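/- Let $m\ge 2$ be an integer, let $\delta>2$ be real, and let $$F:\mathbb C^2\to\mathbb C^2,\qquad F(z,w)=\left(e^{-z^m}+\delta e^{2\pi i/m}\,w,\;z\right).$$ Regard $\mathbb C^2$ as a subset of $\mathbb P^2=\mathbb P^2(\mathbb C)$ through $(z,w)\mapsto[z:w:1]$, let $\ell_\infty=\mathbb P^2\setminus\mathbb C^2$ be the line at infinity, and use on it the coordinate $\zeta\mapsto[\zeta:1:0]$. The Fatou set of $F$ is the set of points that have an open neighbourhood $U$ such that every sequence of iterates $F^n|_U$ has a subsequence converging, uniformly on compact subsets of $U$, to a holomorphic map $U\to\mathbb P^2$; a Fatou component is a connected component of the Fatou set. A limit function on an open set $U$ (a Fatou component, or the union of a cycle of them) is a holomorphic map $h:U\to\mathbb P^2$ such that $F^{n_j}\to h$ uniformly on compact subsets of $U$ for some strictly increasing sequence $(n_j)$; its image $h(U)$ is called a limit set of $U$, and its generic rank is the maximal rank of its differential. A Fatou component is escaping if all its limit sets lie in $\ell_\infty$. A cycle of period $p$ is a set of $p$ distinct Fatou components $\Omega_0,\dots,\Omega_{p-1}$ with $F(\Omega_i)=\Omega_{i+1}$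 (indices modulo $p$). For $0\le j<m$ let $$U_j=\left\{[\zeta:1:0]\;:\;\zeta\in\mathbb C\setminus\{0\},\ \left|\arg\left(\zeta e^{-2\pi i j/m}\right)\right|<\tfrac{\pi}{m}\right\}\subset\ell_\infty ,$$ where $\arg$ takes values in $(-\pi,\pi]$. There exist $m^2$ distinct escaping Fatou components of $F$ that are partitioned into cycles with the following properties. 1. If $m$ is even, there are exactly $m/2$ of these cycles, all of period $2m$. If $m$ is odd, exactly $(m-1)/2$ of these cycles have period $2m$, exactly one has period $m$, and there are no others. 2. On (the union of the components of) each of these cycles there are exactly two limit functions $h_1,h_2$. On each component $\Omega$ of the cycle they are distinct, they are the only limit functions, both have generic rank $1$, and their images lie in $\ell_\infty$. 3. For each component $\Omega$ the limit sets $h_1(\Omega)$ and $h_2(\Omega)$ are hyperbolic (the unit disc is their holomorphic universal covering). They are sectors $h_1(\Omega)=U_j$ and $h_2(\Omega)=U_k$ with $j+k\equiv 1 \pmod m$. They are disjoint if $\Omega$ belongs to a cycle of period $2m$, and they coincide if $\Omega$ belongs to the cycle of period $m$. 4. Let $\Omega_{\rm tot}$ be the union of the $m^2$ components. On $\Omega_{\rm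 tot}$ the map $F$ is holomorphically conjugate to the linear map $L(z,w)=(\delta e^{2\pi i/m}w,z)$: there is a biholomorphic map $\varphi$ from $\Omega_{\rm tot}$ onto an open set $B\subset\mathbb C^2$ such that $F(\Omega_{\rm tot})=\Omega_{\rm tot}$, $L(B)=B$ and $\varphi\circ F=L\circ\varphi$ on $\Omega_{\rm tot}$. 5. Each of the $m^2$ components is biholomorphic to $\mathbb H\times\mathbb H$, where $\mathbb H$ is the upper half-plane. -/

import Mathlib

open Set Filter Topology

noncomputable section

namespace HenonFatou

/-! ### The complex projective plane -/

/-- Homogeneous coordinates. -/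
abbrev E3 : Type := EuclideanSpace ℂ (Fin 3)

/-- The complex projective plane `ℙ²`. -/
abbrev P2 : Type := Projectivization ℂ E3

/-- A line of `ℂ³` as the orthogonal projection of `ℂ³` onto it. -/
def projOp (p : P2) : E3 →L[ℂ] E3 := p.submodule.starProjection

theorem projOp_injective : Function.Injective projOp := by
  intro p q h
  apply Projectivization.submodule_injective
  have h' : p.submodule.starProjection = q.submodule.starProjection := h
  have hp := Submodule.range_starProjection p.submodule
  have hq := Submodule.range_starProjection q.submodule
  rw [h'] at hp
  exact hp.symm.trans hq

/-- The distance on `ℙ²`: the operator norm of the difference of the orthogonal projections,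
i.e. the sine of the angle between the two lines. It induces the usual topology of the
(compact) complex projective plane. -/
instance : MetricSpace P2 := MetricSpace.induced projOp projOp_injective inferInstance

theorem affine_ne_zero (p : ℂ × ℂ) : (!₂[p.1, p.2, 1] : E3) ≠ 0 := by
  intro h
  have h2 := congrArg (fun v : E3 => v 2) h
  simp at h2

/-- The standard embedding `(z, w) ↦ [z : w : 1]` of `ℂ²` in `ℙ²`. -/
def affine (p : ℂ × ℂ) : P2 := Projectivization.mk ℂ !₂[p.1, p.2, 1] (affine_ne_zero p)

/-- The line at infinity, the complement of the affine plane. -/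
def lineAtInfinity : Set P2 := {p | p.rep 2 = 0}

theorem infinity_ne_zero (ζ : ℂ) : (!₂[ζ, 1, 0] : E3) ≠ 0 := by
  intro h
  have h1 := congrArg (fun v : E3 => v 1) h
  simp at h1

/-- The affine coordinate `z / w` on the line at infinity: `ζ ↦ [ζ : 1 : 0]`. -/
def atInfinity (ζ : ℂ) : P2 := Projectivization.mk ℂ !₂[ζ, 1, 0] (infinity_ne_zero ζ)

/-! ### Holomorphic maps to the projective plane and their rank -/

/-- `H` is a holomorphic lift of `h` to `ℂ³ \ {0}` on the set `V`. -/
def IsLift {E : Type*} [NormedAddCommGroup E] [NormedSpace ℂ E]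
    (h : E → P2) (H : E → E3) (V : Set E) : Prop :=
  DifferentiableOn ℂ H V ∧ ∀ x ∈ V, ∃ hx : H x ≠ 0, h x = Projectivization.mk ℂ (H x) hx

/-- `h` is holomorphic as a map from the open set `U` to `ℙ²`: locally it is given by
holomorphic homogeneous coordinates without common zero. -/
def HolomorphicToP2 {E : Type*} [NormedAddCommGroup E] [NormedSpace ℂ E]
    (h : E → P2) (U : Set E) : Prop :=
  ∀ p ∈ U, ∃ V : Set E, IsOpen V ∧ p ∈ V ∧ V ⊆ U ∧ ∃ H : E → E3, IsLift h H V

/-- The differential of `h` at `p` has rank `r`. The tangent space of `ℙ²` at `[H p]` is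
`ℂ³ / ℂ (H p)` (up to a scalar), and the differential of `h` is that of `H` followed by
the quotient map; the rank does not depend on the lift. -/
def HasRankAt (h : ℂ × ℂ → P2) (p : ℂ × ℂ) (r : ℕ) : Prop :=
  ∃ V : Set (ℂ × ℂ), IsOpen V ∧ p ∈ V ∧ ∃ H : ℂ × ℂ → E3, IsLift h H V ∧
    Module.finrank ℂ ((LinearMap.range (fderiv ℂ H p : ℂ × ℂ →ₗ[ℂ] E3)).map
      (Submodule.span ℂ {H p}).mkQ) = r

/-- The (generic) rank of `h` on `U`: the maximal rank of its differential. -/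
def HasGenericRank (h : ℂ × ℂ → P2) (U : Set (ℂ × ℂ)) (r : ℕ) : Prop :=
  IsGreatest {k : ℕ | ∃ p ∈ U, HasRankAt h p k} r

/-! ### Fatou components, limit functions, cycles -/

/-- The subsequence `F^{k 0}, F^{k 1}, …` of iterates of `F` converges to `h`, as maps to `ℙ²`,
uniformly on compact subsets of `U`. -/
def IteratesTendsto (F : ℂ × ℂ → ℂ × ℂ) (k : ℕ → ℕ) (h : ℂ × ℂ → P2) (U : Set (ℂ × ℂ)) : Prop :=
  ∀ K ⊆ U, IsCompact K →
    TendstoUniformlyOn (fun (j : ℕ) (p : ℂ × ℂ) => affine (F^[k j] p)) h atTop K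

/-- The iterates of `F` form a normal family on `U`: every sequence of them has a subsequence
that converges, uniformly on compact subsets, to a holomorphic map from `U` to `ℙ²`. -/
def NormalIterates (F : ℂ × ℂ → ℂ × ℂ) (U : Set (ℂ × ℂ)) : Prop :=
  ∀ k : ℕ → ℕ, ∃ s : ℕ → ℕ, StrictMono s ∧
    ∃ h : ℂ × ℂ → P2, HolomorphicToP2 h U ∧ IteratesTendsto F (k ∘ s) h U

/-- The Fatou set of `F`. -/
def fatouSet (F : ℂ × ℂ → ℂ × ℂ) : Set (ℂ × ℂ) :=
  {p | ∃ U : Set (ℂ × ℂ), IsOpen U ∧ p ∈ U ∧ NormalIterates F U}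

/-- The Fatou components of `F` are the connected components of its Fatou set. -/
def IsFatouComponent (F : ℂ × ℂ → ℂ × ℂ) (Ω : Set (ℂ × ℂ)) : Prop :=
  ∃ p ∈ fatouSet F, Ω = connectedComponentIn (fatouSet F) p

/-- `h` is a limit function of `F` on `Ω` (only the values of `h` on `Ω` matter). -/
def IsLimitFunction (F : ℂ × ℂ → ℂ × ℂ) (Ω : Set (ℂ × ℂ)) (h : ℂ × ℂ → P2) : Prop :=
  HolomorphicToP2 h Ω ∧ ∃ k : ℕ → ℕ, StrictMono k ∧ IteratesTendsto F k h Ω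

/-- All limit functions on `Ω` take their values in the line at infinity. -/
def IsEscaping (F : ℂ × ℂ → ℂ × ℂ) (Ω : Set (ℂ × ℂ)) : Prop :=
  ∀ h : ℂ × ℂ → P2, IsLimitFunction F Ω h → h '' Ω ⊆ lineAtInfinity

/-- `Z` is a cycle of period `p` of Fatou components of `F`: it consists of `p` distinct
components, which `F` permutes cyclically. -/
def IsCycle (F : ℂ × ℂ → ℂ × ℂ) (p : ℕ) (Z : Set (Set (ℂ × ℂ))) : Prop :=
  0 < p ∧ ∃ c : ZMod p → Set (ℂ × ℂ), Function.Injective c ∧ Set.range c = Z ∧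
    (∀ i, IsFatouComponent F (c i)) ∧ ∀ i, F '' c i = c (i + 1)

/-! ### Biholomorphisms, hyperbolic domains, sectors -/

/-- `φ` restricts to a biholomorphic map from the open set `A` onto the open set `B`. -/
def IsBiholomorphic (φ : ℂ × ℂ → ℂ × ℂ) (A B : Set (ℂ × ℂ)) : Prop :=
  IsOpen A ∧ IsOpen B ∧ DifferentiableOn ℂ φ A ∧ BijOn φ A B ∧
    ∃ ψ : ℂ × ℂ → ℂ × ℂ, DifferentiableOn ℂ ψ B ∧ InvOn ψ φ A B

/-- The product of two upper half-planes. -/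
def halfPlaneSq : Set (ℂ × ℂ) := {p | 0 < p.1.im ∧ 0 < p.2.im}

/-- A subset `X` of the line at infinity is a hyperbolic Riemann surface: the unit disc is its
holomorphic universal covering. -/
def IsHyperbolic (X : Set P2) : Prop :=
  X ⊆ lineAtInfinity ∧
    ∃ π : ℂ → P2, HolomorphicToP2 π (Metric.ball 0 1) ∧ SurjOn π (Metric.ball 0 1) X ∧
      ∃ hπ : MapsTo π (Metric.ball 0 1) X, IsCoveringMap (hπ.restrict π (Metric.ball 0 1) X)

/-- The open sector of the complex plane with bisector `arg ζ = 2 π j / m` and amplitude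
`2 π / m`. -/
def sector (m j : ℕ) : Set ℂ :=
  {ζ | ζ ≠ 0 ∧
    |(ζ * Complex.exp (-(2 * Real.pi * j / m) * Complex.I)).arg| < Real.pi / m}

/-- The sector as a subset of the line at infinity. -/
def sectorAtInfinity (m j : ℕ) : Set P2 := atInfinity '' sector m j

/-! ### The maps -/

/-- `F(z, w) = (e^{-z^m} + δ e^{2 π i / m} w, z)`. -/
def henon (m : ℕ) (δ : ℝ) (p : ℂ × ℂ) : ℂ × ℂ :=
  (Complex.exp (-p.1 ^ m) + δ * Complex.exp (2 * Real.pi * Complex.I / m) * p.2, p.1)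

/-- `L(z, w) = (δ e^{2 π i / m} w, z)`. -/
def linearPart (m : ℕ) (δ : ℝ) (p : ℂ × ℂ) : ℂ × ℂ :=
  (δ * Complex.exp (2 * Real.pi * Complex.I / m) * p.2, p.1)

end HenonFatou

end

/-!
Write `a = δ e^{2πi/m}` and let `W_j` be the open sector of amplitude `π/m` and bisector
`e^{2πij/m}`, so that `Re z ^ m > 0` on `W_j` and `a W_j = W_{j+1}`.

**The basins.** On a translate `r e^{2πij/m} + W_j` with `r` large, `|e^{-z^m}| ≤ e^{-r^m}` is
tiny, so `F` is a small perturbation of the linear map `L` there (`henon_mem_absorbing`). Hence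
the rescaled iterates `a⁻ⁿ F²ⁿ` converge on products of two such translates. Call `wave` the limit.
The basin of `(j, k)` is the set of points where the limit exists and lies in `W_j × W_k`. The
limit satisfies `wave ∘ F = L ∘ wave`, and it is close to the identity on the absorbing sets, so
that it is a homeomorphism near infinity by the inverse function theorem for maps approximated by
linear ones. Pulling back by the dynamics makes `wave` a biholomorphism from the basin of `(j, k)`
onto `W_j × W_k` (`isBiholomorphic_wave`), and a power map turns `W_j × W_k` into `ℍ × ℍ`.

**The limit functions.** If `wave p = (u, v)`, then `F²ⁿ p` is asymptotic to `aⁿ (u, v)` and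
`F²ⁿ⁺¹ p` to `aⁿ (a v, u)`. So the even and odd iterates converge to `[u : v : 0]` and
`[a v : u : 0]`, there are no other limits, and the images are the sectors of
indices `j - k` and `1 - (j - k)`, which sum to `1`.

**The basins are Fatou components** (`isFatouComponent_basin`). Basins are open, connected and
contained in the Fatou set; it remains to see that a basin is closed in the Fatou set. Take a
point `q` of the Fatou set in the closure of a basin, and a complex line through `q` and a point
of the basin close to `q`. By normality and the identity theorem, the even and the odd iterates
converge near `q`. Their limits extend the limit functions of the basin, so that they avoid the
point `[1 : 0 : 0]` on a suitable circle of the line about `q`, which bounds there the ratio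
`z_{n+1} / z_n` of the coordinates of the iterates, hence their growth: `|z_n| ≤ A Cⁿ`; the
maximum principle carries the bound to the disc. Since `z_{n+1}` contains the term `e^{-z_n^m}`,
the real part of `z_n ^ m` is at least `-(linear function of n)`. Divided by `δ^{nm}`, these
harmonic functions are almost non-negative, and they have a positive lower bound at the point of
the basin; by Harnack's inequality (`harnack`, which is the Schwarz lemma for the half-plane) they
have one at `q`. The exponential terms along the orbit of `q` are then bounded, so that its
rescaled iterates converge, to a point of some `W_j × W_k`: so `q` is in one of the basins, which
are open and disjoint.

**The cycles.** `F` maps the basin of `(j, k)` onto that of `(k + 1, j)`. An orbit of this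
permutation of `(ℤ/m)²` consists of the pairs with `j - k = d` or `j - k = 1 - d`; its length is
`m` if `2 d = 1` and `2 m` otherwise (`minimalPeriod_step`). As `2 d = 1` has no solution in `ℤ/m`
for even `m` and exactly one for odd `m`, and there are `m²` pairs, the number of cycles follows.
-/

namespace HenonFatou

/-! ### Sectors of the complex plane -/

/-- The open sector of amplitude `π / m` around the positive real axis. -/
def cone (m : ℕ) : Set ℂ := {s | s ≠ 0 ∧ |s.arg| < Real.pi / (2 * m)}

theorem half_angle_bounds {m : ℕ} (hm : 2 ≤ m) :
    0 < Real.pi / (2 * m) ∧ Real.pi / (2 * m) < Real.pi / 2 := by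
  have hm' : (2 : ℝ) ≤ m := by exact_mod_cast hm
  refine ⟨by positivity, ?_⟩
  apply div_lt_div_of_pos_left Real.pi_pos (by norm_num) (by linarith)

/-- The sector is the convex cone between two half-lines. -/
theorem mem_cone_iff {m : ℕ} (hm : 2 ≤ m) {s : ℂ} :
    s ∈ cone m ↔ 0 < s.re ∧ |s.im| < Real.tan (Real.pi / (2 * m)) * s.re := by
  obtain ⟨h1, h2⟩ := half_angle_bounds hm
  have key : 0 < s.re → (|s.arg| < Real.pi / (2 * m) ↔
      |s.im| < Real.tan (Real.pi / (2 * m)) * s.re) := by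
    intro hs
    have ha : |s.arg| < Real.pi / 2 := Complex.abs_arg_lt_pi_div_two_iff.2 (Or.inl hs)
    have ht := Complex.tan_arg s
    have h3 : Real.tan |s.arg| = |s.im| / s.re := by
      rw [← abs_of_pos hs, ← abs_div, ← ht]
      rcases abs_cases s.arg with ⟨h, h'⟩ | ⟨h, h'⟩
      · rw [h, abs_of_nonneg]
        exact Real.tan_nonneg_of_nonneg_of_le_pi_div_two h' (by linarith [abs_lt.1 ha])
      · rw [h, Real.tan_neg, abs_of_nonpos]
        exact Real.tan_nonpos_of_nonpos_of_neg_pi_div_two_le h'.le (by linarith [abs_lt.1 ha])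
    rw [← div_lt_iff₀ hs, ← h3]
    exact (Real.strictMonoOn_tan.lt_iff_lt ⟨by linarith [abs_nonneg s.arg, Real.pi_pos], ha⟩
      ⟨by linarith, h2⟩).symm
  constructor
  · rintro ⟨h0, h⟩
    have hre : 0 < s.re := (Complex.abs_arg_lt_pi_div_two_iff.1 (h.trans h2)).resolve_right h0
    exact ⟨hre, (key hre).1 h⟩
  · rintro ⟨hre, h⟩
    exact ⟨fun h0 => by simp [h0] at hre, (key hre).2 h⟩

theorem isOpen_cone {m : ℕ} (hm : 2 ≤ m) : IsOpen (cone m) := by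
  have : cone m = {s : ℂ | 0 < s.re} ∩
      {s : ℂ | |s.im| < Real.tan (Real.pi / (2 * m)) * s.re} := by
    ext s; exact mem_cone_iff hm
  rw [this]
  exact (isOpen_lt continuous_const Complex.continuous_re).inter
    (isOpen_lt (by fun_prop) (by fun_prop))

theorem cone_add {m : ℕ} (hm : 2 ≤ m) {s t : ℂ} (hs : s ∈ cone m) (ht : t ∈ cone m) :
    s + t ∈ cone m := by
  rw [mem_cone_iff hm] at *
  simp only [Complex.add_re, Complex.add_im]
  exact ⟨by linarith, by rw [mul_add]; linarith [abs_add_le s.im t.im]⟩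

theorem cone_smul {m : ℕ} {s : ℂ} (hs : s ∈ cone m) {t : ℝ} (ht : 0 < t) :
    (t : ℂ) * s ∈ cone m :=
  ⟨mul_ne_zero (by exact_mod_cast ht.ne') hs.1, by rw [Complex.arg_real_mul _ ht]; exact hs.2⟩

theorem one_mem_cone {m : ℕ} (hm : 2 ≤ m) : (1 : ℂ) ∈ cone m :=
  ⟨one_ne_zero, by simpa using (half_angle_bounds hm).1⟩

theorem re_pow_pos_of_mem_cone {m k : ℕ} (hm : 2 ≤ m) (hk : k ≤ m) {s : ℂ} (hs : s ∈ cone m) :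
    0 < (s ^ k).re := by
  have hm' : (2 : ℝ) ≤ m := by exact_mod_cast hm
  have hk' : (k : ℝ) ≤ m := by exact_mod_cast hk
  have h := Complex.norm_mul_exp_arg_mul_I s
  have e : s ^ k = ((‖s‖ ^ k : ℝ) : ℂ) * Complex.exp ((k * s.arg : ℝ) * Complex.I) := by
    conv_lhs => rw [← h]
    rw [mul_pow, ← Complex.exp_nat_mul]
    push_cast; ring_nf
  rw [e, Complex.re_ofReal_mul, Complex.exp_ofReal_mul_I_re]
  have h1 : |(k : ℝ) * s.arg| < Real.pi / 2 := by
    rw [abs_mul, Nat.abs_cast]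
    calc (k : ℝ) * |s.arg| ≤ m * |s.arg| := by gcongr
      _ < m * (Real.pi / (2 * m)) := by gcongr; exact hs.2
      _ = Real.pi / 2 := by field_simp
  have := abs_lt.1 h1
  exact mul_pos (pow_pos (norm_pos_iff.2 hs.1) k) (Real.cos_pos_of_mem_Ioo ⟨this.1, this.2⟩)

/-- Translating by `r > 0` along the bisector gives a lower bound for `Re z ^ m`: all the terms
of the binomial formula have nonnegative real part. -/
theorem pow_le_re_pow {m : ℕ} (hm : 2 ≤ m) {s : ℂ} (hs : s ∈ cone m) {r : ℝ} (hr : 0 ≤ r) :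
    r ^ m ≤ ((s + r) ^ m).re := by
  rw [add_pow, Complex.re_sum, Finset.sum_range_succ']
  have h0 : (s ^ 0 * (r : ℂ) ^ (m - 0) * (m.choose 0 : ℂ)).re = r ^ m := by
    simp [← Complex.ofReal_pow]
  rw [h0]
  refine le_add_of_nonneg_left (Finset.sum_nonneg fun i hi => ?_)
  have hi' : i + 1 ≤ m := Nat.succ_le_of_lt (Finset.mem_range.1 hi)
  have e : s ^ (i + 1) * (r : ℂ) ^ (m - (i + 1)) * (m.choose (i + 1) : ℂ)
      = ((r ^ (m - (i + 1)) * m.choose (i + 1) : ℝ) : ℂ) * s ^ (i + 1) := by push_cast; ring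
  rw [e, Complex.re_ofReal_mul]
  exact mul_nonneg (by positivity) (re_pow_pos_of_mem_cone hm hi' hs).le

theorem pow_cpow_of_mem_cone {m : ℕ} (hm : 2 ≤ m) {s : ℂ} (hs : s ∈ cone m) :
    (s ^ m) ^ ((m : ℂ)⁻¹) = s := by
  have hm' : (2 : ℝ) ≤ m := by exact_mod_cast hm
  have : Real.pi / (2 * m) ≤ Real.pi / m := by
    apply div_le_div_of_nonneg_left Real.pi_pos.le (by linarith) (by linarith)
  have h2 := abs_lt.1 hs.2
  exact Complex.pow_cpow_nat_inv (by omega) (by linarith) (by linarith)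

theorem cpow_mem_cone {m : ℕ} (hm : 2 ≤ m) {u : ℂ} (hu : 0 < u.re) :
    u ^ ((m : ℂ)⁻¹) ∈ cone m := by
  obtain ⟨h1, h2⟩ := half_angle_bounds hm
  have hm' : (2 : ℝ) ≤ m := by exact_mod_cast hm
  have hu0 : u ≠ 0 := fun h => by simp [h] at hu
  have ha : |u.arg| < Real.pi / 2 := Complex.abs_arg_lt_pi_div_two_iff.2 (Or.inl hu)
  have him : (Complex.log u * (m : ℂ)⁻¹).im = u.arg / m := by
    have : (m : ℂ)⁻¹ = ((m : ℝ)⁻¹ : ℝ) := by push_cast; rfl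
    rw [this, Complex.im_mul_ofReal, Complex.log_im]; rfl
  have hb : |u.arg / m| < Real.pi / (2 * m) := by
    rw [abs_div, Nat.abs_cast, div_lt_div_iff₀ (by linarith) (by linarith)]
    nlinarith
  rw [Complex.cpow_def_of_ne_zero hu0]
  refine ⟨Complex.exp_ne_zero _, ?_⟩
  have hb' := abs_lt.1 hb
  rw [Complex.arg_exp, him, toIocMod_eq_self .. |>.2 ⟨by linarith, by linarith⟩]
  exact hb

section Wedge

variable {m : ℕ} [NeZero m]

/-- The root of unity `exp (2 π i j / m)`. -/
noncomputable def rot (m : ℕ) [NeZero m] (j : ZMod m) : ℂ := ZMod.stdAddChar j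

theorem rot_add (j k : ZMod m) : rot m (j + k) = rot m j * rot m k := AddChar.map_add_eq_mul _ _ _

theorem rot_zero : rot m 0 = 1 := AddChar.map_zero_eq_one _

theorem rot_natCast (j : ℕ) : rot m j = Complex.exp (2 * Real.pi * Complex.I * j / m) := by
  have := ZMod.stdAddChar_coe (N := m) (j : ℤ)
  simpa [rot] using this

theorem rot_one : rot m 1 = Complex.exp (2 * Real.pi * Complex.I / m) := by
  simpa using rot_natCast (m := m) 1

theorem rot_mul_neg (j : ZMod m) : rot m j * rot m (-j) = 1 := by
  rw [← rot_add, add_neg_cancel, rot_zero]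

theorem norm_rot (j : ZMod m) : ‖rot m j‖ = 1 := by
  exact Circle.norm_coe _

theorem rot_ne_zero (j : ZMod m) : rot m j ≠ 0 := by
  intro h; simpa [h] using norm_rot j

theorem rot_pow (j : ZMod m) : rot m j ^ m = 1 := by
  rw [rot, ← AddChar.map_nsmul_eq_pow]; simp

theorem rot_natCast_eq_pow (n : ℕ) : rot m (n : ZMod m) = rot m 1 ^ n := by
  rw [rot, rot, ← AddChar.map_nsmul_eq_pow]; simp

theorem exists_rot_of_pow_eq_one {z : ℂ} (hz : z ^ m = 1) : ∃ j : ZMod m, z = rot m j := by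
  obtain ⟨i, -, hi⟩ := (Complex.isPrimitiveRoot_exp m (NeZero.ne m)).eq_pow_of_pow_eq_one hz
  refine ⟨i, ?_⟩
  rw [← hi, rot_natCast, ← Complex.exp_nat_mul]
  congr 1; ring

/-- The sector of amplitude `π / m` with bisector through `exp (2 π i j / m)`. -/
def wedge (m : ℕ) [NeZero m] (j : ZMod m) : Set ℂ := {z | z * rot m (-j) ∈ cone m}

theorem rot_mul_mem_wedge {j : ZMod m} {s : ℂ} : rot m j * s ∈ wedge m j ↔ s ∈ cone m := by
  have : rot m j * s * rot m (-j) = s := by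
    rw [mul_right_comm, rot_mul_neg, one_mul]
  rw [wedge, mem_ofPred_eq, this]

theorem exists_of_mem_wedge {j : ZMod m} {z : ℂ} (hz : z ∈ wedge m j) :
    ∃ s ∈ cone m, z = rot m j * s :=
  ⟨_, hz, by rw [mul_left_comm, rot_mul_neg, mul_one]⟩

theorem rot_mul_mem_wedge_add {i j : ZMod m} {z : ℂ} :
    rot m i * z ∈ wedge m (j + i) ↔ z ∈ wedge m j := by
  have : rot m i * z * rot m (-(j + i)) = z * rot m (-j) := by
    rw [neg_add, rot_add, mul_comm (rot m (-j)), ← mul_assoc, mul_right_comm (rot m i),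
      rot_mul_neg, one_mul]
  rw [wedge, mem_ofPred_eq, this]; rfl

theorem isOpen_wedge (hm : 2 ≤ m) (j : ZMod m) : IsOpen (wedge m j) :=
  (isOpen_cone hm).preimage (by fun_prop)

theorem wedge_add (hm : 2 ≤ m) {j : ZMod m} {s t : ℂ} (hs : s ∈ wedge m j) (ht : t ∈ wedge m j) :
    s + t ∈ wedge m j := by
  simpa only [wedge, mem_ofPred_eq, add_mul] using cone_add hm hs ht

theorem wedge_smul {j : ZMod m} {s : ℂ} (hs : s ∈ wedge m j) {t : ℝ} (ht : 0 < t) :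
    (t : ℂ) * s ∈ wedge m j := by
  simpa only [wedge, mem_ofPred_eq, mul_assoc] using cone_smul hs ht

theorem rot_mem_wedge (hm : 2 ≤ m) (j : ZMod m) : rot m j ∈ wedge m j := by
  simpa using rot_mul_mem_wedge.2 (one_mem_cone hm)

theorem convex_wedge (hm : 2 ≤ m) (j : ZMod m) : Convex ℝ (wedge m j) := by
  refine convex_iff_forall_pos.2 fun x hx y hy a b ha hb _ => ?_
  simp only [Complex.real_smul]
  exact wedge_add hm (wedge_smul hx ha) (wedge_smul hy hb)

theorem ne_zero_of_mem_wedge {j : ZMod m} {z : ℂ} (hz : z ∈ wedge m j) : z ≠ 0 := by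
  rintro rfl; simp [wedge, cone] at hz

theorem pow_rot_mul (j : ZMod m) (s : ℂ) : (rot m j * s) ^ m = s ^ m := by
  rw [mul_pow, rot_pow, one_mul]

theorem re_pow_pos_of_mem_wedge (hm : 2 ≤ m) {j : ZMod m} {z : ℂ} (hz : z ∈ wedge m j) :
    0 < (z ^ m).re := by
  obtain ⟨s, hs, rfl⟩ := exists_of_mem_wedge hz
  rw [pow_rot_mul]; exact re_pow_pos_of_mem_cone hm le_rfl hs

theorem wedge_root (hm : 2 ≤ m) {j : ZMod m} {z : ℂ} (hz : z ∈ wedge m j) :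
    rot m j * (z ^ m) ^ ((m : ℂ)⁻¹) = z := by
  obtain ⟨s, hs, rfl⟩ := exists_of_mem_wedge hz
  rw [pow_rot_mul, pow_cpow_of_mem_cone hm hs]

theorem exists_mem_wedge (hm : 2 ≤ m) {z : ℂ} (hz : 0 < (z ^ m).re) : ∃ j, z ∈ wedge m j := by
  have hs := cpow_mem_cone hm hz
  set s := (z ^ m) ^ ((m : ℂ)⁻¹) with hsdef
  have hsm : s ^ m = z ^ m := Complex.cpow_nat_inv_pow _ (NeZero.ne m)
  have h1 : (z / s) ^ m = 1 := by
    rw [div_pow, hsm, div_self]; intro h; simp [h] at hz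
  obtain ⟨j, hj⟩ := exists_rot_of_pow_eq_one h1
  refine ⟨j, ?_⟩
  rw [(div_eq_iff hs.1).1 hj]
  exact rot_mul_mem_wedge.2 hs

theorem wedge_eq_of_mem (hm : 2 ≤ m) {j k : ZMod m} {z : ℂ} (hj : z ∈ wedge m j)
    (hk : z ∈ wedge m k) : j = k := by
  have h1 := wedge_root hm hj
  have h2 := wedge_root hm hk
  have h0 : (z ^ m) ^ ((m : ℂ)⁻¹) ≠ 0 := fun h => by
    rw [h, mul_zero] at h1; exact ne_zero_of_mem_wedge hj h1.symm
  exact ZMod.injective_stdAddChar (mul_right_cancel₀ h0 (h1.trans h2.symm))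

end Wedge

/-! ### The sectors `U_j` -/

section Sector
variable {m : ℕ} [NeZero m]

theorem mem_sector_iff {j : ℕ} {ζ : ℂ} :
    ζ ∈ sector m j ↔ ζ ≠ 0 ∧ |(ζ * rot m (-(j : ZMod m))).arg| < Real.pi / m := by
  have : rot m (-(j : ZMod m)) = Complex.exp (-(2 * Real.pi * j / m) * Complex.I) := by
    apply mul_left_cancel₀ (rot_ne_zero (j : ZMod m))
    rw [rot_mul_neg, rot_natCast, ← Complex.exp_add]
    ring_nf; simp
  rw [sector, mem_ofPred_eq, this]

/-- The open sector of amplitude `2 π / m` around the positive real axis. -/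
def wideCone (m : ℕ) : Set ℂ := {s | s ≠ 0 ∧ |s.arg| < Real.pi / m}

theorem mem_sector_iff_wideCone {j : ℕ} {ζ : ℂ} :
    ζ ∈ sector m j ↔ ζ * rot m (-(j : ZMod m)) ∈ wideCone m := by
  rw [mem_sector_iff]
  simp [wideCone, rot_ne_zero]

theorem rot_mul_mem_sector {j : ℕ} {s : ℂ} :
    rot m (j : ZMod m) * s ∈ sector m j ↔ s ∈ wideCone m := by
  rw [mem_sector_iff_wideCone, mul_right_comm, rot_mul_neg, one_mul]

theorem disjoint_sector (hm : 2 ≤ m) {i j : ℕ} (h : (i : ZMod m) ≠ j) :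
    Disjoint (sector m i) (sector m j) := by
  rw [Set.disjoint_left]
  intro ζ hi hj
  rw [mem_sector_iff_wideCone] at hi hj
  apply h
  have root : ∀ s ∈ wideCone m, (s ^ m) ^ ((m : ℂ)⁻¹) = s := fun s hs => by
    have h2 := abs_lt.1 hs.2
    exact Complex.pow_cpow_nat_inv (by omega) (by linarith) (by linarith)
  have h1 := root _ hi
  have h2 := root _ hj
  rw [mul_pow, rot_pow] at h1 h2
  have h3 := h1.symm.trans h2
  have h0 : ζ ≠ 0 := by rintro rfl; simp [wideCone] at hi
  exact neg_injective (ZMod.injective_stdAddChar (mul_left_cancel₀ h0 h3))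

theorem div_mem_sector (hm : 2 ≤ m) {j k : ZMod m} {z w : ℂ} (hz : z ∈ wedge m j)
    (hw : w ∈ wedge m k) {d : ℕ} (hd : (d : ZMod m) = j - k) : z / w ∈ sector m d := by
  obtain ⟨s, hs, rfl⟩ := exists_of_mem_wedge hz
  obtain ⟨t, ht, rfl⟩ := exists_of_mem_wedge hw
  have e : rot m j * s / (rot m k * t) = rot m (d : ZMod m) * (s / t) := by
    have : rot m j = rot m (d : ZMod m) * rot m k := by rw [← rot_add, hd]; ring_nf
    rw [this]; field_simp [rot_ne_zero]
  rw [e, rot_mul_mem_sector]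
  refine ⟨div_ne_zero hs.1 ht.1, ?_⟩
  have hm' : (2 : ℝ) ≤ m := by exact_mod_cast hm
  have e2 : Real.pi / (2 * m) + Real.pi / (2 * m) = Real.pi / m := by field_simp; ring
  have h1 := (half_angle_bounds hm).2
  have h2 := abs_lt.1 hs.2
  have h3 := abs_lt.1 ht.2
  have h4 := Real.pi_pos
  have hc : (s / t).arg = s.arg - t.arg := by
    rw [div_eq_mul_inv, Complex.arg_mul hs.1 (inv_ne_zero ht.1), Complex.arg_inv, if_neg]
    · ring
    · linarith
    · rw [Complex.arg_inv, if_neg (by linarith)]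
      exact ⟨by linarith, by linarith⟩
  rw [hc, abs_lt]
  constructor <;> linarith

theorem exists_div_eq_of_mem_sector (hm : 2 ≤ m) {j k : ZMod m} {d : ℕ}
    (hd : (d : ZMod m) = j - k) {ζ : ℂ} (hζ : ζ ∈ sector m d) :
    ∃ z ∈ wedge m j, ∃ w ∈ wedge m k, z / w = ζ := by
  rw [mem_sector_iff_wideCone] at hζ
  set u := ζ * rot m (-(d : ZMod m)) with hu
  have hζu : ζ = rot m (d : ZMod m) * u := by rw [hu, mul_left_comm, rot_mul_neg, mul_one]
  have hm' : (2 : ℝ) ≤ m := by exact_mod_cast hm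
  have h1 := (half_angle_bounds hm).2
  have h2 := abs_lt.1 hζ.2
  have h4 := Real.pi_pos
  have e2 : Real.pi / (2 * m) = Real.pi / m / 2 := by field_simp
  have hn : (0 : ℝ) < ‖u‖ := norm_pos_iff.2 hζ.1
  have harg : ∀ x : ℝ, |x| < Real.pi / m / 2 → Complex.exp (x * Complex.I) ∈ cone m := by
    intro x hx
    have hx' := abs_lt.1 hx
    refine ⟨Complex.exp_ne_zero _, ?_⟩
    rw [Complex.arg_exp_mul_I, (toIocMod_eq_self ..).2 ⟨by linarith, by linarith⟩, e2]
    exact hx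
  refine ⟨rot m j * (‖u‖ * Complex.exp ((u.arg / 2 : ℝ) * Complex.I)),
    rot_mul_mem_wedge.2 (cone_smul (harg _ (abs_lt.2 ⟨by linarith, by linarith⟩)) hn),
    rot m k * Complex.exp ((-(u.arg / 2) : ℝ) * Complex.I),
    rot_mul_mem_wedge.2 (harg _ (abs_lt.2 ⟨by linarith, by linarith⟩)), ?_⟩
  have : rot m j = rot m (d : ZMod m) * rot m k := by rw [← rot_add, hd]; ring_nf
  rw [hζu, this, mul_assoc, mul_left_comm, mul_div_mul_left _ _ (rot_ne_zero k), mul_div_assoc]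
  congr 1
  conv_rhs => rw [← Complex.norm_mul_exp_arg_mul_I u]
  rw [mul_div_assoc, ← Complex.exp_sub]
  push_cast; ring_nf

/-- A sector is biholomorphic to the unit disc, by the Cayley transform followed by the power
`2 / m` of the right half-plane. -/
theorem exists_disc_equiv_sector (hm : 2 ≤ m) (d : ℕ) :
    ∃ f g : ℂ → ℂ, DifferentiableOn ℂ f (Metric.ball 0 1) ∧ ContinuousOn g (sector m d) ∧
      MapsTo f (Metric.ball 0 1) (sector m d) ∧ MapsTo g (sector m d) (Metric.ball 0 1) ∧
      InvOn g f (Metric.ball 0 1) (sector m d) := by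
  have hm' : (2 : ℝ) ≤ m := by exact_mod_cast hm
  have hm0 : (m : ℂ) ≠ 0 := by exact_mod_cast NeZero.ne m
  have hpi := Real.pi_pos
  have hpm : Real.pi / m ≤ Real.pi / 2 :=
    div_le_div_of_nonneg_left hpi.le (by norm_num) hm'
  -- the Cayley transform and its inverse
  let c : ℂ → ℂ := fun t => (1 + t) / (1 - t)
  let c' : ℂ → ℂ := fun u => (u - 1) / (u + 1)
  have hd1 : ∀ t ∈ Metric.ball (0 : ℂ) 1, 1 - t ≠ 0 := fun t ht h => by
    rw [← sub_eq_zero.1 h] at ht; simp at ht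
  have hc1 : ∀ t ∈ Metric.ball (0 : ℂ) 1, 0 < (c t).re := fun t ht => by
    have h0 := Complex.normSq_pos.2 (hd1 t ht)
    have h1 : (c t).re = (1 - Complex.normSq t) / Complex.normSq (1 - t) := by
      simp only [c, Complex.div_re, ← add_div, Complex.normSq_apply t]
      simp; ring
    rw [h1]
    refine div_pos ?_ h0
    have : ‖t‖ < 1 := by simpa using ht
    rw [Complex.normSq_eq_norm_sq]; nlinarith [norm_nonneg t]
  have hc2 : ∀ u : ℂ, 0 < u.re → u + 1 ≠ 0 := fun u hu h => by
    have := congrArg Complex.re h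
    simp at this; linarith
  have hc3 : ∀ u : ℂ, 0 < u.re → c' u ∈ Metric.ball (0 : ℂ) 1 := fun u hu => by
    rw [mem_ball_zero_iff, norm_div, div_lt_one (norm_pos_iff.2 (hc2 u hu)),
      ← sq_lt_sq₀ (norm_nonneg _) (norm_nonneg _), ← Complex.normSq_eq_norm_sq,
      ← Complex.normSq_eq_norm_sq, Complex.normSq_apply, Complex.normSq_apply]
    simp; nlinarith
  -- the power map of exponent `2 / m` of the right half-plane and its inverse
  let e : ℂ → ℂ := fun u => Complex.exp (Complex.log u * (2 / m : ℝ))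
  let e' : ℂ → ℂ := fun s => Complex.exp (Complex.log s * (m / 2 : ℝ))
  have he : ∀ u : ℂ, 0 < u.re → e u ∈ wideCone m ∧ e' (e u) = u := fun u hu => by
    have hu0 : u ≠ 0 := fun h => by simp [h] at hu
    have ha := abs_lt.1 (Complex.abs_arg_lt_pi_div_two_iff.2 (Or.inl hu))
    have him : |(Complex.log u * (2 / m : ℝ)).im| < Real.pi / m := by
      rw [Complex.im_mul_ofReal, Complex.log_im, abs_mul, abs_of_pos (a := (2 / m : ℝ))
        (by positivity), mul_div_assoc', div_lt_div_iff_of_pos_right (by linarith)]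
      linarith [abs_lt.2 ha]
    have him' := abs_lt.1 him
    refine ⟨⟨Complex.exp_ne_zero _, ?_⟩, ?_⟩
    · rw [Complex.arg_exp, (toIocMod_eq_self ..).2 ⟨by linarith, by linarith⟩]
      exact him
    · simp only [e, e']
      rw [Complex.log_exp (by linarith) (by linarith), mul_assoc, ← Complex.ofReal_mul]
      have : (2 / m * (m / 2) : ℝ) = 1 := by field_simp
      rw [this, Complex.ofReal_one, mul_one, Complex.exp_log hu0]
  have he' : ∀ s ∈ wideCone m, 0 < (e' s).re ∧ e (e' s) = s := fun s hs => by
    have him : |(Complex.log s * (m / 2 : ℝ)).im| < Real.pi / 2 := by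
      rw [Complex.im_mul_ofReal, Complex.log_im, abs_mul, abs_of_pos (a := (m / 2 : ℝ))
        (by positivity), mul_div_assoc', div_lt_div_iff_of_pos_right (by norm_num)]
      exact (lt_div_iff₀ (by linarith)).1 hs.2
    have him' := abs_lt.1 him
    constructor
    · simp only [e']
      rw [Complex.exp_re]
      exact mul_pos (Real.exp_pos _) (Real.cos_pos_of_mem_Ioo ⟨him'.1, him'.2⟩)
    · simp only [e, e']
      rw [Complex.log_exp (by linarith) (by linarith), mul_assoc, ← Complex.ofReal_mul]
      have : (m / 2 * (2 / m) : ℝ) = 1 := by field_simp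
      rw [this, Complex.ofReal_one, mul_one, Complex.exp_log hs.1]
  have slit : ∀ s ∈ wideCone m, s ∈ Complex.slitPlane := fun s hs => by
    rw [Complex.mem_slitPlane_iff_arg]
    exact ⟨fun h => by have := abs_lt.1 hs.2; linarith, hs.1⟩
  refine ⟨fun t => rot m (d : ZMod m) * e (c t), fun ζ => c' (e' (ζ * rot m (-(d : ZMod m)))),
    ?_, ?_, ?_, ?_, ?_, ?_⟩
  · refine DifferentiableOn.const_mul (DifferentiableOn.cexp (DifferentiableOn.mul_const
      (DifferentiableOn.clog ?_ ?_) _)) _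
    · exact DifferentiableOn.div (by fun_prop) (by fun_prop) hd1
    · exact fun t ht => Or.inl (hc1 t ht)
  · have h1 : ContinuousOn (fun ζ : ℂ => e' (ζ * rot m (-(d : ZMod m)))) (sector m d) := by
      refine ContinuousOn.cexp (ContinuousOn.mul (ContinuousOn.clog (by fun_prop) ?_)
        continuousOn_const)
      exact fun ζ hζ => slit _ (mem_sector_iff_wideCone.1 hζ)
    exact ContinuousOn.div (h1.sub continuousOn_const) (h1.add continuousOn_const)
      fun ζ hζ => hc2 _ (he' _ (mem_sector_iff_wideCone.1 hζ)).1
  · exact fun t ht => rot_mul_mem_sector.2 (he _ (hc1 t ht)).1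
  · exact fun ζ hζ => hc3 _ (he' _ (mem_sector_iff_wideCone.1 hζ)).1
  · intro t ht
    have h1 : rot m (d : ZMod m) * e (c t) * rot m (-(d : ZMod m)) = e (c t) := by
      rw [mul_right_comm, rot_mul_neg, one_mul]
    have h2 := hd1 t ht
    have h3 := hc2 _ (hc1 t ht)
    simp only [h1, (he _ (hc1 t ht)).2, c']
    rw [div_eq_iff h3]
    simp only [c]
    field_simp; ring
  · intro ζ hζ
    obtain ⟨h1, h2⟩ := he' _ (mem_sector_iff_wideCone.1 hζ)
    set u := e' (ζ * rot m (-(d : ZMod m))) with hu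
    have h3 := hc2 u h1
    have h4 : c (c' u) = u := by
      have := hd1 _ (hc3 u h1)
      simp only [c]
      rw [div_eq_iff this]
      simp only [c']
      field_simp; ring
    change rot m (d : ZMod m) * e (c (c' u)) = ζ
    rw [h4, h2, mul_left_comm, rot_mul_neg, mul_one]

end Sector

/-! ### The metric of the projective plane -/

theorem projOp_mk_apply (v : E3) (hv : v ≠ 0) (x : E3) :
    projOp (Projectivization.mk ℂ v hv) x = (inner ℂ v x / ((‖v‖ ^ 2 : ℝ) : ℂ)) • v := by
  have : (Projectivization.mk ℂ v hv).submodule = Submodule.span ℂ {v} :=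
    Projectivization.submodule_mk v hv
  simp only [projOp, this]
  rw [Submodule.starProjection_singleton]
  rfl

theorem dist_eq_norm_projOp (p q : P2) : dist p q = ‖projOp p - projOp q‖ := by
  rw [← dist_eq_norm]; rfl

/-- The matrix coefficients of the orthogonal projection onto a line. -/
noncomputable def entry (i j : Fin 3) (p : P2) : ℂ := projOp p (EuclideanSpace.single j 1) i

theorem entry_mk (i j : Fin 3) (v : E3) (hv : v ≠ 0) :
    entry i j (Projectivization.mk ℂ v hv) = (starRingEnd ℂ (v j)) * v i / ((‖v‖ ^ 2 : ℝ) : ℂ) := by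
  rw [entry, projOp_mk_apply, EuclideanSpace.inner_single_right]
  simp
  ring

theorem dist_entry_le (i j : Fin 3) (p q : P2) : dist (entry i j p) (entry i j q) ≤ dist p q := by
  rw [dist_eq_norm, dist_eq_norm_projOp]
  have h1 : entry i j p - entry i j q = ((projOp p - projOp q) (EuclideanSpace.single j 1)) i := by
    simp [entry]
  rw [h1]
  calc _ ≤ ‖(projOp p - projOp q) (EuclideanSpace.single j 1)‖ := PiLp.norm_apply_le _ i
    _ ≤ ‖projOp p - projOp q‖ * ‖(EuclideanSpace.single j 1 : E3)‖ :=
        ContinuousLinearMap.le_opNorm _ _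
    _ = _ := by simp

theorem continuous_entry (i j : Fin 3) : Continuous (entry i j) :=
  (LipschitzWith.of_dist_le' (K := 1) fun p q => by
    simpa using dist_entry_le i j p q).continuous

/-- Upper bound for the distance of two points of `ℙ²` in terms of homogeneous coordinates. -/
theorem dist_mk_le (v w : E3) (hv : v ≠ 0) (hw : w ≠ 0) :
    dist (Projectivization.mk ℂ v hv) (Projectivization.mk ℂ w hw) ≤ 4 * ‖v - w‖ / ‖w‖ := by
  have hv' := norm_pos_iff.2 hv
  have hw' := norm_pos_iff.2 hw
  set a : E3 := ((‖v‖⁻¹ : ℝ) : ℂ) • v with ha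
  set b : E3 := ((‖w‖⁻¹ : ℝ) : ℂ) • w with hb
  have na : ‖a‖ = 1 := by
    rw [ha, norm_smul, Complex.norm_real, norm_inv, norm_norm, inv_mul_cancel₀ hv'.ne']
  have nb : ‖b‖ = 1 := by
    rw [hb, norm_smul, Complex.norm_real, norm_inv, norm_norm, inv_mul_cancel₀ hw'.ne']
  have proj : ∀ (u : E3) (hu : u ≠ 0) (x : E3), projOp (Projectivization.mk ℂ u hu) x
      = inner ℂ (((‖u‖⁻¹ : ℝ) : ℂ) • u) x • (((‖u‖⁻¹ : ℝ) : ℂ) • u) := by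
    intro u hu x
    rw [projOp_mk_apply, inner_smul_left, smul_smul, Complex.conj_ofReal]
    congr 1
    push_cast
    field_simp
  have hab : ‖a - b‖ ≤ 2 * ‖v - w‖ / ‖w‖ := by
    have e : a - b = ((‖v‖⁻¹ - ‖w‖⁻¹ : ℝ) : ℂ) • v + ((‖w‖⁻¹ : ℝ) : ℂ) • (v - w) := by
      rw [ha, hb]; push_cast; module
    rw [e]
    refine (norm_add_le _ _).trans ?_
    rw [norm_smul, norm_smul, Complex.norm_real, Complex.norm_real, norm_inv, norm_norm]
    have e2 : ‖(‖v‖⁻¹ - ‖w‖⁻¹ : ℝ)‖ * ‖v‖ = |‖w‖ - ‖v‖| / ‖w‖ := by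
      rw [Real.norm_eq_abs, inv_sub_inv hv'.ne' hw'.ne', abs_div, abs_of_pos (mul_pos hv' hw')]
      field_simp
    rw [e2, abs_sub_comm]
    have := abs_norm_sub_norm_le v w
    calc _ ≤ ‖v - w‖ / ‖w‖ + ‖w‖⁻¹ * ‖v - w‖ := by gcongr
      _ = _ := by ring
  rw [dist_eq_norm_projOp]
  refine ContinuousLinearMap.opNorm_le_bound _ (by positivity) fun x => ?_
  rw [_root_.sub_apply, proj v hv, proj w hw, ← ha, ← hb]
  have e : inner ℂ a x • a - inner ℂ b x • b = inner ℂ (a - b) x • a + inner ℂ b x • (a - b) := by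
    rw [inner_sub_left]; module
  rw [e]
  calc _ ≤ ‖inner ℂ (a - b) x‖ * ‖a‖ + ‖inner ℂ b x‖ * ‖a - b‖ := by
        refine (norm_add_le _ _).trans ?_
        exact add_le_add (norm_smul_le _ _) (norm_smul_le _ _)
    _ ≤ (‖a - b‖ * ‖x‖) * ‖a‖ + (‖b‖ * ‖x‖) * ‖a - b‖ := by
        gcongr <;> exact norm_inner_le_norm _ _
    _ = 2 * ‖a - b‖ * ‖x‖ := by rw [na, nb]; ring
    _ ≤ 2 * (2 * ‖v - w‖ / ‖w‖) * ‖x‖ := by gcongr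
    _ = _ := by ring

theorem mk_mem_lineAtInfinity {v : E3} {hv : v ≠ 0} :
    Projectivization.mk ℂ v hv ∈ lineAtInfinity ↔ v 2 = 0 := by
  obtain ⟨a, ha⟩ := Projectivization.exists_smul_eq_mk_rep ℂ v hv
  rw [lineAtInfinity, mem_ofPred_eq, ← ha]
  change (a : ℂ) * v 2 = 0 ↔ _
  simp

theorem atInfinity_mem_lineAtInfinity (ζ : ℂ) : atInfinity ζ ∈ lineAtInfinity := by
  rw [atInfinity, mk_mem_lineAtInfinity]; simp

theorem entry_atInfinity_ne_zero (ζ : ℂ) : entry 1 1 (atInfinity ζ) ≠ 0 := by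
  rw [atInfinity, entry_mk]
  refine div_ne_zero (by simp) ?_
  have := norm_ne_zero_iff.2 (infinity_ne_zero ζ)
  exact_mod_cast pow_ne_zero 2 this

theorem entry_div_entry_atInfinity (ζ : ℂ) :
    entry 0 1 (atInfinity ζ) / entry 1 1 (atInfinity ζ) = ζ := by
  have h := entry_atInfinity_ne_zero ζ
  rw [div_eq_iff h, atInfinity, entry_mk, entry_mk]
  simp; ring

theorem atInfinity_injective : Function.Injective atInfinity := fun a b h => by
  rw [← entry_div_entry_atInfinity a, h, entry_div_entry_atInfinity]

theorem mk_eq_atInfinity {x y : ℂ} (hy : y ≠ 0) (h : (!₂[x, y, 0] : E3) ≠ 0) :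
    Projectivization.mk ℂ !₂[x, y, 0] h = atInfinity (x / y) := by
  rw [atInfinity, Projectivization.mk_eq_mk_iff']
  refine ⟨y, ?_⟩
  ext i; fin_cases i <;> simp [mul_div_cancel₀ _ hy]

theorem differentiableOn_vec3 {E : Type*} [NormedAddCommGroup E] [NormedSpace ℂ E]
    {f₀ f₁ f₂ : E → ℂ} {s : Set E} (h₀ : DifferentiableOn ℂ f₀ s) (h₁ : DifferentiableOn ℂ f₁ s)
    (h₂ : DifferentiableOn ℂ f₂ s) :
    DifferentiableOn ℂ (fun x => (!₂[f₀ x, f₁ x, f₂ x] : E3)) s := by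
  rw [differentiableOn_euclidean]
  intro i; fin_cases i <;> simpa

theorem isCoveringMap_of_homeomorph {X Y : Type*} [TopologicalSpace X] [TopologicalSpace Y]
    (e : X ≃ₜ Y) : IsCoveringMap e := fun y =>
  IsEvenlyCovered.to_isEvenlyCovered_preimage (I := Unit)
    ⟨inferInstance, univ, mem_univ y, isOpen_univ, by simp,
      (Homeomorph.Set.univ X).trans (e.trans ((Homeomorph.Set.univ Y).symm.trans
        (Homeomorph.prodPUnit _).symm)), fun _ => rfl⟩

theorem isHyperbolic_sectorAtInfinity {m : ℕ} [NeZero m] (hm : 2 ≤ m) (d : ℕ) :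
    IsHyperbolic (sectorAtInfinity m d) := by
  obtain ⟨f, g, hf, hg, hfm, hgm, hinv⟩ := exists_disc_equiv_sector hm d
  have hlift : IsLift (fun t => atInfinity (f t)) (fun t => !₂[f t, 1, 0]) (Metric.ball 0 1) :=
    ⟨differentiableOn_vec3 hf (by fun_prop) (by fun_prop),
      fun t _ => ⟨infinity_ne_zero _, rfl⟩⟩
  have hmaps : MapsTo (fun t => atInfinity (f t)) (Metric.ball 0 1) (sectorAtInfinity m d) :=
    fun t ht => mem_image_of_mem _ (hfm ht)
  refine ⟨?_, fun t => atInfinity (f t), ?_, ?_, hmaps, ?_⟩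
  · rintro _ ⟨ζ, -, rfl⟩; exact atInfinity_mem_lineAtInfinity ζ
  · exact fun p hp => ⟨_, Metric.isOpen_ball, hp, Subset.rfl, _, hlift⟩
  · rintro _ ⟨ζ, hζ, rfl⟩
    exact ⟨g ζ, hgm hζ, congrArg atInfinity (hinv.2 hζ)⟩
  · have hat : Continuous atInfinity := by
      rw [continuous_iff_continuousAt]
      intro ζ
      have hn := norm_pos_iff.2 (infinity_ne_zero ζ)
      rw [ContinuousAt, tendsto_iff_dist_tendsto_zero]
      refine squeeze_zero (fun _ => dist_nonneg)
        (fun ξ => dist_mk_le _ _ (infinity_ne_zero ξ) (infinity_ne_zero ζ)) ?_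
      have : Continuous fun ξ : ℂ =>
          4 * ‖(!₂[ξ, 1, 0] : E3) - !₂[ζ, 1, 0]‖ / ‖(!₂[ζ, 1, 0] : E3)‖ := by
        have h1 : Continuous fun ξ : ℂ => (!₂[ξ, 1, 0] : E3) := by
          refine (PiLp.continuous_toLp 2 _).comp (continuous_pi fun i => ?_)
          fin_cases i <;> simp <;> fun_prop
        fun_prop
      simpa using this.tendsto ζ
    -- the inverse homeomorphism
    let e : Metric.ball (0 : ℂ) 1 ≃ₜ sectorAtInfinity m d :=
      { toFun := hmaps.restrict
        invFun := fun p => ⟨g (entry 0 1 p.1 / entry 1 1 p.1), by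
          obtain ⟨_, ζ, hζ, rfl⟩ := p
          rw [entry_div_entry_atInfinity]; exact hgm hζ⟩
        left_inv := fun t => by
          apply Subtype.ext
          change g (entry 0 1 (atInfinity (f t)) / entry 1 1 (atInfinity (f t))) = t
          rw [entry_div_entry_atInfinity]; exact hinv.1 t.2
        right_inv := fun p => by
          obtain ⟨_, ζ, hζ, rfl⟩ := p
          apply Subtype.ext
          change atInfinity (f (g (entry 0 1 (atInfinity ζ) / entry 1 1 (atInfinity ζ)))) = _
          rw [entry_div_entry_atInfinity, hinv.2 hζ]
        continuous_toFun :=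
          (hat.comp_continuousOn hf.continuousOn).mapsToRestrict hmaps
        continuous_invFun := by
          refine Continuous.subtype_mk (hg.comp_continuous ?_ ?_) _
          · refine Continuous.div ((continuous_entry 0 1).comp continuous_subtype_val)
              ((continuous_entry 1 1).comp continuous_subtype_val) ?_
            rintro ⟨_, ζ, hζ, rfl⟩
            exact entry_atInfinity_ne_zero ζ
          · rintro ⟨_, ζ, hζ, rfl⟩
            rw [entry_div_entry_atInfinity]; exact hζ }
    exact isCoveringMap_of_homeomorph e

/-! ### Holomorphic maps to the projective plane -/

section Holomorphic

variable {E : Type*} [NormedAddCommGroup E] [NormedSpace ℂ E]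

/-- The identity theorem on a convex open set, by restriction to complex lines. -/
theorem eqOn_zero_of_convex {f : E → ℂ} {V O : Set E} (hV : IsOpen V) (hVc : Convex ℝ V)
    (hf : DifferentiableOn ℂ f V) (hO : IsOpen O) (hOV : (O ∩ V).Nonempty)
    (h0 : ∀ x ∈ O ∩ V, f x = 0) : ∀ x ∈ V, f x = 0 := by
  obtain ⟨q, hqO, hqV⟩ := hOV
  intro x hx
  let l : ℂ → E := fun t => q + t • (x - q)
  have hl : Continuous l := by fun_prop
  have hD : IsOpen (l ⁻¹' V) := hV.preimage hl
  have hDc : Convex ℝ (l ⁻¹' V) := by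
    intro s hs t ht a b ha hb hab
    have : l (a • s + b • t) = a • l s + b • l t := by
      have hq : a • q + b • q = q := by rw [← add_smul, hab, one_smul]
      simp only [l, smul_add, add_smul, smul_assoc]
      rw [add_add_add_comm, hq]
    rw [mem_preimage, this]
    exact hVc hs ht ha hb hab
  have hfl : DifferentiableOn ℂ (f ∘ l) (l ⁻¹' V) :=
    hf.comp (by fun_prop) (mapsTo_preimage l V)
  have hA := hfl.analyticOnNhd hD
  have h0l : l 0 = q := by simp [l]
  have h1l : l 1 = x := by simp [l]
  have hz : (0 : ℂ) ∈ l ⁻¹' V := by rw [mem_preimage, h0l]; exact hqV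
  have hev : f ∘ l =ᶠ[𝓝 0] 0 := by
    have : l ⁻¹' (O ∩ V) ∈ 𝓝 (0 : ℂ) :=
      ((hO.inter hV).preimage hl).mem_nhds (by rw [mem_preimage, h0l]; exact ⟨hqO, hqV⟩)
    filter_upwards [this] with t ht using h0 _ ht
  have := hA.eqOn_zero_of_preconnected_of_eventuallyEq_zero hDc.isPreconnected hz hev
    (show (1 : ℂ) ∈ l ⁻¹' V by rw [mem_preimage, h1l]; exact hx)
  simpa [h1l] using this

theorem mk_eq_mk_iff_cross {v w : E3} (hv : v ≠ 0) (hw : w ≠ 0) :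
    Projectivization.mk ℂ v hv = Projectivization.mk ℂ w hw ↔
      ∀ i j, v i * w j - v j * w i = 0 := by
  rw [Projectivization.mk_eq_mk_iff']
  constructor
  · rintro ⟨a, rfl⟩ i j
    simp; ring
  · intro h
    obtain ⟨j, hj⟩ : ∃ j, w j ≠ 0 := by
      by_contra hcon; push Not at hcon
      exact hw (by ext i; simpa using hcon i)
    refine ⟨v j / w j, ?_⟩
    ext i
    have := h i j
    simp only [PiLp.smul_apply, smul_eq_mul]
    field_simp
    linear_combination -this

/-- The identity theorem for holomorphic maps to `ℙ²`. -/
theorem HolomorphicToP2.eqOn_of_eqOn_open {h h' : E → P2} {U O : Set E}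
    (hU : IsPreconnected U) (hh : HolomorphicToP2 h U) (hh' : HolomorphicToP2 h' U)
    (hO : IsOpen O) (hOU : (U ∩ O).Nonempty) (heq : EqOn h h' O) : EqOn h h' U := by
  set W := interior {x | h x = h' x} with hW
  have hOW : O ⊆ W := interior_maximal heq hO
  have : U ⊆ W := by
    refine hU.subset_of_closure_inter_subset isOpen_interior
      (hOU.mono (inter_subset_inter_right _ hOW)) ?_
    rintro x ⟨hxc, hxU⟩
    obtain ⟨V, hVo, hxV, -, H, hHd, hH⟩ := hh x hxU
    obtain ⟨V', hVo', hxV', -, H', hHd', hH'⟩ := hh' x hxU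
    obtain ⟨r, hr, hball⟩ := Metric.isOpen_iff.1 (hVo.inter hVo') x ⟨hxV, hxV'⟩
    have hB := fun y (hy : y ∈ Metric.ball x r) => hball hy
    have hzero : ∀ i j, ∀ y ∈ Metric.ball x r, H y i * H' y j - H y j * H' y i = 0 := by
      intro i j
      refine eqOn_zero_of_convex (O := W) Metric.isOpen_ball (convex_ball x r) ?_ isOpen_interior
        ?_ ?_
      · have d := fun i => (differentiableOn_euclidean.1 hHd i).mono fun y hy => (hB y hy).1
        have d' := fun i => (differentiableOn_euclidean.1 hHd' i).mono fun y hy => (hB y hy).2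
        exact ((d i).mul (d' j)).sub ((d j).mul (d' i))
      · rw [inter_comm]
        exact mem_closure_iff.1 hxc _ Metric.isOpen_ball (Metric.mem_ball_self hr)
      · rintro y ⟨hyW, hyB⟩
        obtain ⟨hy0, hy1⟩ := hH y (hB y hyB).1
        obtain ⟨hy0', hy1'⟩ := hH' y (hB y hyB).2
        have hyW' : h y = h' y := interior_subset (s := {x | h x = h' x}) hyW
        rw [hy1, hy1'] at hyW'
        exact (mk_eq_mk_iff_cross hy0 hy0').1 hyW' i j
    refine mem_interior.2 ⟨Metric.ball x r, fun y hy => ?_, Metric.isOpen_ball,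
      Metric.mem_ball_self hr⟩
    obtain ⟨hy0, hy1⟩ := hH y (hB y hy).1
    obtain ⟨hy0', hy1'⟩ := hH' y (hB y hy).2
    rw [mem_ofPred_eq, hy1, hy1', mk_eq_mk_iff_cross hy0 hy0']
    exact fun i j => hzero i j y hy
  exact fun x hx => interior_subset (s := {x | h x = h' x}) (this hx)

end Holomorphic

/-! ### Rank of maps to the line at infinity -/

/-- The plane of vectors with last coordinate `0` has a line as its quotient by `v`. -/
theorem finrank_map_mkQ_le_one {W : Submodule ℂ E3} {v : E3} (hv : v ≠ 0) (hv2 : v 2 = 0)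
    (hW : ∀ w ∈ W, w 2 = 0) :
    Module.finrank ℂ (W.map (Submodule.span ℂ {v}).mkQ) ≤ 1 := by
  -- one of the first two coordinates of `v` is nonzero, so some `e` completes `v` to a basis
  obtain ⟨e, he⟩ : ∃ e : E3, ∀ w : E3, w 2 = 0 → ∃ a b : ℂ, w = a • v + b • e := by
    by_cases h0 : v 0 = 0
    · have h1 : v 1 ≠ 0 := fun h1 => hv (by ext i; fin_cases i <;> simp [h0, h1, hv2])
      refine ⟨!₂[1, 0, 0], fun w hw => ⟨w 1 / v 1, w 0, ?_⟩⟩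
      ext i; fin_cases i <;> simp [h0, h1, hv2, hw]
    · refine ⟨!₂[0, 1, 0], fun w hw => ⟨w 0 / v 0, w 1 - w 0 / v 0 * v 1, ?_⟩⟩
      ext i; fin_cases i <;> simp [h0, hv2, hw]
  have hle : W.map (Submodule.span ℂ {v}).mkQ ≤
      Submodule.span ℂ {(Submodule.span ℂ {v}).mkQ e} := by
    rintro _ ⟨w, hw, rfl⟩
    obtain ⟨a, b, rfl⟩ := he w (hW w hw)
    rw [map_add, map_smul, map_smul]
    have : (Submodule.span ℂ {v}).mkQ v = 0 := by simp [Submodule.mem_span_singleton_self]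
    rw [this, smul_zero, zero_add]
    exact Submodule.smul_mem _ _ (Submodule.mem_span_singleton_self _)
  exact (Submodule.finrank_mono hle).trans ((finrank_span_le_card _).trans (by
    rw [Set.toFinset_singleton]; simp))

theorem one_le_finrank_map_mkQ {W : Submodule ℂ E3} {v : E3} {w : E3} (hw : w ∈ W)
    (h : w ∉ Submodule.span ℂ {v}) :
    1 ≤ Module.finrank ℂ (W.map (Submodule.span ℂ {v}).mkQ) := by
  rw [Nat.one_le_iff_ne_zero]
  intro h0
  rw [Submodule.finrank_eq_zero] at h0
  have : (Submodule.span ℂ {v}).mkQ w ∈ W.map (Submodule.span ℂ {v}).mkQ :=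
    Submodule.mem_map_of_mem hw
  rw [h0, Submodule.mem_bot] at this
  exact h (by simpa using this)

/-- A map with values in the line at infinity has rank at most `1`. -/
theorem HasRankAt.le_one {h : ℂ × ℂ → P2} {Ω : Set (ℂ × ℂ)} (hΩ : IsOpen Ω)
    (hh : h '' Ω ⊆ lineAtInfinity) {p : ℂ × ℂ} (hp : p ∈ Ω) {k : ℕ} (hk : HasRankAt h p k) :
    k ≤ 1 := by
  obtain ⟨V, hVo, hpV, H, ⟨hHd, hH⟩, rfl⟩ := hk
  have hz : ∀ y ∈ V ∩ Ω, H y 2 = 0 := fun y hy => by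
    obtain ⟨hy0, hy1⟩ := hH y hy.1
    have := hh (mem_image_of_mem h hy.2)
    rwa [hy1, mk_mem_lineAtInfinity] at this
  obtain ⟨hp0, -⟩ := hH p hpV
  refine finrank_map_mkQ_le_one hp0 (hz p ⟨hpV, hp⟩) ?_
  rintro _ ⟨x, rfl⟩
  have hd : HasFDerivAt H (fderiv ℂ H p) p := ((hHd p hpV).differentiableAt
    (hVo.mem_nhds hpV)).hasFDerivAt
  have hd2 := (EuclideanSpace.proj (𝕜 := ℂ) (2 : Fin 3)).hasFDerivAt.comp p hd
  have hc : HasFDerivAt (fun y => H y 2) (0 : ℂ × ℂ →L[ℂ] ℂ) p := by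
    refine (hasFDerivAt_const (0 : ℂ) p).congr_of_eventuallyEq ?_
    filter_upwards [(hVo.inter hΩ).mem_nhds ⟨hpV, hp⟩] with y hy using hz y hy
  have := hd2.unique hc
  exact congrArg (fun T => T x) this

/-! ### Locally uniform limits of holomorphic maps of several variables -/

section Limits

variable {E G : Type*} [NormedAddCommGroup E] [NormedSpace ℂ E] [NormedAddCommGroup G]
  [NormedSpace ℂ G]

/-- Cauchy estimate for the derivative. -/
theorem norm_fderiv_le_of_bound {f : E → G} {c : E} {R C : ℝ} (hR : 0 < R)
    (hf : DifferentiableOn ℂ f (Metric.ball c R)) (hC : ∀ y ∈ Metric.ball c R, ‖f y‖ ≤ C) :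
    ‖fderiv ℂ f c‖ ≤ 2 * C / R := by
  refine Complex.norm_fderiv_le_div_of_mapsTo_ball hf (fun y hy => ?_) hR
  rw [Metric.mem_closedBall, dist_eq_norm]
  linarith [norm_sub_le (f y) (f c), hC y hy, hC c (Metric.mem_ball_self hR)]

theorem differentiableOn_of_tendstoUniformlyOn [CompleteSpace G] {f : ℕ → E → G} {g : E → G}
    {U : Set E} (hU : IsOpen U) (hf : ∀ n, DifferentiableOn ℂ (f n) U)
    (hfg : TendstoUniformlyOn f g atTop U) : DifferentiableOn ℂ g U := by
  intro x hx
  obtain ⟨R, hR, hball⟩ := Metric.isOpen_iff.1 hU x hx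
  have hsub : ∀ y ∈ Metric.ball x (R / 2), Metric.ball y (R / 2) ⊆ U := fun y hy z hz => by
    apply hball
    rw [Metric.mem_ball] at *
    linarith [dist_triangle z y x]
  have hcau : UniformCauchySeqOn (fun n => fderiv ℂ (f n)) atTop (Metric.ball x (R / 2)) := by
    rw [Metric.uniformCauchySeqOn_iff]
    intro ε hε
    obtain ⟨N, hN⟩ := Metric.uniformCauchySeqOn_iff.1 hfg.uniformCauchySeqOn (ε * R / 8)
      (by positivity)
    refine ⟨N, fun n hn k hk y hy => ?_⟩
    have hd : ∀ n, DifferentiableAt ℂ (f n) y := fun n => (hf n).differentiableAt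
      (hU.mem_nhds (hsub y hy (Metric.mem_ball_self (by linarith))))
    rw [dist_eq_norm, ← fderiv_sub (hd n) (hd k)]
    have := norm_fderiv_le_of_bound (f := f n - f k) (c := y) (R := R / 2) (C := ε * R / 8)
      (by linarith) (((hf n).sub (hf k)).mono (hsub y hy)) fun z hz => by
        have := hN n hn k hk z (hsub y hy hz)
        rw [dist_eq_norm] at this
        exact this.le
    refine this.trans_lt ?_
    have : 2 * (ε * R / 8) / (R / 2) = ε / 2 := by field_simp; ring
    linarith
  have hlim : ∀ y ∈ Metric.ball x (R / 2),
      ∃ T, Tendsto (fun n => fderiv ℂ (f n) y) atTop (𝓝 T) := fun y hy =>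
    cauchySeq_tendsto_of_complete (hcau.cauchySeq hy)
  choose! T hT using hlim
  have hunif := hcau.tendstoUniformlyOn_of_tendsto hT
  have hsubU : Metric.ball x (R / 2) ⊆ U := fun y hy =>
    hsub y hy (Metric.mem_ball_self (by linarith))
  exact (hasFDerivAt_of_tendstoUniformlyOn Metric.isOpen_ball hunif
    (fun n y hy => ((hf n).differentiableAt (hU.mem_nhds (hsubU hy))).hasFDerivAt)
    (fun y hy => hfg.tendsto_at (hsubU hy))
    (Metric.mem_ball_self (by linarith))).differentiableAt.differentiableWithinAt

end Limits

/-! ### The map, its inverse and the index permutation -/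

/-- The multiplier `a = δ e^{2 π i / m}`, so that the square of the linear part is `a • id`. -/
noncomputable def mult (m : ℕ) (δ : ℝ) : ℂ := δ * Complex.exp (2 * Real.pi * Complex.I / m)

theorem henon_apply (m : ℕ) (δ : ℝ) (p : ℂ × ℂ) :
    henon m δ p = (Complex.exp (-p.1 ^ m) + mult m δ * p.2, p.1) := rfl

theorem linearPart_apply (m : ℕ) (δ : ℝ) (p : ℂ × ℂ) :
    linearPart m δ p = (mult m δ * p.2, p.1) := rfl

theorem norm_mult (m : ℕ) {δ : ℝ} (hδ : 2 < δ) : ‖mult m δ‖ = δ := by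
  have : (2 * Real.pi * Complex.I / m : ℂ) = ((2 * Real.pi / m : ℝ) : ℂ) * Complex.I := by
    push_cast; ring
  rw [mult, norm_mul, this, Complex.norm_exp_ofReal_mul_I, Complex.norm_real, mul_one,
    Real.norm_eq_abs, abs_of_pos (by linarith)]

theorem mult_ne_zero (m : ℕ) {δ : ℝ} (hδ : 2 < δ) : mult m δ ≠ 0 := by
  rw [← norm_pos_iff, norm_mult m hδ]; linarith

theorem mult_eq (m : ℕ) [NeZero m] (δ : ℝ) : mult m δ = δ * rot m 1 := by rw [rot_one]; rfl

/-- The inverse of `henon`. -/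
noncomputable def henonInv (m : ℕ) (δ : ℝ) (p : ℂ × ℂ) : ℂ × ℂ :=
  (p.2, (p.1 - Complex.exp (-p.2 ^ m)) / mult m δ)

theorem leftInverse_henonInv (m : ℕ) {δ : ℝ} (hδ : 2 < δ) :
    Function.LeftInverse (henonInv m δ) (henon m δ) := fun p => by
  have := mult_ne_zero m hδ
  ext
  · rfl
  · simp [henonInv, henon_apply, this]

theorem rightInverse_henonInv (m : ℕ) {δ : ℝ} (hδ : 2 < δ) :
    Function.RightInverse (henonInv m δ) (henon m δ) := fun p => by
  have := mult_ne_zero m hδ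
  ext
  · simp only [henonInv, henon_apply]; field_simp; ring
  · rfl

theorem differentiable_henon (m : ℕ) (δ : ℝ) : Differentiable ℂ (henon m δ) := by
  have : henon m δ = fun p => (Complex.exp (-p.1 ^ m) + mult m δ * p.2, p.1) := rfl
  rw [this]; fun_prop

theorem differentiable_henonInv (m : ℕ) (δ : ℝ) : Differentiable ℂ (henonInv m δ) := by
  have : henonInv m δ = fun p => (p.2, (p.1 - Complex.exp (-p.2 ^ m)) * (mult m δ)⁻¹) := rfl
  rw [this]; fun_prop

theorem differentiable_iterate {E : Type*} [NormedAddCommGroup E] [NormedSpace ℂ E] {f : E → E}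
    (hf : Differentiable ℂ f) (n : ℕ) : Differentiable ℂ f^[n] := by
  induction n with
  | zero => exact differentiable_id
  | succ n ih => rw [Function.iterate_succ]; exact ih.comp hf

/-- The action of `henon` on the indices of the products of sectors. -/
def step {m : ℕ} (x : ZMod m × ZMod m) : ZMod m × ZMod m := (x.2 + 1, x.1)

theorem step_iterate_two_mul {m : ℕ} (x : ZMod m × ZMod m) (n : ℕ) :
    step^[2 * n] x = (x.1 + n, x.2 + n) := by
  induction n with
  | zero => simp
  | succ n ih =>
    rw [show 2 * (n + 1) = 2 + 2 * n by ring, Function.iterate_add_apply, ih]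
    simp [step, add_assoc]

theorem step_injective {m : ℕ} : Function.Injective (step (m := m)) := fun x y h => by
  have h1 := congrArg Prod.fst h
  have h2 := congrArg Prod.snd h
  simp only [step, add_left_inj] at h1 h2
  exact Prod.ext h2 h1

/-! ### The absorbing domains -/

section Dynamics

variable {m : ℕ} [NeZero m] {δ : ℝ}

/-- The product of two sectors of amplitude `π / m`. -/
def wedgeProd (m : ℕ) [NeZero m] (x : ZMod m × ZMod m) : Set (ℂ × ℂ) := wedge m x.1 ×ˢ wedge m x.2

/-- The sector `wedge m j` translated by `r` along its bisector. -/
def shifted (m : ℕ) [NeZero m] (r : ℝ) (j : ZMod m) : Set ℂ := {z | z - r * rot m j ∈ wedge m j}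

/-- The product of two translated sectors. -/
def absorbing (m : ℕ) [NeZero m] (r : ℝ) (x : ZMod m × ZMod m) : Set (ℂ × ℂ) :=
  shifted m r x.1 ×ˢ shifted m r x.2

/-- The size `r` of the translation is large enough, given a radius `σ` such that the ball
`B(1, σ)` lies in the sector. -/
def LargeShift (m : ℕ) (σ r : ℝ) : Prop :=
  0 < σ ∧ Metric.ball 1 σ ⊆ cone m ∧ 1 ≤ r ∧ 4 * Real.exp (-r) < σ

omit [NeZero m] in
theorem exists_largeShift (hm : 2 ≤ m) : ∃ σ r, LargeShift m σ r := by
  obtain ⟨σ, hσ, hb⟩ := Metric.isOpen_iff.1 (isOpen_cone hm) 1 (one_mem_cone hm)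
  have h1 : Tendsto (fun r : ℝ => 4 * Real.exp (-r)) atTop (𝓝 (4 * 0)) :=
    (Real.tendsto_exp_neg_atTop_nhds_zero).const_mul 4
  rw [mul_zero] at h1
  obtain ⟨r, hr1, hr2⟩ := ((h1.eventually (gt_mem_nhds hσ)).and (eventually_ge_atTop 1)).exists
  exact ⟨σ, r, hσ, hb, hr2, hr1⟩

omit [NeZero m] in
theorem LargeShift.mono {σ r s : ℝ} (h : LargeShift m σ r) (hrs : r ≤ s) : LargeShift m σ s := by
  obtain ⟨h1, h2, h3, h4⟩ := h
  refine ⟨h1, h2, h3.trans hrs, lt_of_le_of_lt ?_ h4⟩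
  gcongr

theorem isOpen_shifted (hm : 2 ≤ m) (r : ℝ) (j : ZMod m) : IsOpen (shifted m r j) :=
  (isOpen_wedge hm j).preimage (by fun_prop)

theorem isOpen_absorbing (hm : 2 ≤ m) (r : ℝ) (x : ZMod m × ZMod m) : IsOpen (absorbing m r x) :=
  (isOpen_shifted hm r x.1).prod (isOpen_shifted hm r x.2)

theorem isOpen_wedgeProd (hm : 2 ≤ m) (x : ZMod m × ZMod m) : IsOpen (wedgeProd m x) :=
  (isOpen_wedge hm x.1).prod (isOpen_wedge hm x.2)

theorem convex_wedgeProd (hm : 2 ≤ m) (x : ZMod m × ZMod m) : Convex ℝ (wedgeProd m x) :=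
  (convex_wedge hm x.1).prod (convex_wedge hm x.2)

theorem convex_shifted (hm : 2 ≤ m) (r : ℝ) (j : ZMod m) : Convex ℝ (shifted m r j) := by
  have : shifted m r j = (fun z => (-(r * rot m j) : ℂ) + z) ⁻¹' wedge m j := by
    ext z; simp [shifted, sub_eq_neg_add]
  rw [this]
  exact (convex_wedge hm j).translate_preimage_right _

theorem convex_absorbing (hm : 2 ≤ m) (r : ℝ) (x : ZMod m × ZMod m) :
    Convex ℝ (absorbing m r x) := (convex_shifted hm r x.1).prod (convex_shifted hm r x.2)

theorem shifted_subset_wedge (hm : 2 ≤ m) {r : ℝ} (hr : 0 < r) (j : ZMod m) :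
    shifted m r j ⊆ wedge m j := fun z hz => by
  have := wedge_add hm hz (wedge_smul (rot_mem_wedge hm j) hr)
  simpa using this

/-- A perturbation smaller than `s σ` costs at most `s` of the translation. -/
theorem add_mem_shifted (hm : 2 ≤ m) {σ : ℝ} (hσ : Metric.ball 1 σ ⊆ cone m) {r s : ℝ}
    (hs : 0 < s) {j : ZMod m} {z e : ℂ} (hz : z ∈ shifted m (r + s) j) (he : ‖e‖ < s * σ) :
    z + e ∈ shifted m r j := by
  have h1 : 1 + e / (s * rot m j) ∈ cone m := by
    apply hσ
    rw [mem_ball_iff_norm, add_sub_cancel_left, norm_div, norm_mul, norm_rot, Complex.norm_real,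
      Real.norm_eq_abs, abs_of_pos hs, mul_one, div_lt_iff₀ hs]
    linarith
  have h2 := wedge_add hm hz (wedge_smul (rot_mul_mem_wedge.2 h1) hs)
  have hs' : (s : ℂ) ≠ 0 := by exact_mod_cast hs.ne'
  have h3 := rot_ne_zero (m := m) j
  have e1 : z - ((r + s : ℝ) : ℂ) * rot m j + s * (rot m j * (1 + e / (s * rot m j)))
      = z + e - r * rot m j := by
    push_cast; field_simp; ring
  rw [e1] at h2
  exact h2

theorem mult_mul_mem_shifted (hδ : 2 < δ) {r : ℝ} {j : ZMod m} {z : ℂ} (hz : z ∈ shifted m r j) :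
    mult m δ * z ∈ shifted m (δ * r) (j + 1) := by
  have h1 := rot_mul_mem_wedge_add (i := 1).2 (wedge_smul hz (t := δ) (by linarith))
  have e : rot m 1 * (δ * (z - r * rot m j))
      = mult m δ * z - ((δ * r : ℝ) : ℂ) * rot m (j + 1) := by
    rw [mult_eq, rot_add]; push_cast; ring
  rw [e] at h1
  exact h1

theorem norm_exp_neg_pow_le (hm : 2 ≤ m) {r : ℝ} (hr : 1 ≤ r) {j : ZMod m} {z : ℂ}
    (hz : z ∈ shifted m r j) : ‖Complex.exp (-z ^ m)‖ ≤ Real.exp (-r) := by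
  obtain ⟨s, hs, hzs⟩ := exists_of_mem_wedge hz
  have e : z = rot m j * (s + r) := by linear_combination hzs
  rw [Complex.norm_exp, Complex.neg_re, e, pow_rot_mul]
  have h1 := pow_le_re_pow hm hs (r := r) (by linarith)
  have h2 : r ≤ r ^ m := le_self_pow₀ hr (by omega)
  exact Real.exp_le_exp.2 (by linarith)

theorem henon_mem_absorbing (hm : 2 ≤ m) (hδ : 2 < δ) {σ r : ℝ} (h : LargeShift m σ r)
    {x : ZMod m × ZMod m} {p : ℂ × ℂ} (hp : p ∈ absorbing m r x) :
    henon m δ p ∈ absorbing m r (step x) := by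
  obtain ⟨h1, h2, h3, h4⟩ := h
  refine ⟨?_, hp.1⟩
  have hz := mult_mul_mem_shifted hδ hp.2
  have : δ * r = r + (δ - 1) * r := by ring
  rw [this] at hz
  rw [henon_apply, add_comm]
  refine add_mem_shifted hm h2 (by nlinarith) hz ((norm_exp_neg_pow_le hm h3 hp.1).trans_lt ?_)
  have := Real.exp_pos (-r)
  nlinarith [mul_le_mul (by linarith : 1 ≤ δ - 1) h3 zero_le_one (by linarith)]

theorem iterate_mem_absorbing (hm : 2 ≤ m) (hδ : 2 < δ) {σ r : ℝ} (h : LargeShift m σ r)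
    {x : ZMod m × ZMod m} {p : ℂ × ℂ} (hp : p ∈ absorbing m r x) (n : ℕ) :
    (henon m δ)^[n] p ∈ absorbing m r (step^[n] x) := by
  induction n with
  | zero => exact hp
  | succ n ih =>
    rw [Function.iterate_succ_apply', Function.iterate_succ_apply']
    exact henon_mem_absorbing hm hδ h ih

/-! ### The limit of the rescaled iterates -/

/-- The iterates of even order, rescaled by the linear part: `L⁻²ⁿ F²ⁿ`. -/
noncomputable def scaled (m : ℕ) (δ : ℝ) (n : ℕ) (p : ℂ × ℂ) : ℂ × ℂ :=
  ((mult m δ) ^ n)⁻¹ • (henon m δ)^[2 * n] p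

/-- The limit of the rescaled iterates; it conjugates `henon` to its linear part. It is meaningful
where the limit exists, in particular on the basins. -/
noncomputable def wave (m : ℕ) (δ : ℝ) (p : ℂ × ℂ) : ℂ × ℂ :=
  limUnder atTop fun n => scaled m δ n p

/-- The set of points whose rescaled iterates converge into a given product of sectors. -/
def basin (m : ℕ) [NeZero m] (δ : ℝ) (x : ZMod m × ZMod m) : Set (ℂ × ℂ) :=
  {p | ∃ v ∈ wedgeProd m x, Tendsto (fun n => scaled m δ n p) atTop (𝓝 v)}

theorem tendsto_scaled_of_mem_basin {x : ZMod m × ZMod m} {p : ℂ × ℂ} (hp : p ∈ basin m δ x) :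
    Tendsto (fun n => scaled m δ n p) atTop (𝓝 (wave m δ p)) := by
  obtain ⟨v, -, hv⟩ := hp
  rwa [wave, hv.limUnder_eq]

theorem wave_mem_wedgeProd {x : ZMod m × ZMod m} {p : ℂ × ℂ} (hp : p ∈ basin m δ x) :
    wave m δ p ∈ wedgeProd m x := by
  obtain ⟨v, hv, hlim⟩ := hp
  rwa [wave, hlim.limUnder_eq]

theorem differentiable_scaled (m : ℕ) (δ : ℝ) (n : ℕ) : Differentiable ℂ (scaled m δ n) :=
  (differentiable_iterate (differentiable_henon m δ) (2 * n)).const_smul (((mult m δ) ^ n)⁻¹)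

theorem scaled_add (m : ℕ) {δ : ℝ} (n N : ℕ) (p : ℂ × ℂ) :
    scaled m δ (n + N) p = ((mult m δ) ^ N)⁻¹ • scaled m δ n ((henon m δ)^[2 * N] p) := by
  rw [scaled, scaled, mul_add, Function.iterate_add_apply, smul_smul, pow_add, mul_inv, mul_comm]

theorem norm_henon_two_sub_le (hm : 2 ≤ m) (hδ : 2 < δ) {σ r : ℝ} (h : LargeShift m σ r)
    {x : ZMod m × ZMod m} {p : ℂ × ℂ} (hp : p ∈ absorbing m r x) :
    ‖(henon m δ)^[2] p - mult m δ • p‖ ≤ Real.exp (-r) := by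
  have h1 := norm_exp_neg_pow_le hm h.2.2.1 hp.1
  have h2 := norm_exp_neg_pow_le hm h.2.2.1 (henon_mem_absorbing hm hδ h hp).1
  have e : (henon m δ)^[2] p - mult m δ • p
      = (Complex.exp (-(henon m δ p).1 ^ m), Complex.exp (-p.1 ^ m)) := by
    ext <;> simp [henon_apply]
  rw [e]
  exact max_le h2 h1

theorem dist_scaled_succ_le (hm : 2 ≤ m) (hδ : 2 < δ) {σ r : ℝ} (h : LargeShift m σ r)
    {x : ZMod m × ZMod m} {p : ℂ × ℂ} (hp : p ∈ absorbing m r x) (n : ℕ) :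
    dist (scaled m δ n p) (scaled m δ (n + 1) p) ≤ Real.exp (-r) / 2 / 2 ^ n := by
  have hq := iterate_mem_absorbing hm hδ h hp (2 * n)
  have ha := mult_ne_zero m hδ
  rw [dist_comm, dist_eq_norm]
  have e : scaled m δ (n + 1) p - scaled m δ n p = (mult m δ ^ (n + 1))⁻¹ •
      ((henon m δ)^[2] ((henon m δ)^[2 * n] p) - mult m δ • (henon m δ)^[2 * n] p) := by
    rw [smul_sub, smul_smul, scaled, scaled, ← Function.iterate_add_apply]
    congr 2
    · congr 1; ring
    · rw [pow_succ]; field_simp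
  rw [e, norm_smul, norm_inv, norm_pow, norm_mult m hδ]
  have h2 := norm_henon_two_sub_le hm hδ h hq
  have h3 : (δ ^ (n + 1))⁻¹ ≤ (2 ^ (n + 1))⁻¹ := by gcongr
  calc _ ≤ (2 ^ (n + 1))⁻¹ * Real.exp (-r) := by gcongr
    _ = _ := by rw [pow_succ]; field_simp

theorem tendsto_scaled_of_mem_absorbing (hm : 2 ≤ m) (hδ : 2 < δ) {σ r : ℝ}
    (h : LargeShift m σ r) {x : ZMod m × ZMod m} {p : ℂ × ℂ} (hp : p ∈ absorbing m r x) :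
    Tendsto (fun n => scaled m δ n p) atTop (𝓝 (wave m δ p)) := by
  exact (cauchySeq_of_le_geometric_two (dist_scaled_succ_le hm hδ h hp)).tendsto_limUnder

theorem dist_scaled_wave_le (hm : 2 ≤ m) (hδ : 2 < δ) {σ r : ℝ}
    (h : LargeShift m σ r) {x : ZMod m × ZMod m} {p : ℂ × ℂ} (hp : p ∈ absorbing m r x) (n : ℕ) :
    dist (scaled m δ n p) (wave m δ p) ≤ Real.exp (-r) / 2 ^ n :=
  dist_le_of_le_geometric_two_of_tendsto (dist_scaled_succ_le hm hδ h hp)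
    (tendsto_scaled_of_mem_absorbing hm hδ h hp) n

theorem norm_wave_sub_le (hm : 2 ≤ m) (hδ : 2 < δ) {σ r : ℝ}
    (h : LargeShift m σ r) {x : ZMod m × ZMod m} {p : ℂ × ℂ} (hp : p ∈ absorbing m r x) :
    ‖wave m δ p - p‖ ≤ Real.exp (-r) := by
  have := dist_scaled_wave_le hm hδ h hp 0
  rw [dist_comm, dist_eq_norm] at this
  simpa [scaled] using this

theorem absorbing_subset_basin (hm : 2 ≤ m) (hδ : 2 < δ) {σ r : ℝ}
    (h : LargeShift m σ r) (x : ZMod m × ZMod m) : absorbing m r x ⊆ basin m δ x := by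
  intro p hp
  refine ⟨_, ?_, tendsto_scaled_of_mem_absorbing hm hδ h hp⟩
  have h1 := norm_wave_sub_le hm hδ h hp
  obtain ⟨hσ, hb, hr, hrσ⟩ := h
  have h0 := Real.exp_pos (-r)
  have key : ∀ {j : ZMod m} {z e : ℂ}, z ∈ shifted m r j → ‖e - z‖ ≤ Real.exp (-r) →
      e ∈ wedge m j := by
    intro j z e hz he
    have hz' : z ∈ shifted m (r / 2 + r / 2) j := by rwa [add_halves]
    have := add_mem_shifted hm hb (by linarith) hz' (e := e - z) (by nlinarith)
    rw [add_sub_cancel] at this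
    exact shifted_subset_wedge hm (by linarith) j this
  exact ⟨key hp.1 ((norm_fst_le _).trans h1), key hp.2 ((norm_snd_le _).trans h1)⟩

theorem mult_pow_mul_mem_wedge (hδ : 2 < δ) {j : ZMod m} {z : ℂ} (hz : z ∈ wedge m j) (n : ℕ) :
    mult m δ ^ n * z ∈ wedge m (j + n) := by
  induction n with
  | zero => simpa
  | succ n ih =>
    have := rot_mul_mem_wedge_add (i := 1).2 (wedge_smul ih (t := δ) (by linarith))
    rw [Nat.cast_succ, ← add_assoc, pow_succ']
    convert this using 1
    rw [mult_eq]; ring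

/-- Expansion moves the points close to a given point of a sector into the translated sector. -/
theorem eventually_mult_pow_mul_mem_shifted (hm : 2 ≤ m) (hδ : 2 < δ) (r : ℝ) {j : ZMod m}
    {v : ℂ} (hv : v ∈ wedge m j) :
    ∀ᶠ q : ℂ × ℕ in 𝓝 v ×ˢ atTop, mult m δ ^ q.2 * q.1 ∈ shifted m r (j + q.2) := by
  -- the point remains in the sector after a translation by a small `t > 0`
  obtain ⟨t, ht, htv⟩ : ∃ t : ℝ, 0 < t ∧ v - t * rot m j ∈ wedge m j := by
    have h1 : Continuous fun t : ℝ => v - t * rot m j := by fun_prop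
    have h2 := (h1.tendsto 0).eventually ((isOpen_wedge hm j).mem_nhds (by simpa using hv))
    obtain ⟨t, h3, h4⟩ := ((h2.filter_mono nhdsWithin_le_nhds).and
      (self_mem_nhdsWithin (s := Ioi (0 : ℝ)))).exists
    exact ⟨t, h4, h3⟩
  have hu : ∀ᶠ u in 𝓝 v, u - t * rot m j ∈ wedge m j := by
    have h1 : Continuous fun u : ℂ => u - t * rot m j := by fun_prop
    exact (h1.tendsto v).eventually ((isOpen_wedge hm j).mem_nhds htv)
  have hn : ∀ᶠ n : ℕ in atTop, r < δ ^ n * t :=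
    ((tendsto_pow_atTop_atTop_of_one_lt (by linarith : 1 < δ)).atTop_mul_const ht).eventually
      (eventually_gt_atTop r)
  filter_upwards [hu.prod_mk hn] with q hq
  obtain ⟨h1, h2⟩ := hq
  have h3 := mult_pow_mul_mem_wedge hδ h1 q.2
  have h4 := wedge_add hm h3 (wedge_smul (rot_mem_wedge hm (j + q.2)) (sub_pos.2 h2))
  have e : mult m δ ^ q.2 * rot m j = ((δ ^ q.2 : ℝ) : ℂ) * rot m (j + q.2) := by
    rw [rot_add, mult_eq, mul_pow, ← rot_natCast_eq_pow]
    push_cast; ring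
  rw [shifted, mem_ofPred_eq]
  convert h4 using 1
  push_cast at e ⊢
  linear_combination (t : ℂ) * e

theorem eventually_mult_pow_smul_mem_absorbing (hm : 2 ≤ m) (hδ : 2 < δ) (r : ℝ)
    {x : ZMod m × ZMod m} {v : ℂ × ℂ} (hv : v ∈ wedgeProd m x) :
    ∀ᶠ q : (ℂ × ℂ) × ℕ in 𝓝 v ×ˢ atTop,
      mult m δ ^ q.2 • q.1 ∈ absorbing m r (step^[2 * q.2] x) := by
  have h1 := ((continuous_fst.tendsto v).prodMap tendsto_id).eventually
    (eventually_mult_pow_mul_mem_shifted hm hδ r hv.1)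
  have h2 := ((continuous_snd.tendsto v).prodMap tendsto_id).eventually
    (eventually_mult_pow_mul_mem_shifted hm hδ r hv.2)
  filter_upwards [h1, h2] with q hq1 hq2
  rw [step_iterate_two_mul]
  exact ⟨hq1, hq2⟩

omit [NeZero m] in
theorem mult_pow_smul_scaled (hδ : 2 < δ) (n : ℕ) (p : ℂ × ℂ) :
    mult m δ ^ n • scaled m δ n p = (henon m δ)^[2 * n] p := by
  rw [scaled, smul_inv_smul₀ (pow_ne_zero n (mult_ne_zero m hδ))]

theorem eventually_iterate_mem_absorbing (hm : 2 ≤ m) (hδ : 2 < δ) (r : ℝ)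
    {x : ZMod m × ZMod m} {p : ℂ × ℂ} (hp : p ∈ basin m δ x) :
    ∀ᶠ n : ℕ in atTop, (henon m δ)^[2 * n] p ∈ absorbing m r (step^[2 * n] x) := by
  have h1 := (tendsto_scaled_of_mem_basin hp).prodMk tendsto_id
  have h2 := h1.eventually (eventually_mult_pow_smul_mem_absorbing hm hδ r
    (wave_mem_wedgeProd hp))
  filter_upwards [h2] with n hn
  have : mult m δ ^ n • scaled m δ n p ∈ absorbing m r (step^[2 * n] x) := hn
  rwa [mult_pow_smul_scaled hδ] at this

theorem mult_pow_smul_mem_wedgeProd (hδ : 2 < δ) {x : ZMod m × ZMod m} {v : ℂ × ℂ} (n : ℕ) :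
    mult m δ ^ n • v ∈ wedgeProd m (step^[2 * n] x) ↔ v ∈ wedgeProd m x := by
  have key : ∀ (j : ZMod m) (z : ℂ), mult m δ ^ n * z ∈ wedge m (j + n) ↔ z ∈ wedge m j := by
    intro j z
    refine ⟨fun h => ?_, fun h => mult_pow_mul_mem_wedge hδ h n⟩
    have h1 := wedge_smul h (t := (δ ^ n)⁻¹) (inv_pos.2 (pow_pos (by linarith) n))
    rw [← rot_mul_mem_wedge_add (i := (n : ZMod m))]
    convert h1 using 1
    have : (δ : ℂ) ^ n ≠ 0 := pow_ne_zero n (by exact_mod_cast (by linarith : δ ≠ 0))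
    rw [mult_eq, mul_pow, rot_natCast_eq_pow]; push_cast; field_simp
  rw [step_iterate_two_mul]
  exact and_congr (key x.1 v.1) (key x.2 v.2)

/-- The basins are invariant under iterates of even order, forwards and backwards. -/
theorem iterate_two_mul_mem_basin (hδ : 2 < δ) {x : ZMod m × ZMod m} {p : ℂ × ℂ} (N : ℕ) :
    (henon m δ)^[2 * N] p ∈ basin m δ (step^[2 * N] x) ↔ p ∈ basin m δ x := by
  have ha := pow_ne_zero N (mult_ne_zero m hδ)
  constructor
  · rintro ⟨v, hv, hlim⟩
    refine ⟨(mult m δ ^ N)⁻¹ • v, ?_, ?_⟩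
    · rwa [← mult_pow_smul_mem_wedgeProd hδ N, smul_inv_smul₀ ha]
    · rw [← tendsto_add_atTop_iff_nat N]
      simp only [scaled_add]
      exact hlim.const_smul _
  · rintro ⟨v, hv, hlim⟩
    refine ⟨mult m δ ^ N • v, (mult_pow_smul_mem_wedgeProd hδ N).2 hv, ?_⟩
    rw [← tendsto_add_atTop_iff_nat N] at hlim
    simp only [scaled_add] at hlim
    simpa [smul_smul, ha] using hlim.const_smul (mult m δ ^ N)

theorem wave_iterate_two_mul (hδ : 2 < δ) {x : ZMod m × ZMod m} {p : ℂ × ℂ}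
    (hp : p ∈ basin m δ x) (N : ℕ) :
    wave m δ ((henon m δ)^[2 * N] p) = mult m δ ^ N • wave m δ p := by
  have ha := pow_ne_zero N (mult_ne_zero m hδ)
  have h1 := tendsto_scaled_of_mem_basin hp
  rw [← tendsto_add_atTop_iff_nat N] at h1
  simp only [scaled_add] at h1
  have h2 := h1.const_smul (mult m δ ^ N)
  simp only [smul_inv_smul₀ ha] at h2
  exact tendsto_nhds_unique
    (tendsto_scaled_of_mem_basin ((iterate_two_mul_mem_basin hδ N).2 hp)) h2

theorem mem_basin_iff_exists (hm : 2 ≤ m) (hδ : 2 < δ) {σ r : ℝ} (h : LargeShift m σ r)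
    {x : ZMod m × ZMod m} {p : ℂ × ℂ} :
    p ∈ basin m δ x ↔ ∃ N : ℕ, (henon m δ)^[2 * N] p ∈ absorbing m r (step^[2 * N] x) :=
  ⟨fun hp => (eventually_iterate_mem_absorbing hm hδ r hp).exists, fun ⟨N, hN⟩ =>
    (iterate_two_mul_mem_basin hδ N).1 (absorbing_subset_basin hm hδ h _ hN)⟩

theorem isOpen_basin (hm : 2 ≤ m) (hδ : 2 < δ) (x : ZMod m × ZMod m) :
    IsOpen (basin m δ x) := by
  obtain ⟨σ, r, h⟩ := exists_largeShift hm
  have : basin m δ x = ⋃ N : ℕ, (henon m δ)^[2 * N] ⁻¹' absorbing m r (step^[2 * N] x) := by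
    ext p; rw [mem_basin_iff_exists hm hδ h]; simp
  rw [this]
  exact isOpen_iUnion fun N => (isOpen_absorbing hm r _).preimage
    (differentiable_iterate (differentiable_henon m δ) _).continuous

theorem tendstoUniformlyOn_scaled_absorbing (hm : 2 ≤ m) (hδ : 2 < δ) {σ r : ℝ}
    (h : LargeShift m σ r) (x : ZMod m × ZMod m) :
    TendstoUniformlyOn (scaled m δ) (wave m δ) atTop (absorbing m r x) := by
  rw [Metric.tendstoUniformlyOn_iff]
  intro ε hε
  have h1 : Tendsto (fun n : ℕ => Real.exp (-r) / 2 ^ n) atTop (𝓝 0) :=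
    tendsto_const_nhds.div_atTop (tendsto_pow_atTop_atTop_of_one_lt one_lt_two)
  filter_upwards [h1.eventually (gt_mem_nhds hε)] with n hn p hp
  rw [dist_comm]
  exact (dist_scaled_wave_le hm hδ h hp n).trans_lt hn

theorem differentiableOn_wave_absorbing (hm : 2 ≤ m) (hδ : 2 < δ) {σ r : ℝ}
    (h : LargeShift m σ r) (x : ZMod m × ZMod m) :
    DifferentiableOn ℂ (wave m δ) (absorbing m r x) :=
  differentiableOn_of_tendstoUniformlyOn (isOpen_absorbing hm r x)
    (fun n => (differentiable_scaled m δ n).differentiableOn)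
    (tendstoUniformlyOn_scaled_absorbing hm hδ h x)

/-- Near each point of a basin, the map `wave` is `wave` on an absorbing domain, conjugated by
an iterate of even order. -/
theorem eventually_wave_eq (hm : 2 ≤ m) (hδ : 2 < δ) {σ r : ℝ} (h : LargeShift m σ r)
    {x : ZMod m × ZMod m} {p : ℂ × ℂ} (hp : p ∈ basin m δ x) :
    ∃ N : ℕ, ∃ V : Set (ℂ × ℂ), IsOpen V ∧ p ∈ V ∧ V ⊆ basin m δ x ∧
      MapsTo (henon m δ)^[2 * N] V (absorbing m r (step^[2 * N] x)) ∧
      ∀ q ∈ V, wave m δ q = (mult m δ ^ N)⁻¹ • wave m δ ((henon m δ)^[2 * N] q) := by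
  obtain ⟨N, hN⟩ := (mem_basin_iff_exists hm hδ h).1 hp
  refine ⟨N, (henon m δ)^[2 * N] ⁻¹' absorbing m r (step^[2 * N] x),
    (isOpen_absorbing hm r _).preimage
      (differentiable_iterate (differentiable_henon m δ) _).continuous, hN,
    fun q hq => (mem_basin_iff_exists hm hδ h).2 ⟨N, hq⟩, fun q hq => hq, fun q hq => ?_⟩
  rw [wave_iterate_two_mul hδ ((mem_basin_iff_exists hm hδ h).2 ⟨N, hq⟩),
    inv_smul_smul₀ (pow_ne_zero N (mult_ne_zero m hδ))]

theorem differentiableOn_wave (hm : 2 ≤ m) (hδ : 2 < δ) (x : ZMod m × ZMod m) :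
    DifferentiableOn ℂ (wave m δ) (basin m δ x) := by
  obtain ⟨σ, r, h⟩ := exists_largeShift hm
  intro p hp
  obtain ⟨N, V, hV, hpV, -, hmaps, heq⟩ := eventually_wave_eq hm hδ h hp
  have h1 : DifferentiableOn ℂ (wave m δ) V := by
    have := ((differentiableOn_wave_absorbing hm hδ h (step^[2 * N] x)).comp
      (differentiable_iterate (differentiable_henon m δ) (2 * N)).differentiableOn
      hmaps).const_smul ((mult m δ ^ N)⁻¹)
    exact this.congr heq
  exact (h1.differentiableAt (hV.mem_nhds hpV)).differentiableWithinAt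

theorem tendstoLocallyUniformlyOn_scaled (hm : 2 ≤ m) (hδ : 2 < δ) (x : ZMod m × ZMod m) :
    TendstoLocallyUniformlyOn (scaled m δ) (wave m δ) atTop (basin m δ x) := by
  obtain ⟨σ, r, h⟩ := exists_largeShift hm
  rw [Metric.tendstoLocallyUniformlyOn_iff]
  intro ε hε p hp
  obtain ⟨N, V, hV, hpV, -, hmaps, heq⟩ := eventually_wave_eq hm hδ h hp
  refine ⟨V, mem_nhdsWithin_of_mem_nhds (hV.mem_nhds hpV), ?_⟩
  have ha : 0 < ‖mult m δ ^ N‖ := norm_pos_iff.2 (pow_ne_zero N (mult_ne_zero m hδ))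
  have hu := Metric.tendstoUniformlyOn_iff.1
    (tendstoUniformlyOn_scaled_absorbing hm hδ h (step^[2 * N] x)) (ε * ‖mult m δ ^ N‖)
    (by positivity)
  filter_upwards [(tendsto_sub_atTop_nat N).eventually hu, eventually_ge_atTop N] with n hn hnN q hq
  obtain ⟨k, rfl⟩ := Nat.exists_eq_add_of_le' hnN
  rw [Nat.add_sub_cancel] at hn
  rw [heq q hq, scaled_add, dist_smul₀, norm_inv, inv_mul_lt_iff₀ ha, mul_comm ‖_‖]
  exact hn _ (hmaps hq)

/-! ### The limit is biholomorphic -/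

/-- On an absorbing domain, the Cauchy estimate makes `wave - id` Lipschitz of constant `1 / 2`. -/
theorem approximatesLinearOn_wave (hm : 2 ≤ m) (hδ : 2 < δ) {σ r : ℝ} (h : LargeShift m σ r)
    (x : ZMod m × ZMod m) :
    ApproximatesLinearOn (wave m δ) ((ContinuousLinearEquiv.refl ℂ (ℂ × ℂ) : _ ≃L[ℂ] _) :
      ℂ × ℂ →L[ℂ] ℂ × ℂ) (absorbing m (2 * r) x) (1 / 2) := by
  have hr := h.2.2.1
  have hball : ∀ p ∈ absorbing m (2 * r) x, Metric.ball p (r * σ) ⊆ absorbing m r x := by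
    intro p hp q hq
    rw [two_mul] at hp
    rw [mem_ball_iff_norm] at hq
    have h1 := add_mem_shifted hm h.2.1 (by linarith) hp.1 ((norm_fst_le (q - p)).trans_lt hq)
    have h2 := add_mem_shifted hm h.2.1 (by linarith) hp.2 ((norm_snd_le (q - p)).trans_lt hq)
    simp only [Prod.fst_sub, Prod.snd_sub, add_sub_cancel] at h1 h2
    exact ⟨h1, h2⟩
  have hd : ∀ p ∈ absorbing m r x, DifferentiableAt ℂ (fun q => wave m δ q - q) p := fun p hp =>
    ((differentiableOn_wave_absorbing hm hδ h x).differentiableAt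
      ((isOpen_absorbing hm r x).mem_nhds hp)).sub differentiableAt_id
  have hσ := h.1
  have hrσ : 0 < r * σ := mul_pos (by linarith) hσ
  have hbound : ∀ p ∈ absorbing m (2 * r) x,
      ‖fderiv ℂ (fun q => wave m δ q - q) p‖ ≤ 1 / 2 := by
    intro p hp
    refine (norm_fderiv_le_of_bound hrσ (C := Real.exp (-r))
      (fun q hq => (hd q (hball p hp hq)).differentiableWithinAt)
      fun q hq => norm_wave_sub_le hm hδ h (hball p hp hq)).trans ?_
    rw [div_le_iff₀ hrσ]
    nlinarith [h.2.2.2]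
  intro p hp q hq
  have := (convex_absorbing hm (2 * r) x).norm_image_sub_le_of_norm_fderiv_le
    (fun y hy => hd y (hball y hy (Metric.mem_ball_self hrσ))) hbound hq hp
  simp only [ContinuousLinearEquiv.coe_refl, ContinuousLinearMap.id_apply]
  calc _ = ‖wave m δ p - p - (wave m δ q - q)‖ := by congr 1; abel
    _ ≤ _ := this
    _ = _ := by simp

theorem half_lt_inv_norm_refl :
    (1 / 2 : NNReal) < ‖((ContinuousLinearEquiv.refl ℂ (ℂ × ℂ)).symm : ℂ × ℂ →L[ℂ] ℂ × ℂ)‖₊⁻¹ := by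
  have : ‖((ContinuousLinearEquiv.refl ℂ (ℂ × ℂ)).symm : ℂ × ℂ →L[ℂ] ℂ × ℂ)‖₊ = 1 := by
    ext; simp
  rw [this]; norm_num

/-- `wave` as an open partial homeomorphism of an absorbing domain. -/
noncomputable def waveHomeomorph (hm : 2 ≤ m) (hδ : 2 < δ) {σ r : ℝ} (h : LargeShift m σ r)
    (x : ZMod m × ZMod m) : OpenPartialHomeomorph (ℂ × ℂ) (ℂ × ℂ) :=
  (approximatesLinearOn_wave hm hδ h x).toOpenPartialHomeomorph _ _
    (Or.inr half_lt_inv_norm_refl) (isOpen_absorbing hm (2 * r) x)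

theorem differentiableOn_waveHomeomorph_symm (hm : 2 ≤ m) (hδ : 2 < δ) {σ r : ℝ}
    (h : LargeShift m σ r) (x : ZMod m × ZMod m) :
    DifferentiableOn ℂ (waveHomeomorph hm hδ h x).symm (waveHomeomorph hm hδ h x).target := by
  intro v hv
  set p := (waveHomeomorph hm hδ h x).symm v with hp
  have hpW : p ∈ absorbing m (2 * r) x := (waveHomeomorph hm hδ h x).map_target hv
  have hpW' : p ∈ basin m δ x :=
    absorbing_subset_basin hm hδ (h.mono (by linarith [h.2.2.1])) x hpW
  have hd : HasFDerivAt (wave m δ) (fderiv ℂ (wave m δ) p) p :=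
    ((differentiableOn_wave hm hδ x).differentiableAt
      ((isOpen_basin hm hδ x).mem_nhds hpW')).hasFDerivAt
  have hclose : ‖1 - fderiv ℂ (wave m δ) p‖ < 1 := by
    have h1 : HasFDerivAt (fun q => q - wave m δ q) (1 - fderiv ℂ (wave m δ) p) p :=
      (hasFDerivAt_id p).sub hd
    have h2 : ‖1 - fderiv ℂ (wave m δ) p‖ ≤ 1 / 2 := by
      refine h1.le_of_lip' (by norm_num) ?_
      filter_upwards [(isOpen_absorbing hm (2 * r) x).mem_nhds hpW] with q hq
      have := approximatesLinearOn_wave hm hδ h x q hq p hpW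
      simp only [ContinuousLinearEquiv.coe_refl, ContinuousLinearMap.id_apply] at this
      rw [← norm_neg]
      calc _ = ‖wave m δ q - wave m δ p - (q - p)‖ := by congr 1; abel
        _ ≤ _ := this
        _ = _ := by simp
    linarith
  have hd' : HasFDerivAt (waveHomeomorph hm hδ h x)
      ((ContinuousLinearEquiv.unitsEquiv ℂ (ℂ × ℂ) (Units.oneSub _ hclose) : _ ≃L[ℂ] _) :
        ℂ × ℂ →L[ℂ] ℂ × ℂ) p := by
    have e : ((ContinuousLinearEquiv.unitsEquiv ℂ (ℂ × ℂ) (Units.oneSub _ hclose) : _ ≃L[ℂ] _) :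
        ℂ × ℂ →L[ℂ] ℂ × ℂ) = fderiv ℂ (wave m δ) p := by
      refine ContinuousLinearMap.ext fun u => ?_
      change ((Units.oneSub _ hclose : (ℂ × ℂ →L[ℂ] ℂ × ℂ)ˣ) : ℂ × ℂ →L[ℂ] ℂ × ℂ) u = _
      rw [Units.val_oneSub, sub_sub_cancel]
    rw [e]; exact hd
  exact ((waveHomeomorph hm hδ h x).hasFDerivAt_symm hv hd').differentiableAt.differentiableWithinAt

theorem absorbing_mono (hm : 2 ≤ m) {r s : ℝ} (hrs : r < s) (x : ZMod m × ZMod m) :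
    absorbing m s x ⊆ absorbing m r x := by
  have key : ∀ j, shifted m s j ⊆ shifted m r j := fun j z hz => by
    have := wedge_add hm hz (wedge_smul (rot_mem_wedge hm j) (sub_pos.2 hrs))
    rw [shifted, mem_ofPred_eq]
    convert this using 1
    push_cast; ring
  exact prod_mono (key _) (key _)

/-- The image of the homeomorphism contains a smaller absorbing domain, as `wave` is close to the
identity. -/
theorem absorbing_subset_target (hm : 2 ≤ m) (hδ : 2 < δ) {σ r : ℝ}
    (h : LargeShift m σ r) (x : ZMod m × ZMod m) :
    absorbing m (3 * r) x ⊆ (waveHomeomorph hm hδ h x).target := by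
  intro v hv
  have hr := h.2.2.1
  have h0 := Real.exp_pos (-r)
  have hball : Metric.closedBall v (2 * Real.exp (-r)) ⊆ absorbing m (2 * r) x := by
    intro q hq
    rw [show 3 * r = 2 * r + r by ring] at hv
    have hq' : ‖q - v‖ < r * σ := by
      rw [mem_closedBall_iff_norm] at hq
      have := h.2.2.2
      nlinarith [mul_le_mul_of_nonneg_right hr h.1.le]
    have h1 := add_mem_shifted hm h.2.1 (by linarith) hv.1 ((norm_fst_le (q - v)).trans_lt hq')
    have h2 := add_mem_shifted hm h.2.1 (by linarith) hv.2 ((norm_snd_le (q - v)).trans_lt hq')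
    simp only [Prod.fst_sub, Prod.snd_sub, add_sub_cancel] at h1 h2
    exact ⟨h1, h2⟩
  refine (approximatesLinearOn_wave hm hδ h x).closedBall_subset_target
    (Or.inr half_lt_inv_norm_refl) (isOpen_absorbing hm (2 * r) x) (by positivity) hball ?_
  have h1 : ‖((ContinuousLinearEquiv.refl ℂ (ℂ × ℂ)).symm : ℂ × ℂ →L[ℂ] ℂ × ℂ)‖₊ = 1 := by
    ext; simp
  rw [h1, mem_closedBall_iff_norm, norm_sub_rev]
  refine (norm_wave_sub_le hm hδ h (absorbing_mono hm (by linarith) x hv)).trans (le_of_eq ?_)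
  push_cast; ring

theorem injOn_wave (hm : 2 ≤ m) (hδ : 2 < δ) (x : ZMod m × ZMod m) :
    InjOn (wave m δ) (basin m δ x) := by
  obtain ⟨σ, r, h⟩ := exists_largeShift hm
  intro p hp q hq hpq
  obtain ⟨N, hN1, hN2⟩ := ((eventually_iterate_mem_absorbing hm hδ (2 * r) hp).and
    (eventually_iterate_mem_absorbing hm hδ (2 * r) hq)).exists
  have h1 := (approximatesLinearOn_wave hm hδ h (step^[2 * N] x)).injOn
    (Or.inr half_lt_inv_norm_refl) hN1 hN2
    (by rw [wave_iterate_two_mul hδ hp, wave_iterate_two_mul hδ hq, hpq])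
  exact (leftInverse_henonInv m hδ).injective.iterate _ h1

/-- Local holomorphic inverses of `wave`. -/
theorem exists_local_inverse (hm : 2 ≤ m) (hδ : 2 < δ) {x : ZMod m × ZMod m} {v : ℂ × ℂ}
    (hv : v ∈ wedgeProd m x) :
    ∃ V : Set (ℂ × ℂ), IsOpen V ∧ v ∈ V ∧ ∃ g : ℂ × ℂ → ℂ × ℂ, DifferentiableOn ℂ g V ∧
      ∀ u ∈ V, g u ∈ basin m δ x ∧ wave m δ (g u) = u := by
  obtain ⟨σ, r, h⟩ := exists_largeShift hm
  have hr := h.2.2.1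
  obtain ⟨N, hN⟩ : ∃ N : ℕ, mult m δ ^ N • v ∈ absorbing m (3 * r) (step^[2 * N] x) :=
    (eventually_mult_pow_smul_mem_absorbing hm hδ (3 * r) hv).curry.self_of_nhds.exists
  set y := step^[2 * N] x
  have hcont : Continuous fun u : ℂ × ℂ => mult m δ ^ N • u := by fun_prop
  refine ⟨(fun u => mult m δ ^ N • u) ⁻¹' absorbing m (3 * r) y,
    (isOpen_absorbing hm _ _).preimage hcont, hN,
    fun u => (henonInv m δ)^[2 * N] ((waveHomeomorph hm hδ h y).symm (mult m δ ^ N • u)), ?_, ?_⟩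
  · refine (differentiable_iterate (differentiable_henonInv m δ) _).comp_differentiableOn ?_
    exact (differentiableOn_waveHomeomorph_symm hm hδ h y).comp (by fun_prop)
      fun u hu => absorbing_subset_target hm hδ h y hu
  · intro u hu
    have ht := absorbing_subset_target hm hδ h y hu
    set p := (waveHomeomorph hm hδ h y).symm (mult m δ ^ N • u) with hp
    have hpW : p ∈ absorbing m (2 * r) y := (waveHomeomorph hm hδ h y).map_target ht
    have hpw : wave m δ p = mult m δ ^ N • u := (waveHomeomorph hm hδ h y).right_inv ht
    have hFp : (henon m δ)^[2 * N] ((henonInv m δ)^[2 * N] p) = p :=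
      (rightInverse_henonInv m hδ).iterate _ p
    have hmem : (henonInv m δ)^[2 * N] p ∈ basin m δ x := by
      rw [← iterate_two_mul_mem_basin hδ N, hFp]
      exact absorbing_subset_basin hm hδ (h.mono (by linarith)) y hpW
    refine ⟨hmem, ?_⟩
    have := wave_iterate_two_mul hδ hmem N
    rw [hFp, hpw] at this
    exact (smul_right_injective (ℂ × ℂ) (pow_ne_zero N (mult_ne_zero m hδ)) this).symm

/-- The union of all the basins. -/
def totalBasin (m : ℕ) [NeZero m] (δ : ℝ) : Set (ℂ × ℂ) := ⋃ x, basin m δ x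

theorem wedgeProd_eq_of_mem (hm : 2 ≤ m) {x y : ZMod m × ZMod m} {v : ℂ × ℂ}
    (hx : v ∈ wedgeProd m x) (hy : v ∈ wedgeProd m y) : x = y :=
  Prod.ext (wedge_eq_of_mem hm hx.1 hy.1) (wedge_eq_of_mem hm hx.2 hy.2)

theorem basin_eq_of_mem (hm : 2 ≤ m) {x y : ZMod m × ZMod m} {p : ℂ × ℂ}
    (hx : p ∈ basin m δ x) (hy : p ∈ basin m δ y) : x = y :=
  wedgeProd_eq_of_mem hm (wave_mem_wedgeProd hx) (wave_mem_wedgeProd hy)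

theorem bijOn_wave (hm : 2 ≤ m) (hδ : 2 < δ) (x : ZMod m × ZMod m) :
    BijOn (wave m δ) (basin m δ x) (wedgeProd m x) := by
  refine ⟨fun p hp => wave_mem_wedgeProd hp, injOn_wave hm hδ x, fun v hv => ?_⟩
  obtain ⟨V, -, hvV, g, -, hg⟩ := exists_local_inverse hm hδ hv
  exact ⟨g v, hg v hvV⟩

theorem bijOn_wave_totalBasin (hm : 2 ≤ m) (hδ : 2 < δ) :
    BijOn (wave m δ) (totalBasin m δ) (⋃ x, wedgeProd m x) := by
  refine bijOn_iUnion (fun x => bijOn_wave hm hδ x) ?_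
  intro p hp q hq hpq
  obtain ⟨x, hx⟩ := mem_iUnion.1 hp
  obtain ⟨y, hy⟩ := mem_iUnion.1 hq
  have h1 := wave_mem_wedgeProd hx
  rw [hpq] at h1
  obtain rfl := wedgeProd_eq_of_mem hm h1 (wave_mem_wedgeProd hy)
  exact injOn_wave hm hδ x hx hy hpq

/-- The inverse of `wave` on the union of the basins. -/
noncomputable def waveInv (m : ℕ) [NeZero m] (δ : ℝ) : ℂ × ℂ → ℂ × ℂ :=
  Function.invFunOn (wave m δ) (totalBasin m δ)

theorem invOn_waveInv (hm : 2 ≤ m) (hδ : 2 < δ) :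
    InvOn (waveInv m δ) (wave m δ) (totalBasin m δ) (⋃ x, wedgeProd m x) :=
  (bijOn_wave_totalBasin hm hδ).invOn_invFunOn

theorem differentiableOn_waveInv (hm : 2 ≤ m) (hδ : 2 < δ) :
    DifferentiableOn ℂ (waveInv m δ) (⋃ x, wedgeProd m x) := by
  intro v hv
  obtain ⟨x, hx⟩ := mem_iUnion.1 hv
  obtain ⟨V, hV, hvV, g, hgd, hg⟩ := exists_local_inverse hm hδ hx
  have heq : waveInv m δ =ᶠ[𝓝 v] g := by
    filter_upwards [hV.mem_nhds hvV] with u hu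
    obtain ⟨h1, h2⟩ := hg u hu
    have := (invOn_waveInv hm hδ).1 (mem_iUnion.2 ⟨x, h1⟩)
    rwa [h2] at this
  exact ((hgd.differentiableAt (hV.mem_nhds hvV)).congr_of_eventuallyEq
    heq).differentiableWithinAt

theorem isBiholomorphic_wave (hm : 2 ≤ m) (hδ : 2 < δ) (x : ZMod m × ZMod m) :
    IsBiholomorphic (wave m δ) (basin m δ x) (wedgeProd m x) :=
  ⟨isOpen_basin hm hδ x, isOpen_wedgeProd hm x, differentiableOn_wave hm hδ x, bijOn_wave hm hδ x,
    waveInv m δ, (differentiableOn_waveInv hm hδ).mono (subset_iUnion _ x),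
    (invOn_waveInv hm hδ).mono (subset_iUnion _ x) (subset_iUnion _ x)⟩

theorem isOpen_totalBasin (hm : 2 ≤ m) (hδ : 2 < δ) : IsOpen (totalBasin m δ) :=
  isOpen_iUnion fun x => isOpen_basin hm hδ x

theorem differentiableOn_wave_totalBasin (hm : 2 ≤ m) (hδ : 2 < δ) :
    DifferentiableOn ℂ (wave m δ) (totalBasin m δ) := by
  intro p hp
  obtain ⟨x, hx⟩ := mem_iUnion.1 hp
  exact ((differentiableOn_wave hm hδ x).differentiableAt
    ((isOpen_basin hm hδ x).mem_nhds hx)).differentiableWithinAt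

theorem isBiholomorphic_wave_totalBasin (hm : 2 ≤ m) (hδ : 2 < δ) :
    IsBiholomorphic (wave m δ) (totalBasin m δ) (⋃ x, wedgeProd m x) :=
  ⟨isOpen_totalBasin hm hδ, isOpen_iUnion fun x => isOpen_wedgeProd hm x,
    differentiableOn_wave_totalBasin hm hδ, bijOn_wave_totalBasin hm hδ,
    waveInv m δ, differentiableOn_waveInv hm hδ, invOn_waveInv hm hδ⟩

theorem isPreconnected_basin (hm : 2 ≤ m) (hδ : 2 < δ) (x : ZMod m × ZMod m) :
    IsPreconnected (basin m δ x) := by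
  have h1 : basin m δ x = waveInv m δ '' wedgeProd m x :=
    ((bijOn_wave hm hδ x).image_eq ▸ ((invOn_waveInv hm hδ).1.mono
      (subset_iUnion _ x)).image_image).symm
  rw [h1]
  exact (convex_wedgeProd hm x).isPreconnected.image _
    ((differentiableOn_waveInv hm hδ).mono (subset_iUnion _ x)).continuousOn

/-! ### The conjugacy with the linear part -/

theorem linearPart_mem_wedgeProd (hδ : 2 < δ) {x : ZMod m × ZMod m} {v : ℂ × ℂ}
    (hv : v ∈ wedgeProd m x) : linearPart m δ v ∈ wedgeProd m (step x) :=
  ⟨by simpa [step, linearPart_apply] using mult_pow_mul_mem_wedge hδ hv.2 1, hv.1⟩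

theorem tendsto_scaled_henon (hm : 2 ≤ m) (hδ : 2 < δ) {x : ZMod m × ZMod m} {p : ℂ × ℂ}
    (hp : p ∈ basin m δ x) :
    Tendsto (fun n => scaled m δ n (henon m δ p)) atTop (𝓝 (linearPart m δ (wave m δ p))) := by
  have e : ∀ n, scaled m δ n (henon m δ p) = linearPart m δ (scaled m δ n p) +
      (mult m δ ^ n)⁻¹ • (Complex.exp (-((henon m δ)^[2 * n] p).1 ^ m), (0 : ℂ)) := by
    intro n
    rw [scaled, scaled, ← Function.iterate_succ_apply, Function.iterate_succ_apply', henon_apply,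
      linearPart_apply]
    ext <;> simp; ring
  have h1 : Tendsto (fun n => linearPart m δ (scaled m δ n p)) atTop
      (𝓝 (linearPart m δ (wave m δ p))) := by
    have hc : Continuous (linearPart m δ) := by
      have : linearPart m δ = fun p => (mult m δ * p.2, p.1) := rfl
      rw [this]; fun_prop
    exact (hc.tendsto _).comp (tendsto_scaled_of_mem_basin hp)
  have h2 : Tendsto (fun n => (mult m δ ^ n)⁻¹ •
      (Complex.exp (-((henon m δ)^[2 * n] p).1 ^ m), (0 : ℂ))) atTop (𝓝 0) := by
    have h3 : Tendsto (fun n : ℕ => (δ ^ n)⁻¹) atTop (𝓝 0) :=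
      (tendsto_pow_atTop_atTop_of_one_lt (by linarith)).inv_tendsto_atTop
    refine squeeze_zero_norm' ?_ h3
    filter_upwards [eventually_iterate_mem_absorbing hm hδ 1 hp] with n hn
    have h4 := norm_exp_neg_pow_le hm le_rfl hn.1
    have h5 : Real.exp (-1) ≤ 1 := Real.exp_le_one_iff.2 (by norm_num)
    rw [norm_smul, norm_inv, norm_pow, norm_mult m hδ]
    have h6 : (0 : ℝ) < (δ ^ n)⁻¹ := inv_pos.2 (pow_pos (by linarith) n)
    refine mul_le_of_le_one_right h6.le ?_
    rw [Prod.norm_mk, norm_zero]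
    exact max_le (h4.trans h5) zero_le_one
  simp only [e]
  simpa using h1.add h2

theorem henon_mem_basin (hm : 2 ≤ m) (hδ : 2 < δ) {x : ZMod m × ZMod m} {p : ℂ × ℂ}
    (hp : p ∈ basin m δ x) : henon m δ p ∈ basin m δ (step x) :=
  ⟨_, linearPart_mem_wedgeProd hδ (wave_mem_wedgeProd hp), tendsto_scaled_henon hm hδ hp⟩

theorem wave_henon (hm : 2 ≤ m) (hδ : 2 < δ) {x : ZMod m × ZMod m} {p : ℂ × ℂ}
    (hp : p ∈ basin m δ x) : wave m δ (henon m δ p) = linearPart m δ (wave m δ p) :=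
  tendsto_nhds_unique (tendsto_scaled_of_mem_basin (henon_mem_basin hm hδ hp))
    (tendsto_scaled_henon hm hδ hp)

theorem henon_image_basin (hm : 2 ≤ m) (hδ : 2 < δ) (x : ZMod m × ZMod m) :
    henon m δ '' basin m δ x = basin m δ (step x) := by
  apply Subset.antisymm
  · rintro _ ⟨p, hp, rfl⟩; exact henon_mem_basin hm hδ hp
  · intro q hq
    refine ⟨henonInv m δ q, ?_, rightInverse_henonInv m hδ q⟩
    rw [← iterate_two_mul_mem_basin hδ 1]
    have := henon_mem_basin hm hδ hq
    rw [← rightInverse_henonInv m hδ q] at this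
    exact this

theorem step_surjective : Function.Surjective (step (m := m)) :=
  Finite.surjective_of_injective step_injective

theorem henon_image_totalBasin (hm : 2 ≤ m) (hδ : 2 < δ) :
    henon m δ '' totalBasin m δ = totalBasin m δ := by
  simp only [totalBasin, image_iUnion, henon_image_basin hm hδ]
  exact step_surjective.iUnion_comp (fun x => basin m δ x)

theorem linearPart_image (hm : 2 ≤ m) (hδ : 2 < δ) :
    linearPart m δ '' (⋃ x, wedgeProd m x) = ⋃ x, wedgeProd m x := by
  rw [← (bijOn_wave_totalBasin hm hδ).image_eq, image_image]
  conv_rhs => rw [← henon_image_totalBasin hm hδ, image_image]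
  refine image_congr fun p hp => ?_
  obtain ⟨x, hx⟩ := mem_iUnion.1 hp
  exact (wave_henon hm hδ hx).symm

end Dynamics

/-! ### Convergence of the iterates to the line at infinity -/

open Classical in
/-- The point of the line at infinity in the direction of the vector `v ≠ 0` (and `[0 : 1 : 0]` for
`v = 0`, which never occurs on the basins). -/
noncomputable def direction (v : ℂ × ℂ) : P2 :=
  if h : (!₂[v.1, v.2, 0] : E3) ≠ 0 then Projectivization.mk ℂ !₂[v.1, v.2, 0] h else atInfinity 0

theorem vec3_ne_zero_of_snd {x y z : ℂ} (hy : y ≠ 0) : (!₂[x, y, z] : E3) ≠ 0 := fun h => by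
  have := congrArg (fun v : E3 => v 1) h
  exact hy (by simpa using this)

theorem direction_of_ne_zero {v : ℂ × ℂ} (h : (!₂[v.1, v.2, 0] : E3) ≠ 0) :
    direction v = Projectivization.mk ℂ !₂[v.1, v.2, 0] h := dif_pos h

theorem direction_eq_atInfinity {v : ℂ × ℂ} (hv : v.2 ≠ 0) :
    direction v = atInfinity (v.1 / v.2) := by
  rw [direction_of_ne_zero (vec3_ne_zero_of_snd hv), mk_eq_atInfinity hv]

theorem direction_mem_lineAtInfinity {v : ℂ × ℂ} (hv : v.2 ≠ 0) :
    direction v ∈ lineAtInfinity := by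
  rw [direction_eq_atInfinity hv]; exact atInfinity_mem_lineAtInfinity _

theorem isLift_direction {f : ℂ × ℂ → ℂ × ℂ} {V : Set (ℂ × ℂ)} (hf : DifferentiableOn ℂ f V)
    (h2 : ∀ p ∈ V, (f p).2 ≠ 0) :
    IsLift (fun p => direction (f p)) (fun p => !₂[(f p).1, (f p).2, 0]) V :=
  ⟨differentiableOn_vec3 hf.fst hf.snd (by fun_prop),
    fun p hp => ⟨vec3_ne_zero_of_snd (h2 p hp), direction_of_ne_zero _⟩⟩

theorem holomorphicToP2_direction {f : ℂ × ℂ → ℂ × ℂ} {V : Set (ℂ × ℂ)} (hV : IsOpen V)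
    (hf : DifferentiableOn ℂ f V) (h2 : ∀ p ∈ V, (f p).2 ≠ 0) :
    HolomorphicToP2 (fun p => direction (f p)) V := fun _ hp =>
  ⟨V, hV, hp, Subset.rfl, _, isLift_direction hf h2⟩

theorem norm_vec3_le (x y z : ℂ) : ‖(!₂[x, y, z] : E3)‖ ≤ ‖x‖ + ‖y‖ + ‖z‖ := by
  rw [EuclideanSpace.norm_eq, Fin.sum_univ_three]
  refine Real.sqrt_le_iff.2 ⟨by positivity, ?_⟩
  simp
  nlinarith [mul_nonneg (norm_nonneg x) (norm_nonneg y), mul_nonneg (norm_nonneg x) (norm_nonneg z),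
    mul_nonneg (norm_nonneg y) (norm_nonneg z)]

/-- Closeness of an affine point to the line at infinity, after division by a large factor. -/
theorem dist_affine_direction_le {b : ℂ} (hb : b ≠ 0) {q v : ℂ × ℂ} (hv : v.2 ≠ 0) :
    dist (affine q) (direction v) ≤ 4 * (2 * dist (b⁻¹ • q) v + ‖b‖⁻¹) / ‖v.2‖ := by
  have hv' : (!₂[v.1, v.2, 0] : E3) ≠ 0 := vec3_ne_zero_of_snd hv
  have hq : (!₂[b⁻¹ * q.1, b⁻¹ * q.2, b⁻¹] : E3) ≠ 0 := fun h => by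
    have := congrArg (fun v : E3 => v 2) h
    simp [hb] at this
  have e : affine q = Projectivization.mk ℂ !₂[b⁻¹ * q.1, b⁻¹ * q.2, b⁻¹] hq := by
    rw [affine, Projectivization.mk_eq_mk_iff']
    refine ⟨b, ?_⟩
    ext i; fin_cases i <;> simp [hb]
  rw [e, direction_of_ne_zero hv']
  refine (dist_mk_le _ _ hq hv').trans ?_
  have h1 : (!₂[b⁻¹ * q.1, b⁻¹ * q.2, b⁻¹] : E3) - !₂[v.1, v.2, 0]
      = !₂[b⁻¹ * q.1 - v.1, b⁻¹ * q.2 - v.2, b⁻¹] := by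
    ext i; fin_cases i <;> simp
  have h2 : ‖v.2‖ ≤ ‖(!₂[v.1, v.2, 0] : E3)‖ := by
    simpa using PiLp.norm_apply_le (!₂[v.1, v.2, 0] : E3) 1
  have h3 : ‖b⁻¹ * q.1 - v.1‖ ≤ dist (b⁻¹ • q) v := by
    rw [dist_eq_norm]; exact norm_fst_le (b⁻¹ • q - v)
  have h4 : ‖b⁻¹ * q.2 - v.2‖ ≤ dist (b⁻¹ • q) v := by
    rw [dist_eq_norm]; exact norm_snd_le (b⁻¹ • q - v)
  rw [h1]
  have h5 := norm_vec3_le (b⁻¹ * q.1 - v.1) (b⁻¹ * q.2 - v.2) b⁻¹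
  rw [norm_inv] at h5
  have h6 := norm_pos_iff.2 hv
  gcongr
  linarith

section Limits

variable {m : ℕ} [NeZero m] {δ : ℝ}

/-- The limit of the iterates of even order. -/
noncomputable def evenLimit (m : ℕ) (δ : ℝ) (p : ℂ × ℂ) : P2 := direction (wave m δ p)

/-- The limit of the iterates of odd order. -/
noncomputable def oddLimit (m : ℕ) (δ : ℝ) (p : ℂ × ℂ) : P2 :=
  direction (linearPart m δ (wave m δ p))

theorem wave_ne_zero {x : ZMod m × ZMod m} {p : ℂ × ℂ} (hp : p ∈ basin m δ x) :
    (wave m δ p).1 ≠ 0 ∧ (wave m δ p).2 ≠ 0 :=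
  ⟨ne_zero_of_mem_wedge (wave_mem_wedgeProd hp).1, ne_zero_of_mem_wedge (wave_mem_wedgeProd hp).2⟩

theorem wave_ne_zero_of_mem_totalBasin {p : ℂ × ℂ} (hp : p ∈ totalBasin m δ) :
    (wave m δ p).1 ≠ 0 ∧ (wave m δ p).2 ≠ 0 := by
  obtain ⟨x, hx⟩ := mem_iUnion.1 hp
  exact wave_ne_zero hx

theorem basin_subset_totalBasin (x : ZMod m × ZMod m) : basin m δ x ⊆ totalBasin m δ :=
  subset_iUnion _ x

theorem oddLimit_eq (hm : 2 ≤ m) (hδ : 2 < δ) {p : ℂ × ℂ} (hp : p ∈ totalBasin m δ) :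
    oddLimit m δ p = evenLimit m δ (henon m δ p) := by
  obtain ⟨x, hx⟩ := mem_iUnion.1 hp
  rw [evenLimit, wave_henon hm hδ hx, oddLimit]

theorem holomorphicToP2_evenLimit (hm : 2 ≤ m) (hδ : 2 < δ) {U : Set (ℂ × ℂ)} (hU : IsOpen U)
    (h : U ⊆ totalBasin m δ) : HolomorphicToP2 (evenLimit m δ) U :=
  holomorphicToP2_direction hU ((differentiableOn_wave_totalBasin hm hδ).mono h)
    fun _ hp => (wave_ne_zero_of_mem_totalBasin (h hp)).2

theorem holomorphicToP2_oddLimit (hm : 2 ≤ m) (hδ : 2 < δ) {U : Set (ℂ × ℂ)} (hU : IsOpen U)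
    (h : U ⊆ totalBasin m δ) : HolomorphicToP2 (oddLimit m δ) U := by
  have hd := (differentiableOn_wave_totalBasin hm hδ).mono h
  exact holomorphicToP2_direction (f := fun p => linearPart m δ (wave m δ p)) hU
    ((hd.snd.const_mul _).prodMk hd.fst) fun _ hp => (wave_ne_zero_of_mem_totalBasin (h hp)).1

theorem tendstoUniformlyOn_even (hm : 2 ≤ m) (hδ : 2 < δ) {K : Set (ℂ × ℂ)} (hK : IsCompact K)
    (hKb : K ⊆ totalBasin m δ) :
    TendstoUniformlyOn (fun (n : ℕ) p => affine ((henon m δ)^[2 * n] p)) (evenLimit m δ)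
      atTop K := by
  have hloc : TendstoLocallyUniformlyOn (scaled m δ) (wave m δ) atTop (totalBasin m δ) :=
    tendstoLocallyUniformlyOn_iUnion (fun x => isOpen_basin hm hδ x)
      fun x => tendstoLocallyUniformlyOn_scaled hm hδ x
  have hunif := (tendstoLocallyUniformlyOn_iff_forall_isCompact (isOpen_totalBasin hm hδ)).1 hloc
    K hKb hK
  obtain ⟨c, hc, hcK⟩ : ∃ c : ℝ, 0 < c ∧ ∀ p ∈ K, c ≤ ‖(wave m δ p).2‖ := by
    rcases K.eq_empty_or_nonempty with rfl | hne
    · exact ⟨1, one_pos, by simp⟩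
    · obtain ⟨p, hp, hmin⟩ := hK.exists_isMinOn hne
        ((differentiableOn_wave_totalBasin hm hδ).mono hKb).snd.continuousOn.norm
      exact ⟨_, norm_pos_iff.2 (wave_ne_zero_of_mem_totalBasin (hKb hp)).2, fun q hq => hmin hq⟩
  rw [Metric.tendstoUniformlyOn_iff] at hunif ⊢
  intro ε hε
  have h1 : Tendsto (fun n : ℕ => (δ ^ n)⁻¹) atTop (𝓝 0) :=
    (tendsto_pow_atTop_atTop_of_one_lt (by linarith)).inv_tendsto_atTop
  have hη : 0 < ε * c / 24 := by positivity
  filter_upwards [hunif (ε * c / 24) hη, h1.eventually (gt_mem_nhds hη)] with n hn hn' p hp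
  have h2 := dist_affine_direction_le (pow_ne_zero n (mult_ne_zero m hδ))
    (q := (henon m δ)^[2 * n] p) (wave_ne_zero_of_mem_totalBasin (hKb hp)).2
  rw [dist_comm]
  refine h2.trans_lt ?_
  have h3 := hn p hp
  rw [dist_comm] at h3
  have h4 := hcK p hp
  rw [norm_pow, norm_mult m hδ, div_lt_iff₀ (hc.trans_le h4)]
  change dist ((mult m δ ^ n)⁻¹ • (henon m δ)^[2 * n] p) _ < _ at h3
  nlinarith

theorem iteratesTendsto_even (hm : 2 ≤ m) (hδ : 2 < δ) {l : ℕ → ℕ} (hl : Tendsto l atTop atTop) :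
    IteratesTendsto (henon m δ) (fun j => 2 * l j) (evenLimit m δ) (totalBasin m δ) := by
  intro K hKb hK u hu
  exact hl.eventually (tendstoUniformlyOn_even hm hδ hK hKb u hu)

theorem iteratesTendsto_odd (hm : 2 ≤ m) (hδ : 2 < δ) {l : ℕ → ℕ} (hl : Tendsto l atTop atTop) :
    IteratesTendsto (henon m δ) (fun j => 2 * l j + 1) (oddLimit m δ) (totalBasin m δ) := by
  intro K hKb hK u hu
  have hK' : IsCompact (henon m δ '' K) := hK.image (differentiable_henon m δ).continuous
  have hKb' : henon m δ '' K ⊆ totalBasin m δ := by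
    rw [← henon_image_totalBasin hm hδ]; exact image_mono hKb
  filter_upwards [hl.eventually (tendstoUniformlyOn_even hm hδ hK' hKb' u hu)] with j hj p hp
  rw [oddLimit_eq hm hδ (hKb hp), Function.iterate_succ_apply]
  exact hj _ (mem_image_of_mem _ hp)

theorem IteratesTendsto.mono {F : ℂ × ℂ → ℂ × ℂ} {k : ℕ → ℕ} {h : ℂ × ℂ → P2}
    {U V : Set (ℂ × ℂ)} (hh : IteratesTendsto F k h U) (hVU : V ⊆ U) : IteratesTendsto F k h V :=
  fun K hK hKc => hh K (hK.trans hVU) hKc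

theorem IteratesTendsto.tendsto {F : ℂ × ℂ → ℂ × ℂ} {k : ℕ → ℕ} {h : ℂ × ℂ → P2}
    {U : Set (ℂ × ℂ)} (hh : IteratesTendsto F k h U) {p : ℂ × ℂ} (hp : p ∈ U) :
    Tendsto (fun j => affine (F^[k j] p)) atTop (𝓝 (h p)) :=
  (hh {p} (singleton_subset_iff.2 hp) isCompact_singleton).tendsto_at (mem_singleton p)

/-- A sequence tending to infinity has a subsequence of even terms or one of odd terms. -/
theorem exists_even_or_odd_subseq {k : ℕ → ℕ} (hk : Tendsto k atTop atTop) :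
    ∃ s : ℕ → ℕ, StrictMono s ∧ ∃ l : ℕ → ℕ, Tendsto l atTop atTop ∧
      ((k ∘ s = fun j => 2 * l j) ∨ (k ∘ s = fun j => 2 * l j + 1)) := by
  have hdiv : ∀ {s : ℕ → ℕ}, StrictMono s → Tendsto (fun j => k (s j) / 2) atTop atTop :=
    fun hs => (Nat.tendsto_div_const_atTop two_ne_zero).comp (hk.comp hs.tendsto_atTop)
  by_cases h : ∃ᶠ n in atTop, Even (k n)
  · obtain ⟨s, hs, hev⟩ := extraction_of_frequently_atTop h
    exact ⟨s, hs, _, hdiv hs, Or.inl (funext fun j => (Nat.two_mul_div_two_of_even (hev j)).symm)⟩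
  · have h' : ∃ᶠ n in atTop, Odd (k n) := by
      rw [not_frequently] at h
      exact (h.mono fun n hn => Nat.not_even_iff_odd.1 hn).frequently
    obtain ⟨s, hs, hodd⟩ := extraction_of_frequently_atTop h'
    exact ⟨s, hs, _, hdiv hs,
      Or.inr (funext fun j => (Nat.two_mul_div_two_add_one_of_odd (hodd j)).symm)⟩

theorem normalIterates_totalBasin (hm : 2 ≤ m) (hδ : 2 < δ) :
    NormalIterates (henon m δ) (totalBasin m δ) := by
  intro k
  have hopen := isOpen_totalBasin (m := m) hm hδ
  by_cases hc : ∃ c, ∃ᶠ n in atTop, k n = c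
  · -- a subsequence is constant
    obtain ⟨c, hc⟩ := hc
    obtain ⟨s, hs, hsc⟩ := extraction_of_frequently_atTop hc
    refine ⟨s, hs, fun p => affine ((henon m δ)^[c] p), ?_, ?_⟩
    · refine fun p hp => ⟨_, hopen, hp, Subset.rfl,
        fun p => !₂[((henon m δ)^[c] p).1, ((henon m δ)^[c] p).2, 1], ?_,
        fun q _ => ⟨affine_ne_zero _, rfl⟩⟩
      have hd := differentiable_iterate (differentiable_henon m δ) c
      exact differentiableOn_vec3 hd.fst.differentiableOn hd.snd.differentiableOn (by fun_prop)
    · intro K _ _ u hu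
      refine Eventually.of_forall fun j p _ => ?_
      simp only [Function.comp, hsc]
      exact refl_mem_uniformity hu
  · have hk : Tendsto k atTop atTop := by
      refine tendsto_atTop.2 fun b => ?_
      filter_upwards [(Finset.range b).eventually_all.2
        fun c _ => not_frequently.1 (not_exists.1 hc c)] with n hn
      exact not_lt.1 fun h => hn _ (Finset.mem_range.2 h) rfl
    obtain ⟨s, hs, l, hl, h | h⟩ := exists_even_or_odd_subseq hk
    · exact ⟨s, hs, _, holomorphicToP2_evenLimit hm hδ hopen Subset.rfl,
        h ▸ iteratesTendsto_even hm hδ hl⟩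
    · exact ⟨s, hs, _, holomorphicToP2_oddLimit hm hδ hopen Subset.rfl,
        h ▸ iteratesTendsto_odd hm hδ hl⟩

theorem totalBasin_subset_fatouSet (hm : 2 ≤ m) (hδ : 2 < δ) :
    totalBasin m δ ⊆ fatouSet (henon m δ) := fun _ hp =>
  ⟨_, isOpen_totalBasin hm hδ, hp, normalIterates_totalBasin hm hδ⟩

theorem eqOn_evenLimit_or_oddLimit (hm : 2 ≤ m) (hδ : 2 < δ) {U : Set (ℂ × ℂ)}
    (hU : U ⊆ totalBasin m δ) {h : ℂ × ℂ → P2} (hh : IsLimitFunction (henon m δ) U h) :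
    EqOn h (evenLimit m δ) U ∨ EqOn h (oddLimit m δ) U := by
  obtain ⟨-, k, hk, hlim⟩ := hh
  obtain ⟨s, hs, l, hl, e | e⟩ := exists_even_or_odd_subseq hk.tendsto_atTop
  · refine Or.inl fun p hp => ?_
    have h1 := (hlim.tendsto hp).comp hs.tendsto_atTop
    have h2 := iteratesTendsto_even hm hδ hl
    rw [← e] at h2
    replace h2 := (h2.mono hU).tendsto hp
    exact tendsto_nhds_unique h1 h2
  · refine Or.inr fun p hp => ?_
    have h1 := (hlim.tendsto hp).comp hs.tendsto_atTop
    have h2 := iteratesTendsto_odd hm hδ hl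
    rw [← e] at h2
    replace h2 := (h2.mono hU).tendsto hp
    exact tendsto_nhds_unique h1 h2

theorem isLimitFunction_evenLimit (hm : 2 ≤ m) (hδ : 2 < δ) {U : Set (ℂ × ℂ)} (hUo : IsOpen U)
    (hU : U ⊆ totalBasin m δ) : IsLimitFunction (henon m δ) U (evenLimit m δ) :=
  ⟨holomorphicToP2_evenLimit hm hδ hUo hU, fun j => 2 * j, fun _ _ h => by
    simpa using h, (iteratesTendsto_even hm hδ tendsto_id).mono hU⟩

theorem isLimitFunction_oddLimit (hm : 2 ≤ m) (hδ : 2 < δ) {U : Set (ℂ × ℂ)} (hUo : IsOpen U)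
    (hU : U ⊆ totalBasin m δ) : IsLimitFunction (henon m δ) U (oddLimit m δ) :=
  ⟨holomorphicToP2_oddLimit hm hδ hUo hU, fun j => 2 * j + 1, fun _ _ h => by
    simpa using h, (iteratesTendsto_odd hm hδ tendsto_id).mono hU⟩

/-! ### The limit sets -/

theorem evenLimit_image (hm : 2 ≤ m) (hδ : 2 < δ) {x : ZMod m × ZMod m} {d : ℕ}
    (hd : (d : ZMod m) = x.1 - x.2) :
    evenLimit m δ '' basin m δ x = sectorAtInfinity m d := by
  apply Subset.antisymm
  · rintro _ ⟨p, hp, rfl⟩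
    have h1 := wave_mem_wedgeProd hp
    rw [evenLimit, direction_eq_atInfinity (wave_ne_zero hp).2]
    exact mem_image_of_mem _ (div_mem_sector hm h1.1 h1.2 hd)
  · rintro _ ⟨ζ, hζ, rfl⟩
    obtain ⟨z, hz, w, hw, rfl⟩ := exists_div_eq_of_mem_sector hm hd hζ
    obtain ⟨p, hp, hpv⟩ := (bijOn_wave hm hδ x).surjOn (show (z, w) ∈ wedgeProd m x from ⟨hz, hw⟩)
    refine ⟨p, hp, ?_⟩
    rw [evenLimit, hpv, direction_eq_atInfinity (ne_zero_of_mem_wedge hw)]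

theorem oddLimit_image (hm : 2 ≤ m) (hδ : 2 < δ) {x : ZMod m × ZMod m} {d : ℕ}
    (hd : (d : ZMod m) = 1 - (x.1 - x.2)) :
    oddLimit m δ '' basin m δ x = sectorAtInfinity m d := by
  have h1 : oddLimit m δ '' basin m δ x = evenLimit m δ '' (henon m δ '' basin m δ x) := by
    rw [image_image]
    exact image_congr fun p hp => oddLimit_eq hm hδ (basin_subset_totalBasin x hp)
  rw [h1, henon_image_basin hm hδ, evenLimit_image hm hδ]
  rw [hd]; simp only [step]; ring

omit [NeZero m] in
theorem sectorAtInfinity_subset (d : ℕ) : sectorAtInfinity m d ⊆ lineAtInfinity := by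
  rintro _ ⟨ζ, -, rfl⟩; exact atInfinity_mem_lineAtInfinity ζ

theorem evenLimit_image_subset (hm : 2 ≤ m) (hδ : 2 < δ) (x : ZMod m × ZMod m) :
    evenLimit m δ '' basin m δ x ⊆ lineAtInfinity := by
  rw [evenLimit_image hm hδ (ZMod.natCast_zmod_val _)]; exact sectorAtInfinity_subset _

theorem oddLimit_image_subset (hm : 2 ≤ m) (hδ : 2 < δ) (x : ZMod m × ZMod m) :
    oddLimit m δ '' basin m δ x ⊆ lineAtInfinity := by
  rw [oddLimit_image hm hδ (ZMod.natCast_zmod_val _)]; exact sectorAtInfinity_subset _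

theorem disjoint_sectorAtInfinity (hm : 2 ≤ m) {i j : ℕ} (h : (i : ZMod m) ≠ j) :
    Disjoint (sectorAtInfinity m i) (sectorAtInfinity m j) :=
  (disjoint_image_iff atInfinity_injective).2 (disjoint_sector hm h)

theorem isEscaping_basin (hm : 2 ≤ m) (hδ : 2 < δ) (x : ZMod m × ZMod m) :
    IsEscaping (henon m δ) (basin m δ x) := by
  intro h hh
  rcases eqOn_evenLimit_or_oddLimit hm hδ (basin_subset_totalBasin x) hh with e | e
  · rw [e.image_eq]; exact evenLimit_image_subset hm hδ x
  · rw [e.image_eq]; exact oddLimit_image_subset hm hδ x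

theorem not_eqOn_evenLimit_oddLimit (hm : 2 ≤ m) (hδ : 2 < δ) (x : ZMod m × ZMod m) :
    ¬ EqOn (evenLimit m δ) (oddLimit m δ) (basin m δ x) := by
  intro h
  -- equality would force `z ^ 2 = a w ^ 2` on the whole product of sectors
  have key : ∀ z ∈ wedge m x.1, ∀ w ∈ wedge m x.2, z * z = mult m δ * w * w := by
    intro z hz w hw
    obtain ⟨p, hp, hpv⟩ := (bijOn_wave hm hδ x).surjOn (show (z, w) ∈ wedgeProd m x from ⟨hz, hw⟩)
    have hz0 := ne_zero_of_mem_wedge hz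
    have hw0 := ne_zero_of_mem_wedge hw
    have h1 := h hp
    rw [evenLimit, oddLimit, hpv, direction_eq_atInfinity hw0, linearPart_apply,
      direction_eq_atInfinity hz0] at h1
    exact (div_eq_div_iff hw0 hz0).1 (atInfinity_injective h1)
  have h1 := rot_mem_wedge hm x.1
  have h2 := wedge_smul h1 two_pos
  have h3 := rot_mem_wedge hm x.2
  have h4 := (key _ h1 _ h3).trans (key _ h2 _ h3).symm
  have h5 := rot_ne_zero (m := m) x.1
  have h6 : 3 * (rot m x.1 * rot m x.1) = 0 := by push_cast at h4; linear_combination -h4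
  simp [h5] at h6

/-! ### The rank of the limit functions -/

theorem surjective_fderiv_wave (hm : 2 ≤ m) (hδ : 2 < δ) {x : ZMod m × ZMod m} {p : ℂ × ℂ}
    (hp : p ∈ basin m δ x) : Function.Surjective (fderiv ℂ (wave m δ) p) := by
  have hpt := basin_subset_totalBasin x hp
  have hv : wave m δ p ∈ ⋃ x, wedgeProd m x := (bijOn_wave_totalBasin hm hδ).mapsTo hpt
  have hBo : IsOpen (⋃ x, wedgeProd m x) := isOpen_iUnion fun x => isOpen_wedgeProd hm x
  have hgp : waveInv m δ (wave m δ p) = p := (invOn_waveInv hm hδ).1 hpt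
  have hg := ((differentiableOn_waveInv hm hδ).differentiableAt (hBo.mem_nhds hv)).hasFDerivAt
  have hf : HasFDerivAt (wave m δ) (fderiv ℂ (wave m δ) p) (waveInv m δ (wave m δ p)) := by
    rw [hgp]
    exact ((differentiableOn_wave_totalBasin hm hδ).differentiableAt
      ((isOpen_totalBasin hm hδ).mem_nhds hpt)).hasFDerivAt
  have hid : HasFDerivAt (wave m δ ∘ waveInv m δ) (ContinuousLinearMap.id ℂ (ℂ × ℂ))
      (wave m δ p) := by
    refine (hasFDerivAt_id _).congr_of_eventuallyEq ?_
    filter_upwards [hBo.mem_nhds hv] with v hv using (invOn_waveInv hm hδ).2 hv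
  have := (hf.comp _ hg).unique hid
  exact fun u => ⟨_, congrArg (fun T => T u) this⟩

/-- The direction of a holomorphic map has rank `1` as soon as the differential of the map
attains `(1, 0)` at some point. -/
theorem hasGenericRank_direction {f : ℂ × ℂ → ℂ × ℂ} {Ω : Set (ℂ × ℂ)} (hΩ : IsOpen Ω)
    (hf : DifferentiableOn ℂ f Ω) (h2 : ∀ p ∈ Ω, (f p).2 ≠ 0) {p : ℂ × ℂ} (hp : p ∈ Ω)
    {u : ℂ × ℂ} (hu : fderiv ℂ f p u = (1, 0)) :
    HasGenericRank (fun p => direction (f p)) Ω 1 := by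
  have hle : ∀ q ∈ Ω, ∀ k, HasRankAt (fun p => direction (f p)) q k → k ≤ 1 := fun q hq k hk =>
    hk.le_one hΩ (by rintro _ ⟨y, hy, rfl⟩; exact direction_mem_lineAtInfinity (h2 y hy)) hq
  refine ⟨⟨p, hp, ?_⟩, fun k ⟨q, hq, hk⟩ => hle q hq k hk⟩
  have hrank : HasRankAt (fun p => direction (f p)) p _ :=
    ⟨Ω, hΩ, hp, _, isLift_direction hf h2, rfl⟩
  convert hrank
  refine le_antisymm ?_ (hle p hp _ hrank)
  have hd : HasFDerivAt f (fderiv ℂ f p) p :=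
    (hf.differentiableAt (hΩ.mem_nhds hp)).hasFDerivAt
  have hH := ((isLift_direction hf h2).1.differentiableAt (hΩ.mem_nhds hp)).hasFDerivAt
  set D := fderiv ℂ (fun p => (!₂[(f p).1, (f p).2, 0] : E3)) p with hD
  -- the differential of the lift sends `u` to `(1, 0, 0)`
  have h0 : D u 0 = 1 := by
    have e1 := (EuclideanSpace.proj (𝕜 := ℂ) (0 : Fin 3)).hasFDerivAt.comp p hH
    have e2 : HasFDerivAt (fun p => (f p).1) _ p := hd.fst
    have := congrArg (fun T => T u) (e1.unique (e2.congr_of_eventuallyEq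
      (Eventually.of_forall fun q => by simp)))
    simpa [hu] using this
  have h1 : D u 1 = 0 := by
    have e1 := (EuclideanSpace.proj (𝕜 := ℂ) (1 : Fin 3)).hasFDerivAt.comp p hH
    have e2 : HasFDerivAt (fun p => (f p).2) _ p := hd.snd
    have := congrArg (fun T => T u) (e1.unique (e2.congr_of_eventuallyEq
      (Eventually.of_forall fun q => by simp)))
    simpa [hu] using this
  refine one_le_finrank_map_mkQ (w := D u) ⟨u, rfl⟩ fun hmem => ?_
  obtain ⟨c, hc⟩ := Submodule.mem_span_singleton.1 hmem
  have hc1 := congrArg (fun v : E3 => v 1) hc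
  have hc0 := congrArg (fun v : E3 => v 0) hc
  simp [h0, h1, h2 p hp] at hc0 hc1
  simp [hc1] at hc0

theorem basin_nonempty (hm : 2 ≤ m) (hδ : 2 < δ) (x : ZMod m × ZMod m) :
    (basin m δ x).Nonempty := by
  obtain ⟨p, hp, -⟩ := (bijOn_wave hm hδ x).surjOn
    (show (rot m x.1, rot m x.2) ∈ wedgeProd m x from ⟨rot_mem_wedge hm _, rot_mem_wedge hm _⟩)
  exact ⟨p, hp⟩

theorem hasGenericRank_evenLimit (hm : 2 ≤ m) (hδ : 2 < δ) (x : ZMod m × ZMod m) :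
    HasGenericRank (evenLimit m δ) (basin m δ x) 1 := by
  obtain ⟨p, hp⟩ := basin_nonempty (δ := δ) hm hδ x
  obtain ⟨u, hu⟩ := surjective_fderiv_wave hm hδ hp (1, 0)
  exact hasGenericRank_direction (isOpen_basin hm hδ x) (differentiableOn_wave hm hδ x)
    (fun q hq => (wave_ne_zero hq).2) hp hu

theorem hasGenericRank_oddLimit (hm : 2 ≤ m) (hδ : 2 < δ) (x : ZMod m × ZMod m) :
    HasGenericRank (oddLimit m δ) (basin m δ x) 1 := by
  obtain ⟨p, hp⟩ := basin_nonempty (δ := δ) hm hδ x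
  obtain ⟨u, hu⟩ := surjective_fderiv_wave hm hδ hp (0, (mult m δ)⁻¹)
  have hd := differentiableOn_wave hm hδ x
  refine hasGenericRank_direction (f := fun q => linearPart m δ (wave m δ q))
    (isOpen_basin hm hδ x) ((hd.snd.const_mul _).prodMk hd.fst)
    (fun q hq => (wave_ne_zero hq).1) hp (u := u) ?_
  have hdp := (hd.differentiableAt ((isOpen_basin hm hδ x).mem_nhds hp)).hasFDerivAt
  have : HasFDerivAt (fun q => linearPart m δ (wave m δ q)) _ p :=
    (hdp.snd.const_mul (mult m δ)).prodMk hdp.fst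
  rw [this.fderiv]
  simp [hu, mult_ne_zero m hδ]

end Limits

/-! ### One-variable tools -/

/-- Harnack's inequality between the centre of a disc and another point, for the real part of a
holomorphic function; it is the Schwarz lemma after a Cayley transform. -/
theorem harnack {f : ℂ → ℂ} {ρ : ℝ} (hρ : 1 < ρ) (hf : DifferentiableOn ℂ f (Metric.ball 0 ρ))
    (hpos : ∀ t ∈ Metric.ball (0 : ℂ) ρ, 0 < (f t).re) :
    (ρ - 1) / (ρ + 1) * (f 1).re ≤ (f 0).re := by
  have hρ0 : 0 < ρ := by linarith
  have hm0 : (0 : ℂ) ∈ Metric.ball (0 : ℂ) ρ := Metric.mem_ball_self hρ0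
  have hm1 : (1 : ℂ) ∈ Metric.ball (0 : ℂ) ρ := by simpa using hρ
  set b := f 0 with hb
  have hden : ∀ t ∈ Metric.ball (0 : ℂ) ρ, f t + starRingEnd ℂ b ≠ 0 := fun t ht h => by
    have := congrArg Complex.re h
    simp at this
    linarith [hpos t ht, hpos 0 hm0]
  let g : ℂ → ℂ := fun t => (f t - b) / (f t + starRingEnd ℂ b)
  have hg : DifferentiableOn ℂ g (Metric.ball 0 ρ) :=
    (hf.sub_const _).div (hf.add_const _) hden
  have hg0 : g 0 = 0 := by simp [g, hb]
  have hmaps : MapsTo g (Metric.ball 0 ρ) (Metric.closedBall (g 0) 1) := by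
    intro t ht
    rw [hg0, mem_closedBall_zero_iff, norm_div, div_le_one (norm_pos_iff.2 (hden t ht)),
      ← sq_le_sq₀ (norm_nonneg _) (norm_nonneg _), ← Complex.normSq_eq_norm_sq,
      ← Complex.normSq_eq_norm_sq, Complex.normSq_apply, Complex.normSq_apply]
    simp
    nlinarith [mul_pos (hpos t ht) (hpos 0 hm0)]
  have h1 := Complex.dist_le_div_mul_dist_of_mapsTo_ball hg hmaps hm1
  rw [hg0, dist_zero_right, dist_zero_right, norm_one, mul_one, norm_div,
    div_le_div_iff₀ (norm_pos_iff.2 (hden 1 hm1)) hρ0, one_mul] at h1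
  -- compare the real parts
  have h2 : ((f 1).re - b.re) * ρ ≤ (f 1).re + b.re := by
    by_contra hcon
    push Not at hcon
    have hx := hpos 1 hm1
    have hy := hpos 0 hm0
    rw [← hb] at hy
    have h3 : (‖f 1 - b‖ * ρ) ^ 2 ≤ ‖f 1 + starRingEnd ℂ b‖ ^ 2 :=
      pow_le_pow_left₀ (by positivity) h1 2
    rw [mul_pow, ← Complex.normSq_eq_norm_sq, ← Complex.normSq_eq_norm_sq, Complex.normSq_apply,
      Complex.normSq_apply] at h3
    simp at h3
    have h4 : ((f 1).re + b.re) ^ 2 < (((f 1).re - b.re) * ρ) ^ 2 :=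
      pow_lt_pow_left₀ hcon (by linarith) two_ne_zero
    have h5 : ((f 1).im - b.im) ^ 2 ≤ ((f 1).im - b.im) ^ 2 * ρ ^ 2 :=
      le_mul_of_one_le_right (sq_nonneg _) (one_le_pow₀ hρ.le)
    nlinarith
  rw [div_mul_eq_mul_div, div_le_iff₀ (by linarith)]
  linarith

/-- A holomorphic function on a disc that is not identically zero has no zeros on some large
circle. -/
theorem exists_circle_ne_zero {f : ℂ → ℂ} {R : ℝ} (hR : 1 < R)
    (hf : DifferentiableOn ℂ f (Metric.ball 0 R)) (h1 : f 1 ≠ 0) :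
    ∃ ρ, 1 < ρ ∧ ρ < R ∧ ∀ t : ℂ, ‖t‖ = ρ → f t ≠ 0 := by
  have hA := hf.analyticOnNhd Metric.isOpen_ball
  rcases hA.eqOn_zero_or_eventually_ne_zero_of_preconnected
    (convex_ball (0 : ℂ) R).isPreconnected with h | h
  · exact absurd (h (show (1 : ℂ) ∈ Metric.ball 0 R by simpa using hR)) h1
  obtain ⟨R', h1R', hR'R⟩ := exists_between hR
  have hsub : Metric.closedBall (0 : ℂ) R' ⊆ Metric.ball 0 R := Metric.closedBall_subset_ball hR'R
  have hfin := (isCompact_closedBall (0 : ℂ) R').finite_sdiff_of_mem_codiscreteWithin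
    (Filter.codiscreteWithin_mono hsub h)
  obtain ⟨ρ, hρ, hρS⟩ := (Ioo_infinite h1R').exists_notMem_finite (hfin.image norm)
  refine ⟨ρ, hρ.1, hρ.2.trans hR'R, fun t ht h0 => hρS ⟨t, ⟨?_, fun h' => h' h0⟩, ht⟩⟩
  rw [mem_closedBall_zero_iff, ht]; exact hρ.2.le

/-! ### Limits on normal domains that meet the basins -/

/-- If the iterates are normal on a connected open set and a sequence of them converges on an
open subset, then it converges on the whole set. -/
theorem NormalIterates.exists_limit {F : ℂ × ℂ → ℂ × ℂ} {U O : Set (ℂ × ℂ)}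
    (hn : NormalIterates F U) (hU : IsPreconnected U) (hO : IsOpen O) (hOU : O ⊆ U)
    (hOne : O.Nonempty) {l : ℕ → ℕ} {g : ℂ × ℂ → P2}
    (hg : ∀ p ∈ O, Tendsto (fun n => affine (F^[l n] p)) atTop (𝓝 (g p))) :
    ∃ h, HolomorphicToP2 h U ∧ EqOn h g O ∧ IteratesTendsto F l h U := by
  have hlim : ∀ {s : ℕ → ℕ} {h : ℂ × ℂ → P2}, StrictMono s → IteratesTendsto F (l ∘ s) h U →
      EqOn h g O := fun hs hh p hp =>
    tendsto_nhds_unique (hh.tendsto (hOU hp)) ((hg p hp).comp hs.tendsto_atTop)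
  obtain ⟨s, hs, h, hh, hconv⟩ := hn l
  refine ⟨h, hh, hlim hs hconv, fun K hKU hK => ?_⟩
  rw [Metric.tendstoUniformlyOn_iff]
  intro ε hε
  by_contra hcon
  obtain ⟨s', hs', hbad⟩ := extraction_of_frequently_atTop (not_eventually.1 hcon)
  obtain ⟨s'', hs'', h', hh', hconv'⟩ := hn (l ∘ s')
  have heq : EqOn h h' U := by
    refine hh.eqOn_of_eqOn_open hU hh' hO (by rwa [inter_eq_self_of_subset_right hOU]) ?_
    exact (hlim hs hconv).trans (hlim (hs'.comp hs'') hconv').symm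
  obtain ⟨n, hn'⟩ := (Metric.tendstoUniformlyOn_iff.1 (hconv' K hKU hK) ε hε).exists
  refine hbad (s'' n) fun p hp => ?_
  rw [heq (hKU hp)]
  exact hn' p hp

/-- On a compact set where the limit avoids the point `[1 : 0 : 0]`, the first coordinate of
the iterates is bounded by a multiple of the second one. -/
theorem exists_fst_le_mul_snd {F : ℂ × ℂ → ℂ × ℂ} {l : ℕ → ℕ} {h : ℂ × ℂ → P2}
    {H : ℂ × ℂ → E3} {V K : Set (ℂ × ℂ)} (hH : IsLift h H V) (hK : IsCompact K) (hKV : K ⊆ V)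
    (hne : ∀ p ∈ K, H p 1 ≠ 0)
    (hlim : TendstoUniformlyOn (fun (j : ℕ) p => affine (F^[l j] p)) h atTop K) :
    ∃ C : ℝ, ∀ᶠ j in atTop, ∀ p ∈ K, ‖(F^[l j] p).1‖ ≤ C * ‖(F^[l j] p).2‖ := by
  have hentry : ∀ (v : E3) (hv : v ≠ 0),
      ‖entry 1 1 (Projectivization.mk ℂ v hv)‖ = ‖v 1‖ ^ 2 / ‖v‖ ^ 2 := by
    intro v hv
    rw [entry_mk, norm_div, norm_mul, RCLike.norm_conj, Complex.norm_real, Real.norm_eq_abs,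
      abs_of_nonneg (by positivity)]
    ring
  obtain ⟨c, hc, hcK⟩ : ∃ c : ℝ, 0 < c ∧ ∀ p ∈ K, c ≤ ‖entry 1 1 (h p)‖ := by
    rcases K.eq_empty_or_nonempty with rfl | hKne
    · exact ⟨1, one_pos, by simp⟩
    have hHc := hH.1.continuousOn.mono hKV
    have hHc1 : ContinuousOn (fun p => H p 1) K :=
      ((differentiableOn_euclidean.1 hH.1 1).continuousOn).mono hKV
    have hcont : ContinuousOn (fun p => ‖H p 1‖ ^ 2 / ‖H p‖ ^ 2) K := by
      refine (hHc1.norm.pow 2).div (hHc.norm.pow 2) fun p hp => ?_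
      obtain ⟨h0, -⟩ := hH.2 p (hKV hp)
      exact pow_ne_zero 2 (norm_ne_zero_iff.2 h0)
    obtain ⟨p, hp, hmin⟩ := hK.exists_isMinOn hKne hcont
    obtain ⟨h0, -⟩ := hH.2 p (hKV hp)
    refine ⟨_, div_pos (pow_pos (norm_pos_iff.2 (hne p hp)) 2)
      (pow_pos (norm_pos_iff.2 h0) 2), fun q hq => ?_⟩
    obtain ⟨h0', h1'⟩ := hH.2 q (hKV hq)
    rw [h1', hentry]
    exact hmin hq
  refine ⟨√(2 / c), ?_⟩
  filter_upwards [Metric.tendstoUniformlyOn_iff.1 hlim (c / 2) (by positivity)] with j hj p hp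
  set y := F^[l j] p
  have h1 : dist (entry 1 1 (h p)) (entry 1 1 (affine y)) < c / 2 :=
    (dist_entry_le 1 1 _ _).trans_lt (hj p hp)
  have h2 : c / 2 ≤ ‖entry 1 1 (affine y)‖ := by
    rw [dist_eq_norm] at h1
    linarith [norm_sub_norm_le (entry 1 1 (h p)) (entry 1 1 (affine y)), hcK p hp]
  have hy := norm_pos_iff.2 (affine_ne_zero y)
  rw [affine, hentry, le_div_iff₀ (by positivity)] at h2
  have h3 : ‖y.1‖ ^ 2 ≤ ‖(!₂[y.1, y.2, 1] : E3)‖ ^ 2 := by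
    have := PiLp.norm_apply_le (!₂[y.1, y.2, 1] : E3) 0
    exact pow_le_pow_left₀ (norm_nonneg _) (by simpa using this) 2
  have h4 : ‖y.1‖ ^ 2 ≤ 2 / c * ‖y.2‖ ^ 2 := by
    have h5 : c / 2 * ‖y.1‖ ^ 2 ≤ ‖y.2‖ ^ 2 := by
      refine (mul_le_mul_of_nonneg_left h3 (by positivity)).trans ?_
      simpa using h2
    rw [div_mul_eq_mul_div, le_div_iff₀ hc]
    linarith
  refine Real.le_sqrt_of_sq_le h4 |>.trans_eq ?_
  rw [Real.sqrt_mul (by positivity), Real.sqrt_sq (norm_nonneg _)]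

section Boundary

variable {m : ℕ} [NeZero m] {δ : ℝ}

theorem mult_pow : mult m δ ^ m = ((δ ^ m : ℝ) : ℂ) := by
  rw [mult_eq, mul_pow, rot_pow, mul_one]; push_cast; rfl

theorem re_pow_scaled (hδ : 2 < δ) (n : ℕ) (p : ℂ × ℂ) :
    (((henon m δ)^[2 * n] p).1 ^ m).re = (δ ^ m) ^ n * ((scaled m δ n p).1 ^ m).re ∧
    (((henon m δ)^[2 * n] p).2 ^ m).re = (δ ^ m) ^ n * ((scaled m δ n p).2 ^ m).re := by
  have key : ∀ z : ℂ, ((mult m δ ^ n * z) ^ m).re = (δ ^ m) ^ n * (z ^ m).re := by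
    intro z
    rw [mul_pow, ← pow_mul, mul_comm n, pow_mul, mult_pow, ← Complex.ofReal_pow,
      Complex.re_ofReal_mul]
  rw [← mult_pow_smul_scaled hδ n p]
  exact ⟨key _, key _⟩

/-- A point belongs to a basin as soon as the rescaled iterates satisfy `Re z ^ m ≥ c` and
`Re w ^ m ≥ c` for some `c > 0`: the exponential terms are then bounded, which forces the
convergence of the rescaled iterates. -/
theorem mem_totalBasin_of_eventually (hm : 2 ≤ m) (hδ : 2 < δ) {p : ℂ × ℂ} {c : ℝ} (hc : 0 < c)
    (h : ∀ᶠ n in atTop, c ≤ ((scaled m δ n p).1 ^ m).re ∧ c ≤ ((scaled m δ n p).2 ^ m).re) :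
    p ∈ totalBasin m δ := by
  obtain ⟨N, hN⟩ := eventually_atTop.1 h
  have hδ0 : 0 < δ := by linarith
  have hexp : ∀ z : ℂ, 0 ≤ (z ^ m).re → ‖Complex.exp (-z ^ m)‖ ≤ 1 := fun z hz => by
    rw [Complex.norm_exp, Complex.neg_re]
    exact Real.exp_le_one_iff.2 (by linarith)
  have hstep : ∀ n, dist (scaled m δ (n + N) p) (scaled m δ (n + 1 + N) p) ≤ 1 / 2 / 2 ^ n := by
    intro n
    set y := (henon m δ)^[2 * (n + N)] p with hy
    have h1 : 0 ≤ (y.1 ^ m).re := by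
      rw [hy, (re_pow_scaled hδ _ p).1]
      exact mul_nonneg (by positivity) (hc.le.trans (hN _ (by omega)).1)
    have e2 : (henon m δ)^[2 * (n + 1 + N)] p = (henon m δ)^[2] y := by
      rw [hy, ← Function.iterate_add_apply]; congr 1; ring
    have h2 : 0 ≤ ((henon m δ y).1 ^ m).re := by
      have e3 : (henon m δ y).1 = ((henon m δ)^[2 * (n + 1 + N)] p).2 := by rw [e2]; rfl
      rw [e3, (re_pow_scaled hδ _ p).2]
      exact mul_nonneg (by positivity) (hc.le.trans (hN _ (by omega)).2)
    have e : (henon m δ)^[2] y - mult m δ • y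
        = (Complex.exp (-(henon m δ y).1 ^ m), Complex.exp (-y.1 ^ m)) := by
      ext <;> simp [henon_apply]
    have h3 : ‖(henon m δ)^[2] y - mult m δ • y‖ ≤ 1 := by
      rw [e]; exact max_le (hexp _ h2) (hexp _ h1)
    have e4 : scaled m δ (n + 1 + N) p - scaled m δ (n + N) p = (mult m δ ^ (n + 1 + N))⁻¹ •
        ((henon m δ)^[2] y - mult m δ • y) := by
      have ha := mult_ne_zero m hδ
      rw [smul_sub, smul_smul, scaled, scaled, e2]
      congr 2
      rw [show n + 1 + N = (n + N) + 1 by ring, pow_succ]; field_simp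
    rw [dist_comm, dist_eq_norm, e4, norm_smul, norm_inv, norm_pow, norm_mult m hδ]
    have h4 : (δ ^ (n + 1 + N))⁻¹ ≤ (2 ^ (n + 1))⁻¹ := by
      apply inv_anti₀ (by positivity)
      calc (2 : ℝ) ^ (n + 1) ≤ δ ^ (n + 1) := by gcongr
        _ ≤ δ ^ (n + 1 + N) := pow_le_pow_right₀ (by linarith) (by omega)
    calc _ ≤ (2 ^ (n + 1))⁻¹ * (1 : ℝ) := by gcongr
      _ = _ := by rw [pow_succ]; field_simp
  obtain ⟨v, hv⟩ := cauchySeq_tendsto_of_complete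
    (cauchySeq_of_le_geometric_two (f := fun n => scaled m δ (n + N) p) hstep)
  rw [tendsto_add_atTop_iff_nat (f := fun n => scaled m δ n p) N] at hv
  have hc1 : Continuous fun u : ℂ × ℂ => (u.1 ^ m).re := by fun_prop
  have hc2 : Continuous fun u : ℂ × ℂ => (u.2 ^ m).re := by fun_prop
  have h1 : c ≤ (v.1 ^ m).re :=
    ge_of_tendsto ((hc1.tendsto v).comp hv) (h.mono fun n hn => hn.1)
  have h2 : c ≤ (v.2 ^ m).re :=
    ge_of_tendsto ((hc2.tendsto v).comp hv) (h.mono fun n hn => hn.2)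
  obtain ⟨j, hj⟩ := exists_mem_wedge hm (hc.trans_le h1)
  obtain ⟨k, hk⟩ := exists_mem_wedge hm (hc.trans_le h2)
  exact mem_iUnion.2 ⟨(j, k), v, ⟨hj, hk⟩, hv⟩

/-- Exponential growth of the orbits on a disc `ℓ (B(0, ρ))` in a complex line, with `ρ > 1`,
implies by Harnack's inequality that `ℓ 0` is in a basin if `ℓ 1` is. -/
theorem mem_totalBasin_of_growth (hm : 2 ≤ m) (hδ : 2 < δ) {ℓ : ℂ → ℂ × ℂ}
    (hℓ : Differentiable ℂ ℓ) {ρ A C : ℝ} (hρ : 1 < ρ) (hC : 1 ≤ C) (hA : 0 ≤ A) {N : ℕ}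
    (hgrow : ∀ n ≥ N, ∀ t ∈ Metric.ball (0 : ℂ) ρ, ‖((henon m δ)^[n] (ℓ t)).1‖ ≤ A * C ^ n)
    (h1 : ℓ 1 ∈ totalBasin m δ) : ℓ 0 ∈ totalBasin m δ := by
  have hδ0 : 0 < δ := by linarith
  set B := A * C + δ * A + 1 with hB
  have hB1 : 1 ≤ B := by
    have : 0 ≤ A * C + δ * A := by positivity
    linarith
  -- the recursion bounds the real part of `-z_n ^ m` linearly in `n`
  have hre : ∀ n ≥ N + 1, ∀ t ∈ Metric.ball (0 : ℂ) ρ,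
      0 < (((henon m δ)^[n] (ℓ t)).1 ^ m).re + (Real.log B + n * Real.log C + 1) := by
    intro n hn t ht
    obtain ⟨k, rfl⟩ := Nat.exists_eq_add_of_le' (show 1 ≤ n by omega)
    set y := (henon m δ)^[k + 1] (ℓ t) with hy
    have h2 : y.2 = ((henon m δ)^[k] (ℓ t)).1 := by
      rw [hy, Function.iterate_succ_apply']; rfl
    have h3 : ((henon m δ)^[k + 1 + 1] (ℓ t)).1 = Complex.exp (-y.1 ^ m) + mult m δ * y.2 := by
      rw [Function.iterate_succ_apply']; rfl
    have h4 : Complex.exp (-y.1 ^ m)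
        = ((henon m δ)^[k + 1 + 1] (ℓ t)).1 - mult m δ * ((henon m δ)^[k] (ℓ t)).1 := by
      rw [h3, h2]; ring
    have h5 : ‖Complex.exp (-y.1 ^ m)‖ ≤ B * C ^ (k + 1) := by
      rw [h4]
      refine (norm_sub_le _ _).trans ?_
      rw [norm_mul, norm_mult m hδ]
      have e1 := hgrow (k + 1 + 1) (by omega) t ht
      have e2 := hgrow k (by omega) t ht
      have e3 : C ^ k ≤ C ^ (k + 1) := pow_le_pow_right₀ hC (by omega)
      have e4 : 0 < C ^ (k + 1) := by positivity
      calc _ ≤ A * C ^ (k + 1 + 1) + δ * (A * C ^ (k + 1)) := by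
            refine add_le_add e1 (mul_le_mul_of_nonneg_left (e2.trans ?_) hδ0.le)
            exact mul_le_mul_of_nonneg_left e3 hA
        _ ≤ B * C ^ (k + 1) := by rw [hB, pow_succ C (k + 1)]; nlinarith
    rw [Complex.norm_exp, Complex.neg_re] at h5
    have h6 := Real.log_le_log (Real.exp_pos _) h5
    rw [Real.log_exp, Real.log_mul (by positivity) (by positivity), Real.log_pow] at h6
    linarith
  set κ := (ρ - 1) / (ρ + 1) with hκ
  have hκ0 : 0 < κ := div_pos (by linarith) (by linarith)
  have hlogB := Real.log_nonneg hB1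
  have hlogC := Real.log_nonneg hC
  have hharnack : ∀ n ≥ N + 1, κ * (((henon m δ)^[n] (ℓ 1)).1 ^ m).re -
      (Real.log B + n * Real.log C + 1) ≤ (((henon m δ)^[n] (ℓ 0)).1 ^ m).re := by
    intro n hn
    have hd : Differentiable ℂ fun t => ((henon m δ)^[n] (ℓ t)).1 ^ m +
        ((Real.log B + n * Real.log C + 1 : ℝ) : ℂ) :=
      (((differentiable_iterate (differentiable_henon m δ) n).comp hℓ).fst.pow m).add_const _
    have := harnack hρ hd.differentiableOn fun t ht => by
      rw [Complex.add_re, Complex.ofReal_re]; exact hre n hn t ht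
    simp only [Complex.add_re, Complex.ofReal_re] at this
    rw [← hκ] at this
    have h0 : 0 ≤ κ * (Real.log B + n * Real.log C + 1) := by positivity
    linarith
  -- the linear term is negligible after rescaling
  have hsmall : Tendsto (fun n : ℕ => (Real.log B + (2 * n : ℕ) * Real.log C + 1) / (δ ^ m) ^ n)
      atTop (𝓝 0) := by
    have hq : 1 < δ ^ m := one_lt_pow₀ (by linarith) (by omega)
    have t1 := tendsto_pow_const_div_const_pow_of_one_lt 0 hq
    have t2 := tendsto_pow_const_div_const_pow_of_one_lt 1 hq
    have := (t1.const_mul (Real.log B + 1)).add (t2.const_mul (2 * Real.log C))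
    simp only [mul_zero, add_zero] at this
    refine this.congr fun n => ?_
    push_cast; ring
  obtain ⟨x, hx⟩ := mem_iUnion.1 h1
  have hw := wave_mem_wedgeProd hx
  have hlim := tendsto_scaled_of_mem_basin hx
  have hp1 := re_pow_pos_of_mem_wedge hm hw.1
  have hp2 := re_pow_pos_of_mem_wedge hm hw.2
  have hc1 : Continuous fun u : ℂ × ℂ => (u.1 ^ m).re := by fun_prop
  have hc2 : Continuous fun u : ℂ × ℂ => (u.2 ^ m).re := by fun_prop
  have l1 := (((hc1.tendsto _).comp hlim).const_mul κ).sub hsmall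
  have l2 := (((hc2.tendsto _).comp hlim).const_mul κ).sub hsmall
  rw [sub_zero] at l1 l2
  obtain ⟨c, hc0, hc⟩ := exists_between (lt_min (mul_pos hκ0 hp1) (mul_pos hκ0 hp2))
  refine mem_totalBasin_of_eventually hm hδ hc0 ?_
  filter_upwards [l1.eventually (lt_mem_nhds (hc.trans_le (min_le_left _ _))),
    l2.eventually (lt_mem_nhds (hc.trans_le (min_le_right _ _))),
    eventually_ge_atTop (N + 1)] with n h1n h2n hnN
  have hq : 0 < (δ ^ m) ^ n := by positivity
  have hsnd : ∀ t, ((henon m δ)^[2 * n] (ℓ t)).2 = ((henon m δ)^[2 * n - 1] (ℓ t)).1 := by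
    intro t
    conv_lhs => rw [show 2 * n = (2 * n - 1) + 1 by omega, Function.iterate_succ_apply']
    rfl
  have a1 := hharnack (2 * n) (by omega)
  have a2 := hharnack (2 * n - 1) (by omega)
  have hle : ((2 * n - 1 : ℕ) : ℝ) ≤ ((2 * n : ℕ) : ℝ) := by exact_mod_cast Nat.sub_le _ _
  have a3 : ((2 * n - 1 : ℕ) : ℝ) * Real.log C ≤ ((2 * n : ℕ) : ℝ) * Real.log C :=
    mul_le_mul_of_nonneg_right hle hlogC
  rw [← hsnd, ← hsnd, (re_pow_scaled hδ n _).2, (re_pow_scaled hδ n _).2] at a2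
  rw [(re_pow_scaled hδ n _).1, (re_pow_scaled hδ n _).1] at a1
  simp only [Function.comp] at h1n h2n
  set Λ := Real.log B + ((2 * n : ℕ) : ℝ) * Real.log C + 1
  constructor
  · refine h1n.le.trans ?_
    rw [sub_le_iff_le_add, ← sub_le_iff_le_add', le_div_iff₀ hq]
    linarith
  · refine h2n.le.trans ?_
    rw [sub_le_iff_le_add, ← sub_le_iff_le_add', le_div_iff₀ hq]
    linarith

/-- The basins are closed in the Fatou set. -/
theorem closure_basin_inter_fatouSet_subset (hm : 2 ≤ m) (hδ : 2 < δ) (x : ZMod m × ZMod m) :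
    closure (basin m δ x) ∩ fatouSet (henon m δ) ⊆ basin m δ x := by
  rintro p ⟨hpc, U₀, hU₀, hpU₀, hn₀⟩
  suffices hp : p ∈ totalBasin m δ by
    obtain ⟨y, hy⟩ := mem_iUnion.1 hp
    obtain ⟨q, hqy, hqx⟩ := mem_closure_iff.1 hpc _ (isOpen_basin hm hδ y) hy
    rwa [basin_eq_of_mem hm hqx hqy]
  obtain ⟨R₀, hR₀, hball₀⟩ := Metric.isOpen_iff.1 hU₀ p hpU₀
  set U := Metric.ball p R₀ with hU
  have hpU : p ∈ U := Metric.mem_ball_self hR₀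
  have hn : NormalIterates (henon m δ) U := fun k => by
    obtain ⟨s, hs, h, hh, hconv⟩ := hn₀ k
    refine ⟨s, hs, h, fun q hq => ?_, hconv.mono hball₀⟩
    obtain ⟨V, hV, hqV, -, H, hH⟩ := hh q (hball₀ hq)
    exact ⟨V ∩ U, hV.inter Metric.isOpen_ball, ⟨hqV, hq⟩, inter_subset_right, H,
      hH.1.mono inter_subset_left, fun y hy => hH.2 y hy.1⟩
  have hUc : IsPreconnected U := (convex_ball p R₀).isPreconnected
  set O := U ∩ basin m δ x with hO
  have hOo : IsOpen O := Metric.isOpen_ball.inter (isOpen_basin hm hδ x)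
  have hOne : O.Nonempty := mem_closure_iff.1 hpc _ Metric.isOpen_ball hpU
  have hOb : ∀ q ∈ O, q ∈ totalBasin m δ := fun q hq => basin_subset_totalBasin x hq.2
  -- the iterates of even and of odd order converge near `p`
  obtain ⟨h, hh, hhO, hhlim⟩ := hn.exists_limit hUc hOo inter_subset_left hOne
    (l := fun n => 2 * n) fun q hq => (iteratesTendsto_even hm hδ tendsto_id).tendsto (hOb q hq)
  obtain ⟨g, hg, hgO, hglim⟩ := hn.exists_limit hUc hOo inter_subset_left hOne
    (l := fun n => 2 * n + 1) fun q hq =>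
      (iteratesTendsto_odd hm hδ tendsto_id).tendsto (hOb q hq)
  obtain ⟨V, hV, hpV, hVU, H, hH⟩ := hh p hpU
  obtain ⟨V', hV', hpV', hVU', G, hG⟩ := hg p hpU
  obtain ⟨R, hR, hball⟩ := Metric.isOpen_iff.1 (hV.inter hV') p ⟨hpV, hpV'⟩
  obtain ⟨q, hqB, hqx⟩ := mem_closure_iff.1 hpc _ Metric.isOpen_ball (Metric.mem_ball_self hR)
  rcases eq_or_ne q p with rfl | hqp
  · exact basin_subset_totalBasin x hqx
  have hqp' : 0 < ‖q - p‖ := norm_pos_iff.2 (sub_ne_zero.2 hqp)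
  -- the complex line through `p` and a point `q` of the basin
  let ℓ : ℂ → ℂ × ℂ := fun t => p + t • (q - p)
  have hℓ : Differentiable ℂ ℓ := by fun_prop
  have hℓ0 : ℓ 0 = p := by simp [ℓ]
  have hℓ1 : ℓ 1 = q := by simp [ℓ]
  have hqB' : ‖q - p‖ < R := by rwa [mem_ball_iff_norm] at hqB
  have hℓB : ∀ t ∈ Metric.ball (0 : ℂ) (R / ‖q - p‖), ℓ t ∈ V ∩ V' := fun t ht => by
    apply hball
    rw [mem_ball_zero_iff, lt_div_iff₀ hqp'] at ht
    rw [mem_ball_iff_norm]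
    simpa [ℓ, norm_smul] using ht
  have hq0 : q ∈ V ∩ V' := hball hqB
  have hqO : q ∈ O := ⟨hVU hq0.1, hqx⟩
  have hd : DifferentiableOn ℂ (fun t => H (ℓ t) 1 * G (ℓ t) 1)
      (Metric.ball 0 (R / ‖q - p‖)) :=
    ((differentiableOn_euclidean.1 hH.1 1).comp hℓ.differentiableOn fun t ht => (hℓB t ht).1).mul
      ((differentiableOn_euclidean.1 hG.1 1).comp hℓ.differentiableOn fun t ht => (hℓB t ht).2)
  have hcoord : ∀ {v : E3} (hv : v ≠ 0) {u : ℂ × ℂ}, u.2 ≠ 0 →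
      Projectivization.mk ℂ v hv = direction u → v 1 ≠ 0 := by
    intro v hv u hu he h0
    rw [direction_of_ne_zero (vec3_ne_zero_of_snd hu), Projectivization.mk_eq_mk_iff'] at he
    obtain ⟨a, ha⟩ := he
    have ha0 : a = 0 := by
      have := congrArg (fun w : E3 => w 1) ha
      simpa [h0, hu] using this
    rw [ha0, zero_smul] at ha
    exact hv ha.symm
  have hne1 : H (ℓ 1) 1 * G (ℓ 1) 1 ≠ 0 := by
    rw [hℓ1]
    obtain ⟨hw1, hw2⟩ := wave_ne_zero hqx
    obtain ⟨a0, a1⟩ := hH.2 q hq0.1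
    obtain ⟨b0, b1⟩ := hG.2 q hq0.2
    exact mul_ne_zero (hcoord a0 hw2 (a1 ▸ hhO hqO)) (hcoord b0 (u := linearPart m δ (wave m δ q))
      hw1 (b1 ▸ hgO hqO))
  obtain ⟨ρ, hρ1, hρR, hρne⟩ := exists_circle_ne_zero ((one_lt_div hqp').2 hqB') hd hne1
  -- growth of the iterates on the circle of radius `ρ`
  set S := Metric.sphere (0 : ℂ) ρ with hS
  have hSsub : ∀ t ∈ S, t ∈ Metric.ball (0 : ℂ) (R / ‖q - p‖) := fun t ht => by
    rw [hS, mem_sphere_zero_iff_norm] at ht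
    rw [mem_ball_zero_iff, ht]; exact hρR
  have hK : IsCompact (ℓ '' S) := (isCompact_sphere _ _).image hℓ.continuous
  have hKV : ℓ '' S ⊆ V := by rintro _ ⟨t, ht, rfl⟩; exact (hℓB t (hSsub t ht)).1
  have hKV' : ℓ '' S ⊆ V' := by rintro _ ⟨t, ht, rfl⟩; exact (hℓB t (hSsub t ht)).2
  have hne : ∀ y ∈ ℓ '' S, H y 1 * G y 1 ≠ 0 := by
    rintro _ ⟨t, ht, rfl⟩
    exact hρne t (mem_sphere_zero_iff_norm.1 ht)
  obtain ⟨C₁, hC₁⟩ := exists_fst_le_mul_snd hH hK hKV (fun y hy => left_ne_zero_of_mul (hne y hy))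
    (hhlim _ (hKV.trans hVU) hK)
  obtain ⟨C₂, hC₂⟩ := exists_fst_le_mul_snd hG hK hKV' (fun y hy => right_ne_zero_of_mul (hne y hy))
    (hglim _ (hKV'.trans hVU') hK)
  obtain ⟨N, hN⟩ := eventually_atTop.1 (hC₁.and hC₂)
  set C := max 1 (max C₁ C₂) with hC
  have hC1 : 1 ≤ C := le_max_left _ _
  have hratio : ∀ n ≥ 2 * N, ∀ t ∈ S, ‖((henon m δ)^[n + 1] (ℓ t)).1‖ ≤
      C * ‖((henon m δ)^[n] (ℓ t)).1‖ := by
    intro n hnN t ht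
    have hsnd : ((henon m δ)^[n + 1] (ℓ t)).2 = ((henon m δ)^[n] (ℓ t)).1 := by
      rw [Function.iterate_succ_apply']; rfl
    rw [← hsnd]
    rcases Nat.even_or_odd' (n + 1) with ⟨k, hk | hk⟩
    · rw [hk]
      refine ((hN k (by omega)).1 _ (mem_image_of_mem _ ht)).trans ?_
      exact mul_le_mul_of_nonneg_right ((le_max_left _ _).trans (le_max_right _ _)) (norm_nonneg _)
    · rw [hk]
      refine ((hN k (by omega)).2 _ (mem_image_of_mem _ ht)).trans ?_
      exact mul_le_mul_of_nonneg_right ((le_max_right _ _).trans (le_max_right _ _)) (norm_nonneg _)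
  have hdiff : ∀ n, Differentiable ℂ fun t => ((henon m δ)^[n] (ℓ t)).1 := fun n =>
    ((differentiable_iterate (differentiable_henon m δ) n).comp hℓ).fst
  obtain ⟨A, hA⟩ := (isCompact_sphere (0 : ℂ) ρ).exists_bound_of_continuousOn
    (hdiff (2 * N)).continuous.continuousOn
  set A' := max A 0
  have hgrowS : ∀ k, ∀ t ∈ S, ‖((henon m δ)^[2 * N + k] (ℓ t)).1‖ ≤ A' * C ^ k := by
    intro k
    induction k with
    | zero => intro t ht; rw [add_zero, pow_zero, mul_one]; exact (hA t ht).trans (le_max_left A 0)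
    | succ k ih =>
      intro t ht
      refine (hratio (2 * N + k) (by omega) t ht).trans ?_
      calc _ ≤ C * (A' * C ^ k) := mul_le_mul_of_nonneg_left (ih t ht) (by linarith)
        _ = _ := by rw [pow_succ]; ring
  rw [← hℓ0]
  refine mem_totalBasin_of_growth hm hδ hℓ hρ1 hC1 (le_max_right A 0) (N := 2 * N) ?_
    (hℓ1 ▸ basin_subset_totalBasin x hqx)
  -- the maximum principle extends the bound to the disc
  intro n hnN t ht
  obtain ⟨k, rfl⟩ := Nat.exists_eq_add_of_le hnN
  have hA'0 : 0 ≤ A' := le_max_right A 0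
  have h1 : ‖((henon m δ)^[2 * N + k] (ℓ t)).1‖ ≤ A' * C ^ k := by
    refine Complex.norm_le_of_forall_mem_frontier_norm_le Metric.isBounded_ball
      (hdiff (2 * N + k)).diffContOnCl (fun s hs => ?_) (subset_closure ht)
    rw [frontier_ball _ (by linarith : ρ ≠ 0)] at hs
    exact hgrowS k s hs
  refine h1.trans (mul_le_mul_of_nonneg_left ?_ hA'0)
  exact pow_le_pow_right₀ hC1 (by omega)

theorem isFatouComponent_basin (hm : 2 ≤ m) (hδ : 2 < δ) (x : ZMod m × ZMod m) :
    IsFatouComponent (henon m δ) (basin m δ x) := by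
  obtain ⟨p, hp⟩ := basin_nonempty (δ := δ) hm hδ x
  have hsub := (basin_subset_totalBasin x).trans (totalBasin_subset_fatouSet hm hδ)
  refine ⟨p, hsub hp, Subset.antisymm ?_ ?_⟩
  · exact (isPreconnected_basin hm hδ x).subset_connectedComponentIn hp hsub
  · refine isPreconnected_connectedComponentIn.subset_of_closure_inter_subset
      (isOpen_basin hm hδ x) ⟨p, mem_connectedComponentIn (hsub hp), hp⟩ ?_
    exact (inter_subset_inter_right _ (connectedComponentIn_subset _ _)).trans
      (closure_basin_inter_fatouSet_subset hm hδ x)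

end Boundary

/-! ### The components as products of half-planes -/

section Components

variable {m : ℕ} [NeZero m] {δ : ℝ}

theorem isBiholomorphic_wedgeProd_halfPlaneSq (hm : 2 ≤ m) (x : ZMod m × ZMod m) :
    ∃ f g : ℂ × ℂ → ℂ × ℂ, DifferentiableOn ℂ f (wedgeProd m x) ∧
      DifferentiableOn ℂ g halfPlaneSq ∧ MapsTo f (wedgeProd m x) halfPlaneSq ∧
      MapsTo g halfPlaneSq (wedgeProd m x) ∧ InvOn g f (wedgeProd m x) halfPlaneSq := by
  have hre : ∀ u : ℂ, (-Complex.I * u).re = u.im := fun u => by simp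
  have him : ∀ u : ℂ, (Complex.I * u).im = u.re := fun u => by simp
  have hI : ∀ u : ℂ, -Complex.I * (Complex.I * u) = u := fun u => by
    rw [← mul_assoc, neg_mul, Complex.I_mul_I]; simp
  have hI' : ∀ u : ℂ, Complex.I * (-Complex.I * u) = u := fun u => by
    rw [← mul_assoc, mul_neg, Complex.I_mul_I]; simp
  let f₁ : ℂ → ℂ := fun z => Complex.I * z ^ m
  let g₁ : ZMod m → ℂ → ℂ := fun j u => rot m j * (-Complex.I * u) ^ ((m : ℂ)⁻¹)
  have hf : ∀ {j z}, z ∈ wedge m j → 0 < (f₁ z).im := fun hz => by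
    simp only [f₁, him]; exact re_pow_pos_of_mem_wedge hm hz
  have hg : ∀ {j u}, 0 < u.im → g₁ j u ∈ wedge m j := fun hu =>
    rot_mul_mem_wedge.2 (cpow_mem_cone hm (by rwa [hre]))
  have hgf : ∀ {j z}, z ∈ wedge m j → g₁ j (f₁ z) = z := fun hz => by
    simp only [f₁, g₁, hI]; exact wedge_root hm hz
  have hfg : ∀ {j u}, 0 < u.im → f₁ (g₁ j u) = u := fun {j u} _ => by
    simp only [f₁, g₁]
    rw [pow_rot_mul, Complex.cpow_nat_inv_pow _ (NeZero.ne m), hI']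
  have hgd : ∀ j, ∀ u : ℂ, 0 < u.im → DifferentiableAt ℂ (g₁ j) u := fun j u hu => by
    refine DifferentiableAt.const_mul (DifferentiableAt.cpow_const
      (differentiableAt_id.const_mul _) (Or.inl ?_)) _
    change 0 < (-Complex.I * u).re
    rw [hre]; exact hu
  refine ⟨fun p => (f₁ p.1, f₁ p.2), fun p => (g₁ x.1 p.1, g₁ x.2 p.2), by fun_prop,
    fun p hp => ?_, fun p hp => ⟨hf hp.1, hf hp.2⟩, fun p hp => ⟨hg hp.1, hg hp.2⟩,
    fun p hp => Prod.ext (hgf hp.1) (hgf hp.2), fun p hp => Prod.ext (hfg hp.1) (hfg hp.2)⟩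
  exact (((hgd x.1 p.1 hp.1).comp p differentiableAt_fst).prodMk
    ((hgd x.2 p.2 hp.2).comp p differentiableAt_snd)).differentiableWithinAt

theorem exists_isBiholomorphic_halfPlaneSq (hm : 2 ≤ m) (hδ : 2 < δ) (x : ZMod m × ZMod m) :
    ∃ φ : ℂ × ℂ → ℂ × ℂ, IsBiholomorphic φ (basin m δ x) halfPlaneSq := by
  obtain ⟨f, g, hf, hg, hfm, hgm, hinv⟩ := isBiholomorphic_wedgeProd_halfPlaneSq hm x
  obtain ⟨hA, -, hφ, hbij, ψ, hψ, hψinv⟩ := isBiholomorphic_wave (δ := δ) hm hδ x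
  have hψm : MapsTo ψ (wedgeProd m x) (basin m δ x) := hψinv.1.mapsTo hbij.surjOn
  have hopen : IsOpen halfPlaneSq :=
    (isOpen_lt continuous_const (Complex.continuous_im.comp continuous_fst)).inter
      (isOpen_lt continuous_const (Complex.continuous_im.comp continuous_snd))
  exact ⟨f ∘ wave m δ, hA, hopen, hf.comp hφ hbij.mapsTo,
    (hinv.bijOn hfm hgm).comp hbij, ψ ∘ g, hψ.comp hg hgm,
    hψinv.comp hinv hbij.mapsTo hgm⟩

/-! ### The cycles -/

/-- The indices of the components of a cycle: the difference of the two indices is `d` or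
`1 - d`. -/
def cycleIndex (d : ZMod m) : Set (ZMod m × ZMod m) := {x | x.1 - x.2 = d ∨ x.1 - x.2 = 1 - d}

theorem basin_injective (hm : 2 ≤ m) (hδ : 2 < δ) : Function.Injective (basin m δ) := by
  intro x y h
  obtain ⟨p, hp⟩ := basin_nonempty (δ := δ) hm hδ x
  exact basin_eq_of_mem hm hp (h ▸ hp)

omit [NeZero m] in
theorem step_iterate_two_mul_add_one (x : ZMod m × ZMod m) (n : ℕ) :
    step^[2 * n + 1] x = (x.2 + n + 1, x.1 + n) := by
  rw [Function.iterate_succ_apply', step_iterate_two_mul]; rfl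

theorem exists_iterate_of_mem_cycleIndex {x y : ZMod m × ZMod m} {d : ZMod m}
    (hx : x.1 - x.2 = d) : y ∈ cycleIndex d ↔ ∃ n, step^[n] x = y := by
  constructor
  · rintro (h | h)
    · refine ⟨2 * (y.1 - x.1).val, ?_⟩
      rw [step_iterate_two_mul, ZMod.natCast_zmod_val]
      ext
      · simp
      · simp only; linear_combination h - hx
    · refine ⟨2 * (y.2 - x.1).val + 1, ?_⟩
      rw [step_iterate_two_mul_add_one, ZMod.natCast_zmod_val]
      ext
      · simp only; linear_combination -hx - h
      · simp
  · rintro ⟨n, rfl⟩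
    rcases Nat.even_or_odd' n with ⟨k, rfl | rfl⟩
    · left; rw [step_iterate_two_mul]; simp only; linear_combination hx
    · right; rw [step_iterate_two_mul_add_one]; simp only; linear_combination -hx

theorem ne_one_sub_of_even (hm : Even m) (d : ZMod m) : d ≠ 1 - d := by
  intro h
  obtain ⟨k, hk⟩ := hm
  have h2 : (2 : ZMod m) * d = 1 := by linear_combination h
  have h3 : ((k : ℕ) : ZMod m) = 0 := by
    have h4 : (k : ZMod m) + k = 0 := by
      rw [← Nat.cast_add, ZMod.natCast_eq_zero_iff, ← hk]
    linear_combination d * h4 - (k : ZMod m) * h2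
  rw [ZMod.natCast_eq_zero_iff] at h3
  have hm0 := NeZero.ne m
  have := Nat.le_of_dvd (by omega) h3
  omega

/-- The period of an index is `m` if the two sectors of the limit sets coincide, and `2 m`
otherwise. -/
theorem minimalPeriod_step {x : ZMod m × ZMod m} {d : ZMod m} (hx : x.1 - x.2 = d) :
    Function.minimalPeriod step x = if d = 1 - d then m else 2 * m := by
  have heven : ∀ k : ℕ, step^[2 * k] x = x ↔ m ∣ k := fun k => by
    rw [step_iterate_two_mul, ← ZMod.natCast_eq_zero_iff]
    refine ⟨fun h => by simpa using congrArg Prod.fst h, fun h => by rw [h]; simp⟩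
  have hodd : ∀ k : ℕ, step^[2 * k + 1] x = x ↔ d = 1 - d ∧ m ∣ 2 * k + 1 := fun k => by
    rw [step_iterate_two_mul_add_one, ← ZMod.natCast_eq_zero_iff]
    push_cast
    constructor
    · intro h
      have h1 := congrArg Prod.fst h
      have h2 := congrArg Prod.snd h
      simp only at h1 h2
      exact ⟨by linear_combination -2 * hx - h1 + h2,
        by linear_combination h1 + h2⟩
    · rintro ⟨h1, h2⟩
      -- `2` is invertible, since `2 d = 1`
      have h3 : (k : ZMod m) = d - 1 := by linear_combination (-(k : ZMod m) - 1) * h1 + d * h2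
      ext
      · simp only; linear_combination h3 - hx
      · simp only; linear_combination h3 + hx + h1
  refine Nat.dvd_antisymm ?_ ?_
  · rw [← Function.isPeriodicPt_iff_minimalPeriod_dvd]
    split_ifs with h
    · obtain ⟨k, hk⟩ : Odd m := by
        by_contra hev
        exact ne_one_sub_of_even (Nat.not_odd_iff_even.1 hev) d h
      have := (hodd k).2 ⟨h, by rw [← hk]⟩
      rw [← hk] at this
      exact this
    · exact (heven m).2 dvd_rfl
  · have hper : step^[Function.minimalPeriod step x] x = x :=
      Function.iterate_minimalPeriod
    rcases Nat.even_or_odd' (Function.minimalPeriod step x) with ⟨k, hk | hk⟩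
    · rw [hk] at hper ⊢
      have := (heven k).1 hper
      split_ifs
      · exact this.mul_left 2
      · exact Nat.mul_dvd_mul_left 2 this
    · rw [hk] at hper ⊢
      obtain ⟨h1, h2⟩ := (hodd k).1 hper
      rw [if_pos h1]; exact h2

/-- The cycle of components with difference of indices `d` or `1 - d`. -/
def cycle (m : ℕ) [NeZero m] (δ : ℝ) (d : ZMod m) : Set (Set (ℂ × ℂ)) :=
  basin m δ '' cycleIndex d

theorem IsCycle.ncard {F : ℂ × ℂ → ℂ × ℂ} {p : ℕ} {Z : Set (Set (ℂ × ℂ))} (h : IsCycle F p Z) :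
    Z.ncard = p := by
  obtain ⟨hp, c, hc, rfl, -⟩ := h
  rw [← image_univ, ncard_image_of_injective _ hc, ncard_univ, Nat.card_zmod]

theorem isCycle_cycle (hm : 2 ≤ m) (hδ : 2 < δ) (d : ZMod m) :
    IsCycle (henon m δ) (if d = 1 - d then m else 2 * m) (cycle m δ d) := by
  set x : ZMod m × ZMod m := (d, 0) with hxdef
  have hx : x.1 - x.2 = d := by simp [hxdef]
  rw [← minimalPeriod_step hx]
  set P := Function.minimalPeriod step x with hP
  have hP0 : 0 < P := by
    rw [hP, minimalPeriod_step hx]; split_ifs <;> omega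
  have : NeZero P := ⟨hP0.ne'⟩
  refine ⟨hP0, fun i => basin m δ (step^[i.val] x), ?_, ?_, fun i => isFatouComponent_basin hm hδ _,
    fun i => ?_⟩
  · intro i j hij
    have h1 := basin_injective hm hδ hij
    rw [Function.iterate_eq_iterate_iff_of_lt_minimalPeriod (ZMod.val_lt i) (ZMod.val_lt j)] at h1
    exact ZMod.val_injective P h1
  · apply Subset.antisymm
    · rintro _ ⟨i, rfl⟩
      exact mem_image_of_mem _ ((exists_iterate_of_mem_cycleIndex hx).2 ⟨_, rfl⟩)
    · rintro _ ⟨y, hy, rfl⟩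
      obtain ⟨n, rfl⟩ := (exists_iterate_of_mem_cycleIndex hx).1 hy
      refine ⟨(n : ZMod P), ?_⟩
      simp only [ZMod.val_natCast]
      rw [Function.iterate_mod_minimalPeriod_eq]
  · change _ = basin m δ (step^[(i + 1).val] x)
    rw [henon_image_basin hm hδ, ← Function.iterate_succ_apply' step,
      ← Function.iterate_mod_minimalPeriod_eq, ← hP, ZMod.val_add, ZMod.val_one_eq_one_mod,
      Nat.add_mod_mod]

theorem isCycle_cycle_iff (hm : 2 ≤ m) (hδ : 2 < δ) (d : ZMod m) (p : ℕ) :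
    IsCycle (henon m δ) p (cycle m δ d) ↔ p = if d = 1 - d then m else 2 * m := by
  refine ⟨fun h => ?_, fun h => h ▸ isCycle_cycle hm hδ d⟩
  rw [← h.ncard, (isCycle_cycle hm hδ d).ncard]

theorem isCycle_two_mul_iff (hm : 2 ≤ m) (hδ : 2 < δ) (d : ZMod m) :
    IsCycle (henon m δ) (2 * m) (cycle m δ d) ↔ d ≠ 1 - d := by
  rw [isCycle_cycle_iff hm hδ]
  split_ifs with h
  · exact iff_of_false (by omega) (not_not.2 h)
  · exact iff_of_true rfl h

theorem isCycle_iff (hm : 2 ≤ m) (hδ : 2 < δ) (d : ZMod m) :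
    IsCycle (henon m δ) m (cycle m δ d) ↔ d = 1 - d := by
  rw [isCycle_cycle_iff hm hδ]
  split_ifs with h
  · exact iff_of_true rfl h
  · exact iff_of_false (by omega) h

omit [NeZero m] in
theorem cycleIndex_eq_of_mem {x : ZMod m × ZMod m} {d e : ZMod m} (hd : x ∈ cycleIndex d)
    (he : x ∈ cycleIndex e) : cycleIndex d = cycleIndex e := by
  have key : e = d ∨ e = 1 - d := by
    rcases hd with hd | hd <;> rcases he with he | he
    · left; linear_combination hd - he
    · right; linear_combination he - hd
    · right; linear_combination hd - he
    · left; linear_combination he - hd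
  rcases key with rfl | rfl
  · rfl
  · ext y
    simp only [cycleIndex, mem_ofPred_eq, sub_sub_cancel]
    exact or_comm

theorem pairwiseDisjoint_cycle (hm : 2 ≤ m) (hδ : 2 < δ) :
    (range (cycle m δ)).PairwiseDisjoint id := by
  rintro _ ⟨d, rfl⟩ _ ⟨e, rfl⟩ hne
  rw [Function.onFun, id, id, Set.disjoint_left]
  rintro _ ⟨x, hx, rfl⟩ ⟨y, hy, hxy⟩
  obtain rfl := basin_injective hm hδ hxy
  exact hne (congrArg (basin m δ '' ·) (cycleIndex_eq_of_mem hx hy))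

theorem sUnion_range_cycle : ⋃₀ range (cycle m δ) = range (basin m δ) := by
  ext Ω
  constructor
  · rintro ⟨_, ⟨d, rfl⟩, x, -, rfl⟩
    exact mem_range_self x
  · rintro ⟨x, rfl⟩
    exact ⟨_, mem_range_self (x.1 - x.2), mem_image_of_mem _ (Or.inl rfl)⟩

theorem ncard_sUnion_range_cycle (hm : 2 ≤ m) (hδ : 2 < δ) :
    (⋃₀ range (cycle m δ)).ncard = m ^ 2 := by
  rw [sUnion_range_cycle, ← image_univ, ncard_image_of_injective _ (basin_injective hm hδ),
    ncard_univ, Nat.card_prod, Nat.card_zmod, sq]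

theorem ncard_sUnion_of_ncard_eq {α : Type*} {A : Set (Set α)} (hA : A.Finite) {n : ℕ}
    (hn : ∀ Z ∈ A, Z.Finite ∧ Z.ncard = n) (hd : A.PairwiseDisjoint id) :
    (⋃₀ A).ncard = A.ncard * n := by
  rw [sUnion_eq_biUnion, hA.ncard_biUnion (fun Z hZ => (hn Z hZ).1) hd,
    finsum_mem_congr rfl (fun Z hZ => (hn Z hZ).2), finsum_mem_eq_finite_toFinset_sum _ hA,
    Finset.sum_const, ncard_eq_toFinset_card A hA, smul_eq_mul]

theorem finite_range_cycle : (range (cycle m δ)).Finite := finite_range _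

theorem finite_cycle (d : ZMod m) : (cycle m δ d).Finite := (toFinite _).image _

omit [NeZero m] in
theorem exists_eq_one_sub_of_odd (hm : Odd m) : ∃ d₀ : ZMod m, ∀ d, d = 1 - d ↔ d = d₀ := by
  obtain ⟨k, hk⟩ := hm
  have h : (2 : ZMod m) * k + 1 = 0 := by
    have h1 := congrArg (Nat.cast : ℕ → ZMod m) hk
    rw [ZMod.natCast_self] at h1
    push_cast at h1
    exact h1.symm
  refine ⟨-k, fun d => ⟨fun hd => ?_, ?_⟩⟩
  · linear_combination d * h - (k : ZMod m) * hd
  · rintro rfl; linear_combination -h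

theorem ncard_range_cycle_of_even (hm : 2 ≤ m) (hδ : 2 < δ) (he : Even m) :
    (range (cycle m δ)).ncard = m / 2 := by
  have h1 : ∀ Z ∈ range (cycle m δ), Z.Finite ∧ Z.ncard = 2 * m := by
    rintro _ ⟨d, rfl⟩
    exact ⟨finite_cycle d, ((isCycle_two_mul_iff hm hδ d).2 (ne_one_sub_of_even he d)).ncard⟩
  have h2 := ncard_sUnion_of_ncard_eq finite_range_cycle h1 (pairwiseDisjoint_cycle hm hδ)
  rw [ncard_sUnion_range_cycle hm hδ] at h2
  have h3 : (range (cycle m δ)).ncard * 2 = m :=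
    Nat.eq_of_mul_eq_mul_right (by omega : 0 < m) (by linarith)
  omega

theorem ncard_range_cycle_of_odd (hm : 2 ≤ m) (hδ : 2 < δ) (ho : Odd m) :
    {Z ∈ range (cycle m δ) | IsCycle (henon m δ) (2 * m) Z}.ncard = (m - 1) / 2 ∧
      {Z ∈ range (cycle m δ) | IsCycle (henon m δ) m Z}.ncard = 1 := by
  obtain ⟨d₀, hd₀⟩ := exists_eq_one_sub_of_odd ho
  set A := {Z ∈ range (cycle m δ) | IsCycle (henon m δ) (2 * m) Z} with hA
  set B := {Z ∈ range (cycle m δ) | IsCycle (henon m δ) m Z} with hB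
  have hAr : A ⊆ range (cycle m δ) := sep_subset _ _
  have hBr : B ⊆ range (cycle m δ) := sep_subset _ _
  have hAf := finite_range_cycle.subset hAr
  have hBf := finite_range_cycle.subset hBr
  have hfin : ∀ Z ∈ range (cycle m δ), Z.Finite := by rintro _ ⟨d, rfl⟩; exact finite_cycle d
  have hB1 : B = {cycle m δ d₀} := by
    ext Z
    constructor
    · rintro ⟨⟨d, rfl⟩, h⟩
      rw [(hd₀ d).1 ((isCycle_iff hm hδ d).1 h)]; rfl
    · rintro rfl
      exact ⟨mem_range_self _, (isCycle_iff hm hδ _).2 ((hd₀ _).2 rfl)⟩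
  have hBc : B.ncard = 1 := by rw [hB1, ncard_singleton]
  have hAB : range (cycle m δ) = A ∪ B := by
    refine Subset.antisymm ?_ (union_subset hAr hBr)
    rintro _ ⟨d, rfl⟩
    by_cases h : d = 1 - d
    · exact Or.inr ⟨mem_range_self d, (isCycle_iff hm hδ d).2 h⟩
    · exact Or.inl ⟨mem_range_self d, (isCycle_two_mul_iff hm hδ d).2 h⟩
  have hdisj : Disjoint (⋃₀ A) (⋃₀ B) := by
    rw [disjoint_sUnion_left]
    intro Z hZ
    rw [disjoint_sUnion_right]
    intro W hW
    refine pairwiseDisjoint_cycle hm hδ hZ.1 hW.1 ?_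
    rintro rfl
    have := hZ.2.ncard.symm.trans hW.2.ncard
    omega
  have h2 := ncard_sUnion_range_cycle (δ := δ) hm hδ
  rw [hAB, sUnion_union, ncard_union_eq hdisj (hAf.sUnion fun Z hZ => hfin Z hZ.1)
    (hBf.sUnion fun Z hZ => hfin Z hZ.1),
    ncard_sUnion_of_ncard_eq hAf (fun Z hZ => ⟨hfin Z hZ.1, hZ.2.ncard⟩)
      ((pairwiseDisjoint_cycle hm hδ).subset hAr),
    ncard_sUnion_of_ncard_eq hBf (fun Z hZ => ⟨hfin Z hZ.1, hZ.2.ncard⟩)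
      ((pairwiseDisjoint_cycle hm hδ).subset hBr), hBc] at h2
  have h3 : A.ncard * 2 + 1 = m :=
    Nat.eq_of_mul_eq_mul_right (by omega : 0 < m) (by linarith)
  exact ⟨by omega, hBc⟩

/-- The limit sets on a component of the cycle of `d` are the sectors of indices `d` and
`1 - d`. -/
theorem limit_sets (hm : 2 ≤ m) (hδ : 2 < δ) {d : ZMod m} {x : ZMod m × ZMod m}
    (hx : x ∈ cycleIndex d) :
    IsHyperbolic (evenLimit m δ '' basin m δ x) ∧ IsHyperbolic (oddLimit m δ '' basin m δ x) ∧
      (∃ j < m, ∃ k < m, j + k ≡ 1 [MOD m] ∧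
        evenLimit m δ '' basin m δ x = sectorAtInfinity m j ∧
        oddLimit m δ '' basin m δ x = sectorAtInfinity m k) ∧
      (d ≠ 1 - d → Disjoint (evenLimit m δ '' basin m δ x) (oddLimit m δ '' basin m δ x)) ∧
      (d = 1 - d → evenLimit m δ '' basin m δ x = oddLimit m δ '' basin m δ x) := by
  rw [evenLimit_image hm hδ (ZMod.natCast_zmod_val _),
    oddLimit_image hm hδ (ZMod.natCast_zmod_val _)]
  have hiff : x.1 - x.2 = 1 - (x.1 - x.2) ↔ d = 1 - d := by
    rcases hx with h | h
    · rw [h]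
    · rw [h]
      exact ⟨fun h => by linear_combination -h, fun h => by linear_combination -h⟩
  generalize x.1 - x.2 = e at hiff
  refine ⟨isHyperbolic_sectorAtInfinity hm _, isHyperbolic_sectorAtInfinity hm _,
    ⟨_, ZMod.val_lt e, _, ZMod.val_lt (1 - e), ?_, rfl, rfl⟩, fun h => ?_, fun h => ?_⟩
  · rw [← ZMod.natCast_eq_natCast_iff]
    simp
  · refine disjoint_sectorAtInfinity hm ?_
    rw [ZMod.natCast_zmod_val, ZMod.natCast_zmod_val]
    exact fun h' => h (hiff.1 h')
  · rw [← hiff.2 h]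

end Components
end HenonFatou

theorem theorem1 (m : ℕ) (hm : 2 ≤ m) (δ : ℝ) (hδ : 2 < δ) :
    ∃ 𝒵 : Set (Set (Set (ℂ × ℂ))),
      -- `𝒵` is a collection of disjoint cycles, with `m ^ 2` components altogether
      𝒵.PairwiseDisjoint id ∧ (⋃₀ 𝒵).ncard = m ^ 2 ∧
      (∀ Ω ∈ ⋃₀ 𝒵, HenonFatou.IsFatouComponent (HenonFatou.henon m δ) Ω ∧
        HenonFatou.IsEscaping (HenonFatou.henon m δ) Ω) ∧
      -- number and periods of the cycles
      (Even m → 𝒵.ncard = m / 2 ∧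
        ∀ Z ∈ 𝒵, HenonFatou.IsCycle (HenonFatou.henon m δ) (2 * m) Z) ∧
      (Odd m →
        {Z ∈ 𝒵 | HenonFatou.IsCycle (HenonFatou.henon m δ) (2 * m) Z}.ncard = (m - 1) / 2 ∧
        {Z ∈ 𝒵 | HenonFatou.IsCycle (HenonFatou.henon m δ) m Z}.ncard = 1 ∧
        ∀ Z ∈ 𝒵, HenonFatou.IsCycle (HenonFatou.henon m δ) (2 * m) Z ∨
          HenonFatou.IsCycle (HenonFatou.henon m δ) m Z) ∧
      -- limit functions and limit sets
      (∀ Z ∈ 𝒵, ∃ h₁ h₂ : ℂ × ℂ → HenonFatou.P2,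
        HenonFatou.IsLimitFunction (HenonFatou.henon m δ) (⋃₀ Z) h₁ ∧
        HenonFatou.IsLimitFunction (HenonFatou.henon m δ) (⋃₀ Z) h₂ ∧
        (∀ h, HenonFatou.IsLimitFunction (HenonFatou.henon m δ) (⋃₀ Z) h →
          Set.EqOn h h₁ (⋃₀ Z) ∨ Set.EqOn h h₂ (⋃₀ Z)) ∧
        ∀ Ω ∈ Z,
          ¬ Set.EqOn h₁ h₂ Ω ∧
          (∀ h, HenonFatou.IsLimitFunction (HenonFatou.henon m δ) Ω h →
            Set.EqOn h h₁ Ω ∨ Set.EqOn h h₂ Ω) ∧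
          HenonFatou.HasGenericRank h₁ Ω 1 ∧ HenonFatou.HasGenericRank h₂ Ω 1 ∧
          h₁ '' Ω ⊆ HenonFatou.lineAtInfinity ∧ h₂ '' Ω ⊆ HenonFatou.lineAtInfinity ∧
          HenonFatou.IsHyperbolic (h₁ '' Ω) ∧ HenonFatou.IsHyperbolic (h₂ '' Ω) ∧
          (∃ j < m, ∃ k < m, j + k ≡ 1 [MOD m] ∧
            h₁ '' Ω = HenonFatou.sectorAtInfinity m j ∧
            h₂ '' Ω = HenonFatou.sectorAtInfinity m k) ∧
          (HenonFatou.IsCycle (HenonFatou.henon m δ) (2 * m) Z → Disjoint (h₁ '' Ω) (h₂ '' Ω)) ∧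
          (HenonFatou.IsCycle (HenonFatou.henon m δ) m Z → h₁ '' Ω = h₂ '' Ω)) ∧
      -- conjugacy to the linear map on the union of the components
      (∃ (φ : ℂ × ℂ → ℂ × ℂ) (B : Set (ℂ × ℂ)),
        HenonFatou.IsBiholomorphic φ (⋃₀ ⋃₀ 𝒵) B ∧
        HenonFatou.henon m δ '' (⋃₀ ⋃₀ 𝒵) = ⋃₀ ⋃₀ 𝒵 ∧
        HenonFatou.linearPart m δ '' B = B ∧
        ∀ p ∈ ⋃₀ ⋃₀ 𝒵, φ (HenonFatou.henon m δ p) = HenonFatou.linearPart m δ (φ p)) ∧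
      -- each component is a product of half-planes
      ∀ Ω ∈ ⋃₀ 𝒵, ∃ φ : ℂ × ℂ → ℂ × ℂ,
        HenonFatou.IsBiholomorphic φ Ω HenonFatou.halfPlaneSq := by
  have : NeZero m := ⟨by omega⟩
  have htot : ⋃₀ ⋃₀ range (HenonFatou.cycle m δ) = HenonFatou.totalBasin m δ := by
    rw [HenonFatou.sUnion_range_cycle, sUnion_range]; rfl
  have hcomp : ∀ Ω ∈ ⋃₀ range (HenonFatou.cycle m δ), ∃ x, HenonFatou.basin m δ x = Ω := by
    rw [HenonFatou.sUnion_range_cycle]; exact fun Ω h => h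
  refine ⟨range (HenonFatou.cycle m δ), HenonFatou.pairwiseDisjoint_cycle hm hδ,
    HenonFatou.ncard_sUnion_range_cycle hm hδ, fun Ω hΩ => ?_, fun he => ⟨?_, ?_⟩,
    fun ho => ⟨(HenonFatou.ncard_range_cycle_of_odd hm hδ ho).1,
      (HenonFatou.ncard_range_cycle_of_odd hm hδ ho).2, ?_⟩, ?_,
    ⟨HenonFatou.wave m δ, ⋃ x, HenonFatou.wedgeProd m x, ?_, ?_,
      HenonFatou.linearPart_image hm hδ, fun p hp => ?_⟩, fun Ω hΩ => ?_⟩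
  · obtain ⟨x, rfl⟩ := hcomp Ω hΩ
    exact ⟨HenonFatou.isFatouComponent_basin hm hδ x, HenonFatou.isEscaping_basin hm hδ x⟩
  · exact HenonFatou.ncard_range_cycle_of_even hm hδ he
  · rintro _ ⟨d, rfl⟩
    exact (HenonFatou.isCycle_two_mul_iff hm hδ d).2 (HenonFatou.ne_one_sub_of_even he d)
  · rintro _ ⟨d, rfl⟩
    by_cases h : d = 1 - d
    · exact Or.inr ((HenonFatou.isCycle_iff hm hδ d).2 h)
    · exact Or.inl ((HenonFatou.isCycle_two_mul_iff hm hδ d).2 h)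
  · rintro _ ⟨d, rfl⟩
    have hsub : ⋃₀ HenonFatou.cycle m δ d ⊆ HenonFatou.totalBasin m δ := by
      rw [← htot]
      exact sUnion_subset_sUnion (subset_sUnion_of_mem (mem_range_self d))
    have hopen : IsOpen (⋃₀ HenonFatou.cycle m δ d) := by
      refine isOpen_sUnion ?_
      rintro _ ⟨x, -, rfl⟩
      exact HenonFatou.isOpen_basin hm hδ x
    refine ⟨HenonFatou.evenLimit m δ, HenonFatou.oddLimit m δ,
      HenonFatou.isLimitFunction_evenLimit hm hδ hopen hsub,
      HenonFatou.isLimitFunction_oddLimit hm hδ hopen hsub,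
      fun h hh => HenonFatou.eqOn_evenLimit_or_oddLimit hm hδ hsub hh, ?_⟩
    rintro _ ⟨x, hx, rfl⟩
    obtain ⟨h1, h2, h3, h4, h5⟩ := HenonFatou.limit_sets (δ := δ) hm hδ hx
    exact ⟨HenonFatou.not_eqOn_evenLimit_oddLimit hm hδ x,
      fun h hh => HenonFatou.eqOn_evenLimit_or_oddLimit hm hδ
        (HenonFatou.basin_subset_totalBasin x) hh,
      HenonFatou.hasGenericRank_evenLimit hm hδ x, HenonFatou.hasGenericRank_oddLimit hm hδ x,
      HenonFatou.evenLimit_image_subset hm hδ x, HenonFatou.oddLimit_image_subset hm hδ x,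
      h1, h2, h3, fun hZ => h4 ((HenonFatou.isCycle_two_mul_iff hm hδ d).1 hZ),
      fun hZ => h5 ((HenonFatou.isCycle_iff hm hδ d).1 hZ)⟩
  · rw [htot]; exact HenonFatou.isBiholomorphic_wave_totalBasin hm hδ
  · rw [htot]; exact HenonFatou.henon_image_totalBasin hm hδ
  · rw [htot] at hp
    obtain ⟨x, hx⟩ := mem_iUnion.1 hp
    exact HenonFatou.wave_henon hm hδ hx
  · obtain ⟨x, rfl⟩ := hcomp Ω hΩ
    exact HenonFatou.exists_isBiholomorphic_halfPlaneSq hm hδ x
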